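/- Let $n\ge 4$. On $\mathbf{CP}^1\times\mathbf{CP}^1$, with affine coordinates $(x,y)$, consider the real structure $(x,y)\mapsto(\bar x,-1/\bar y)$ (complex conjugation on the first factor, anti-podal map on the second); conjugates of points and curves are denoted by a bar. Let $C_1\in|\mathscr O(1,0)|$ be a non-real curve, i.e. $C_1=\{x=c\}$ with $c\in\mathbf C\setminus\mathbf R$, so that $\overline C_1=\{x=\bar c\}$, and let $p_1,\dots,p_{n-1}\in C_1$ be distinct points. Let $S'$ be the blow-up of $\mathbf{CP}^1\times\mathbf{CP}^1$ at $p_1,\dots,p_{n-1},\overline p_1,\dots,\overline p_{n-1}$. The $\mathbf C^*$-action on $\mathbf{CP}^1\times\mathbf{CP}^1$ that is trivial on the second factor and fixes $C_1$ and $\overline C_1$ pointwise (given by $\frac{x-c}{x-\bar c}\mapsto t\,\frac{x-c}{x-\bar c}$, $t\in\mathbf C^*$) lifts to $S'$. Let $q\in S'$ be an isolated fixed point of this action that lies on the exceptional curve over one of the points $p_k$, let $\overline q$ be its conjugate, and let $S$ be the blow-up of $S'$ at $q$ and $\overline q$. Curves and their strict transforms are denoted by the same letter. Let $C_2$ be the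 exceptional curve of $S'\to\mathbf{CP}^1\times\mathbf{CP}^1$ over $p_k$, and let $C_4$ be the member of $|\mathscr O(0,1)|$ through $p_k$; assume that $C_4$ contains none of the points $\overline p_1,\dots,\overline p_{n-1}$. Then: (i) The fixed component of the bi-anticanonical system $|-2K_S|$ is $2C_1+C_2+C_4+2\overline C_1+\overline C_2+\overline C_4$. (ii) The movable part of $|-2K_S|$ (what remains after removing the fixed component) is base-point free and 2-dimensional, i.e. its space of sections has dimension $3$, and the image of the associated morphism $S\to\mathbf{CP}^2$ is a (smooth) conic. -/

import Mathlib

open scoped WithZero KaehlerDifferential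

noncomputable section

namespace BlowUpSurface

/-! ### The function field `ℂ(x, y)` of `CP¹ × CP¹` and its automorphisms -/

/-- The field `ℂ(x, y)` of rational functions on `CP¹ × CP¹`. -/
abbrev K : Type := FractionRing (MvPolynomial (Fin 2) ℂ)

/-- The affine coordinate of the first factor of `CP¹ × CP¹`. -/
def x : K := algebraMap (MvPolynomial (Fin 2) ℂ) K (MvPolynomial.X 0)

/-- The affine coordinate of the second factor of `CP¹ × CP¹`. -/
def y : K := algebraMap (MvPolynomial (Fin 2) ℂ) K (MvPolynomial.X 1)

/-- A complex number, as a constant rational function. -/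
abbrev const (a : ℂ) : K := algebraMap ℂ K a

theorem algIndep_xy : AlgebraicIndependent ℂ ![x, y] := by
  have h := (MvPolynomial.algebraicIndependent_X (Fin 2) ℂ).map'
    (f := IsScalarTower.toAlgHom ℂ (MvPolynomial (Fin 2) ℂ) K)
    (IsFractionRing.injective (MvPolynomial (Fin 2) ℂ) K)
  convert h using 1
  ext i
  fin_cases i <;> rfl

theorem x_ne_const (a : ℂ) : x - const a ≠ 0 := by
  intro h
  have h1 : algebraMap (MvPolynomial (Fin 2) ℂ) K (MvPolynomial.X 0 - MvPolynomial.C a) = 0 := by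
    rw [map_sub, ← MvPolynomial.algebraMap_eq, ← IsScalarTower.algebraMap_apply]
    exact h
  rw [map_eq_zero_iff _ (IsFractionRing.injective _ _)] at h1
  have h2 := congrArg (MvPolynomial.eval (fun _ => a + 1)) h1
  simp at h2

theorem y_ne_zero : y ≠ 0 := by
  intro h
  have h1 : algebraMap (MvPolynomial (Fin 2) ℂ) K (MvPolynomial.X 1) = 0 := h
  rw [map_eq_zero_iff _ (IsFractionRing.injective _ _)] at h1
  exact MvPolynomial.X_ne_zero _ h1

/-- Two rational functions that generate the field `ℂ(x, y)` are algebraically independent. -/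
theorem algIndep_of_generate (u v : K)
    (hx : x ∈ IntermediateField.adjoin ℂ {u, v}) (hy : y ∈ IntermediateField.adjoin ℂ {u, v}) :
    AlgebraicIndependent ℂ ![u, v] := by
  have htop : ∀ z : K, z ∈ IntermediateField.adjoin ℂ (Set.range ![u, v]) := by
    intro z
    rw [Matrix.range_cons, Matrix.range_cons, Matrix.range_empty, Set.union_empty,
      Set.singleton_union]
    obtain ⟨a, b, -, rfl⟩ := IsFractionRing.div_surjective (A := MvPolynomial (Fin 2) ℂ) z
    have key : ∀ f : MvPolynomial (Fin 2) ℂ,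
        algebraMap (MvPolynomial (Fin 2) ℂ) K f ∈ IntermediateField.adjoin ℂ {u, v} := by
      intro f
      induction f using MvPolynomial.induction_on with
      | C a =>
        rw [← MvPolynomial.algebraMap_eq, ← IsScalarTower.algebraMap_apply]
        exact IntermediateField.algebraMap_mem _ a
      | add f g hf hg => rw [map_add]; exact add_mem hf hg
      | mul_X f i hf =>
        rw [map_mul]
        refine mul_mem hf ?_
        fin_cases i
        · exact hx
        · exact hy
    exact div_mem (key a) (key b)
  have halg : Algebra.IsAlgebraic (Algebra.adjoin ℂ (Set.range ![u, v])) K := by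
    refine ⟨fun z => ?_⟩
    obtain ⟨a, ha, b, hb, rfl⟩ := IntermediateField.mem_adjoin_iff_div.mp (htop z)
    have h1 : IsAlgebraic (Algebra.adjoin ℂ (Set.range ![u, v])) a :=
      isAlgebraic_algebraMap (⟨a, ha⟩ : Algebra.adjoin ℂ (Set.range ![u, v]))
    have h2 : IsAlgebraic (Algebra.adjoin ℂ (Set.range ![u, v])) b :=
      isAlgebraic_algebraMap (⟨b, hb⟩ : Algebra.adjoin ℂ (Set.range ![u, v]))
    rw [div_eq_mul_inv]
    exact h1.mul h2.inv
  exact (Algebra.IsAlgebraic.isTranscendenceBasis_of_le_trdeg_of_finite ℂ ![u, v]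
    algIndep_xy.cardinalMk_le_trdeg).1

/-- The substitution `f(x, y) ↦ f(u, v)`, for algebraically independent `u`, `v`. -/
def subst (u v : K) (h : AlgebraicIndependent ℂ ![u, v]) : K →ₐ[ℂ] K :=
  IsFractionRing.liftAlgHom (g := MvPolynomial.aeval ![u, v]) h

/-- Complex conjugation of the coefficients of a rational function. -/
def coeffConj : K →+* K :=
  (IsFractionRing.ringEquivOfRingEquiv (K := K) (L := K)
    (MvPolynomial.mapEquiv (Fin 2) (starRingAut (R := ℂ)))).toRingHom

theorem algIndep_antipodal : AlgebraicIndependent ℂ ![x, -y⁻¹] := by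
  refine algIndep_of_generate _ _
    (IntermediateField.subset_adjoin _ _ (by simp)) ?_
  have h : -y⁻¹ ∈ IntermediateField.adjoin ℂ {x, -y⁻¹} :=
    IntermediateField.subset_adjoin _ _ (by simp)
  have := neg_mem (inv_mem h)
  simpa [inv_neg] using this

/-- The action on rational functions, `f ↦ conj (f ∘ σ)`, of the real structure
`σ (x, y) = (conj x, - 1 / conj y)` = (complex conjugation) × (anti-podal). -/
def realStructure : K →+* K :=
  (subst x (-y⁻¹) algIndep_antipodal).toRingHom.comp coeffConj

/-- The point or curve conjugate to a given one. -/
def conj (R : LocalSubring K) : LocalSubring K := R.map realStructure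

/-- The Möbius transformation of `CP¹` (written as a function of `x`) with fixed points `c`,
`conj c` and multiplier `t`: `(x' - c) / (x' - conj c) = t (x - c) / (x - conj c)`. -/
def flow (c t : ℂ) : K :=
  (const c * (x - const (star c)) - const (t * star c) * (x - const c)) /
    ((x - const (star c)) - const t * (x - const c))

theorem algIndep_flow (c : ℂ) (hc : c.im ≠ 0) (t : ℂˣ) :
    AlgebraicIndependent ℂ ![flow c t, y] := by
  have hcc : c - star c ≠ 0 := by
    intro h
    apply hc
    have := congrArg Complex.im h
    simp at this
    linarith
  have hden : (x - const (star c)) - const t * (x - const c) ≠ 0 := by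
    by_cases ht : (t : ℂ) = 1
    · have : (x - const (star c)) - const t * (x - const c) = const (c - star c) := by
        simp only [const, ht, map_one, map_sub]; ring
      rw [this]
      exact (map_ne_zero _).mpr hcc
    · have h1 : (1 - (t : ℂ)) ≠ 0 := sub_ne_zero.mpr (Ne.symm ht)
      have : (x - const (star c)) - const t * (x - const c) =
          const (1 - t) * (x - const ((star c - t * c) / (1 - t))) := by
        have h2 : const (1 - t) * const ((star c - t * c) / (1 - t)) =
            const (star c) - const t * const c := by
          rw [const, const, ← map_mul, mul_div_cancel₀ _ h1, map_sub, map_mul]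
        rw [mul_sub (const (1 - t)), h2]
        simp only [const, map_sub, map_one]; ring
      rw [this]
      exact mul_ne_zero ((map_ne_zero _).mpr h1) (x_ne_const _)
  set X := flow c t with hX
  have hXeq : X * ((x - const (star c)) - const t * (x - const c)) =
      const c * (x - const (star c)) - const (t * star c) * (x - const c) := by
    rw [hX, flow, div_mul_cancel₀ _ hden]
  -- solve for `x`
  have hsolve : x * ((X - const c) - const t * (X - const (star c))) =
      const (star c) * (X - const c) - const (t * c) * (X - const (star c)) := by
    simp only [const, map_mul] at hXeq ⊢
    linear_combination hXeq
  have hden2 : (X - const c) - const t * (X - const (star c)) ≠ 0 := by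
    intro h0
    have hmul : ((X - const c) - const t * (X - const (star c))) *
        ((x - const (star c)) - const t * (x - const c)) =
        - const t * const (c - star c) ^ 2 := by
      simp only [const, map_mul, map_sub] at hXeq ⊢
      linear_combination (1 - algebraMap ℂ K t) * hXeq
    rw [h0, zero_mul] at hmul
    have h3 : const t * const (c - star c) ^ 2 ≠ 0 :=
      mul_ne_zero ((map_ne_zero _).mpr t.ne_zero) (pow_ne_zero _ ((map_ne_zero _).mpr hcc))
    apply h3
    linear_combination hmul
  have hXm : X ∈ IntermediateField.adjoin ℂ {X, y} :=
    IntermediateField.subset_adjoin _ _ (by simp)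
  have hcm : ∀ a : ℂ, const a ∈ IntermediateField.adjoin ℂ {X, y} :=
    fun a => IntermediateField.algebraMap_mem _ a
  refine algIndep_of_generate _ _ ?_ (IntermediateField.subset_adjoin _ _ (by simp))
  rw [eq_div_of_mul_eq hden2 hsolve]
  exact div_mem (sub_mem (mul_mem (hcm _) (sub_mem hXm (hcm _)))
      (mul_mem (hcm _) (sub_mem hXm (hcm _))))
    (sub_mem (sub_mem hXm (hcm _)) (mul_mem (hcm _) (sub_mem hXm (hcm _))))

/-- The `ℂ^*`-action on `CP¹ × CP¹` that fixes the curves `x = c` and `x = conj c` pointwise and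
is trivial on the second factor, as an action on rational functions. -/
def act (c : ℂ) (hc : c.im ≠ 0) (t : ℂˣ) : K →ₐ[ℂ] K :=
  subst (flow c t) y (algIndep_flow c hc t)

/-! ### Surfaces as sets of local rings

A (projective, integral) surface with function field `K` is given by the set of the local rings,
inside `K`, of all its scheme points: the generic point, the generic points of the irreducible
curves, and the closed points. An irreducible curve is identified with its local ring, so that
a curve and its strict transform under a blow-up are the same element. -/

/-- The maximal ideal of a local subring, as a subset of `K`. -/
def maxIdeal (R : LocalSubring K) : Set K :=
  {z | ∃ h : z ∈ R.toSubring, (⟨z, h⟩ : R.toSubring) ∈ IsLocalRing.maximalIdeal R.toSubring}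

/-- The local rings of `Spec A`. -/
def localRings (A : Subring K) : Set (LocalSubring K) :=
  {R | ∃ (P : Ideal A) (_ : P.IsPrime), R = LocalSubring.ofPrime A P}

/-- The surface `CP¹ × CP¹`, covered by four affine planes. -/
def P1P1 : Set (LocalSubring K) :=
  {R | ∃ u ∈ ({x, x⁻¹} : Set K), ∃ v ∈ ({y, y⁻¹} : Set K),
    R ∈ localRings (Algebra.adjoin ℂ {u, v}).toSubring}

/-- The ring `P[𝔪/u]`, where `𝔪` is the maximal ideal of the local ring `P`. -/
def blowUpChart (P : LocalSubring K) (u : K) : Subring K :=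
  Subring.closure ((P.toSubring : Set K) ∪ {z | ∃ v ∈ maxIdeal P, z = v / u})

/-- The local rings of the points of the exceptional curve of the blow-up of `Spec P` at its
closed point: those local rings of the charts `Spec P[𝔪/u]` that dominate `P` (the order `≤` on
`LocalSubring K` is domination). -/
def exceptionalFibre (P : LocalSubring K) : Set (LocalSubring K) :=
  {R | P ≤ R ∧ ∃ u ∈ maxIdeal P, u ≠ 0 ∧ R ∈ localRings (blowUpChart P u)}

/-- The blow-up of the surface `M` at the (closed, finitely many) points in `Z`. -/
def blowUp (M Z : Set (LocalSubring K)) : Set (LocalSubring K) :=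
  (M \ Z) ∪ ⋃ P ∈ Z, exceptionalFibre P

/-- The closure of the point `C` contains the point `R`; for a curve `C`: `R` lies on `C`. -/
def LiesOn (R C : LocalSubring K) : Prop := R.toSubring ≤ C.toSubring

/-- `R` is a closed point of the surface `M`, that is, a point in the usual sense. -/
def IsClosedPoint (M : Set (LocalSubring K)) (R : LocalSubring K) : Prop :=
  R ∈ M ∧ ∀ R' ∈ M, LiesOn R' R → R' = R

/-- `C` is a discrete valuation ring with field of fractions `K`. -/
def IsDVR (C : LocalSubring K) : Prop :=
  IsDiscreteValuationRing C.toSubring ∧ IsFractionRing C.toSubring K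

/-- `C` is an irreducible curve (a prime divisor) on the regular surface `M`. -/
def IsCurve (M : Set (LocalSubring K)) (C : LocalSubring K) : Prop := C ∈ M ∧ IsDVR C

/-- `R` is a fixed point of the `ℂ^*`-action `act c`. -/
def IsFixed (c : ℂ) (hc : c.im ≠ 0) (R : LocalSubring K) : Prop :=
  ∀ t : ℂˣ, R.map (act c hc t : K →+* K) = R

/-- `R` is an isolated fixed point of the `ℂ^*`-action on the surface `M`: a fixed point through
which there is no curve that consists of fixed points. -/
def IsIsolatedFixedPoint (c : ℂ) (hc : c.im ≠ 0) (M : Set (LocalSubring K))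
    (R : LocalSubring K) : Prop :=
  IsClosedPoint M R ∧ IsFixed c hc R ∧
    ¬ ∃ C, IsCurve M C ∧ LiesOn R C ∧ ∀ R', IsClosedPoint M R' → LiesOn R' C → IsFixed c hc R'

/-- `C` is the member `x = c` of the pencil `|𝒪(1,0)|` on `CP¹ × CP¹`. -/
def IsFirstFibre (c : ℂ) (C : LocalSubring K) : Prop :=
  IsCurve P1P1 C ∧ x - const c ∈ maxIdeal C

/-- `C` is a member `y = b`, `b ∈ ℂ ∪ {∞}`, of the pencil `|𝒪(0,1)|` on `CP¹ × CP¹`. -/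
def IsSecondFibre (C : LocalSubring K) : Prop :=
  IsCurve P1P1 C ∧ ((∃ b : ℂ, y - const b ∈ maxIdeal C) ∨ y⁻¹ ∈ maxIdeal C)

/-! ### Divisors and linear systems

A divisor on a surface `M` is written as the function that gives the multiplicity of each
irreducible curve, and that is `0` at all other local subrings. -/

open Classical in
/-- The order of a rational function along an irreducible curve. -/
def ord (C : LocalSubring K) (f : K) : ℤ :=
  if h : IsDVR C then
    haveI := h.1
    haveI := h.2;
    -WithZero.log ((IsDiscreteValuationRing.maximalIdeal C.toSubring).valuation K f)
  else 0

open Classical in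
/-- The divisor of a (nonzero) rational function on `M`. -/
def div (M : Set (LocalSubring K)) (f : K) : LocalSubring K → ℤ :=
  fun C => if IsCurve M C then ord C f else 0

/-- The rational 2-forms on the surface. -/
abbrev RatForm : Type := ⋀[K]^2 Ω[K⁄ℂ]

/-- The rational 2-forms that are regular at `R`: the `R`-module generated by the `df ∧ dg` with
`f, g ∈ R`. -/
def regularForms (R : LocalSubring K) : Submodule R.toSubring RatForm :=
  Submodule.span R.toSubring
    {η | ∃ f ∈ R.toSubring, ∃ g ∈ R.toSubring,
      η = exteriorPower.ιMulti K 2 ![KaehlerDifferential.D ℂ K f, KaehlerDifferential.D ℂ K g]}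

/-- The order of a (nonzero) rational 2-form along an irreducible curve `C`: the largest order
of an `f` with `ω = f η`, `η` regular at the generic point of `C`. -/
def ordForm (C : LocalSubring K) (ω : RatForm) : ℤ :=
  sSup {m | ∃ f : K, f ≠ 0 ∧ ord C f = m ∧ ∃ η ∈ regularForms C, ω = f • η}

open Classical in
/-- The divisor of a (nonzero) rational 2-form on `M`. -/
def divForm (M : Set (LocalSubring K)) (ω : RatForm) : LocalSubring K → ℤ :=
  fun C => if IsCurve M C then ordForm C ω else 0

/-- `D` is a canonical divisor of `M`. -/
def IsCanonicalDivisor (M : Set (LocalSubring K)) (D : LocalSubring K → ℤ) : Prop :=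
  ∃ ω : RatForm, ω ≠ 0 ∧ D = divForm M ω

/-- The complete linear system `|D|`. -/
def linearSystem (M : Set (LocalSubring K)) (D : LocalSubring K → ℤ) : Set (LocalSubring K → ℤ) :=
  {E | 0 ≤ E ∧ ∃ f : K, f ≠ 0 ∧ E = div M f + D}

open Classical in
/-- The irreducible curve `C`, as a divisor. -/
def single (C : LocalSubring K) : LocalSubring K → ℤ := Pi.single C 1

/-- `F` is the fixed component of the linear system `L`: the largest divisor that is contained
in all members of `L`. -/
def IsFixedPart (L : Set (LocalSubring K → ℤ)) (F : LocalSubring K → ℤ) : Prop :=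
  L.Nonempty ∧ IsGLB L F

/-- What is left of the linear system `L` when its fixed component `F` is removed. -/
def movablePart (L : Set (LocalSubring K → ℤ)) (F : LocalSubring K → ℤ) :
    Set (LocalSubring K → ℤ) := (fun E => E - F) '' L

/-- The linear system `L` has no base points: each point of `M` is off the support of some
member of `L`. -/
def IsBasePointFree (M : Set (LocalSubring K)) (L : Set (LocalSubring K → ℤ)) : Prop :=
  ∀ R, IsClosedPoint M R → ∃ E ∈ L, ∀ C, IsCurve M C → LiesOn R C → E C = 0

theorem ord_add_le (C : LocalSubring K) (f g : K) (hf : f ≠ 0) (hg : g ≠ 0) (h : f + g ≠ 0) :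
    min (ord C f) (ord C g) ≤ ord C (f + g) := by
  unfold ord
  split_ifs with hC
  · have := hC.1
    have := hC.2
    set v := (IsDiscreteValuationRing.maximalIdeal C.toSubring).valuation K
    have hv : ∀ z : K, z ≠ 0 → v z ≠ 0 := fun z hz => (Valuation.ne_zero_iff v).mpr hz
    rcases le_max_iff.mp (v.map_add f g) with h1 | h1
    · exact (min_le_left _ _).trans
        (neg_le_neg ((WithZero.log_le_log (hv _ h) (hv _ hf)).mpr h1))
    · exact (min_le_right _ _).trans
        (neg_le_neg ((WithZero.log_le_log (hv _ h) (hv _ hg)).mpr h1))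
  · simp

theorem ord_const_mul (C : LocalSubring K) (a : ℂ) (ha : a ≠ 0) (f : K) :
    ord C (a • f) = ord C f := by
  rcases eq_or_ne f 0 with rfl | hf
  · rw [smul_zero]
  unfold ord
  split_ifs with hC
  · have := hC.1
    have := hC.2
    set v := (IsDiscreteValuationRing.maximalIdeal C.toSubring).valuation K
    have hv : ∀ z : K, z ≠ 0 → v z ≠ 0 := fun z hz => (Valuation.ne_zero_iff v).mpr hz
    -- a nonzero constant has roots of every order, hence order `0`
    have h0 : WithZero.log (v (const a)) = 0 := by
      set N : ℕ := (WithZero.log (v (const a))).natAbs + 1 with hN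
      obtain ⟨b, hb⟩ := IsAlgClosed.exists_pow_nat_eq a (n := N) (by omega)
      have h1 : WithZero.log (v (const a)) = N * WithZero.log (v (const b)) := by
        rw [← hb, const, map_pow, map_pow, WithZero.log_pow, nsmul_eq_mul]
      have h2 : (N : ℤ) ∣ WithZero.log (v (const a)) := ⟨_, h1⟩
      refine Int.eq_zero_of_abs_lt_dvd h2 ?_
      rw [hN]
      push_cast
      exact lt_add_one _
    rw [Algebra.smul_def, map_mul,
      WithZero.log_mul (hv _ ((map_ne_zero _).mpr ha)) (hv _ hf), h0, zero_add]
  · rfl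

/-- The space `H⁰(M, 𝒪(D))` of the rational functions `f` with `f = 0` or `div f + D ≥ 0`. -/
def H0 (M : Set (LocalSubring K)) (D : LocalSubring K → ℤ) : Submodule ℂ K where
  carrier := {f | f ≠ 0 → 0 ≤ div M f + D}
  zero_mem' := fun h => absurd rfl h
  add_mem' := by
    intro f g hf hg h
    rcases eq_or_ne f 0 with rfl | hf0
    · rw [zero_add] at h ⊢
      exact hg h
    rcases eq_or_ne g 0 with rfl | hg0
    · rw [add_zero] at h ⊢
      exact hf h
    intro C
    have h1 := hf hf0 C
    have h2 := hg hg0 C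
    have h3 := ord_add_le C f g hf0 hg0 h
    simp only [div, Pi.add_apply, Pi.zero_apply] at h1 h2 ⊢
    split_ifs at h1 h2 ⊢
    · rcases min_le_iff.mp h3 with h4 | h4 <;> linarith
    · exact h1
  smul_mem' := by
    intro a f hf h
    have ha : a ≠ 0 := fun h0 => h (by rw [h0, zero_smul])
    have hf0 : f ≠ 0 := fun h0 => h (by rw [h0, smul_zero])
    intro C
    have h1 := hf hf0 C
    simp only [div, Pi.add_apply, Pi.zero_apply, ord_const_mul C a ha f] at h1 ⊢
    exact h1

/-- The rational map `M ⇢ CP²` given by the rational functions `s₀, s₁, s₂` takes the value `P` at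
the point `R`: for some rational function `g ≠ 0` the functions `sᵢ / g` are regular at `R`
with values the homogeneous coordinates of `P`. -/
def TakesValue (s : Fin 3 → K) (R : LocalSubring K) (P : Projectivization ℂ (Fin 3 → ℂ)) : Prop :=
  ∃ g : K, g ≠ 0 ∧ ∀ i, s i / g - const (P.rep i) ∈ maxIdeal R

/-- `X ⊆ CP²` is a smooth conic. -/
def IsConic (X : Set (Projectivization ℂ (Fin 3 → ℂ))) : Prop :=
  ∃ A : Matrix (Fin 3) (Fin 3) ℂ, A.IsSymm ∧ A.det ≠ 0 ∧
    X = {P | P.rep ⬝ᵥ A.mulVec P.rep = 0}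

end BlowUpSurface

end

noncomputable section

namespace BlowUpSurface

/-! ### Local subrings of `K` -/

/-! All geometry takes place inside the function field: points and curves are local rings in `K`,
and every statement is reduced to which elements are regular or vanish there.

Replace `y` by a coordinate Y = 1/(y - e) that is finite at all the centres, and write X for `x`.
Then S is the blow-up at the points (c, bᵢ) and (c', b'ᵢ), where c' is the conjugate of c, followed
by the blow-up of one point infinitely near to (c, bₖ) and one infinitely near to (c', b'ₖ); this
normal form is `Config`. The point q is the direction of the curve Y = bₖ: near X = c the action
multiplies X - c by a function with value t and leaves Y unchanged, so the exceptional curve has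
only two fixed points, and the one on C₁ is not isolated because C₁ is pointwise fixed
(`IsIsolatedFixedPoint.isPt`).

Let the canonical divisor be that of η dX ∧ dY. A function f is a section of the bi-anticanonical
bundle exactly when g = f/η² is a polynomial of bidegree at most (4, 4) with order at least 2 along
every exceptional curve Eᵢ, E'ᵢ of the first blow-up and at least 4 along the curves N, N' of the
second. Such g are found by repeated division (`Config.exists_eq_fixedEq_mul`): on X = c the
polynomial g has degree at most 4 in Y but at least three double zeros, since n - 1 ≥ 3, so X - c
divides it, and likewise X - c'; the quotient has degree at most 2 in X and order at least 3 along
N, so its restriction to Y = bₖ has a triple zero and Y - bₖ divides it, and likewise Y - b'ₖ; what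
remains has bidegree at most (2, 2) and still vanishes at three or more points of each of X = c and
X = c', so both factors split off again. Hence g = Φ r(Y) with Φ = (X - c)²(X - c')²(Y - bₖ)(Y -
b'ₖ) and deg r ≤ 2.

The divisor of η²Φ as a bi-anticanonical section is the asserted fixed component plus twice the
fibre Y = ∞ (`Config.fixed_table`). Thus the movable part is the pull-back of all divisors of degree
2 on the second factor: it has no base points, its sections are spanned by multiples of 1, Y, Y²,
and its morphism is Y followed by the Veronese embedding, with a conic as image
(`isConic_of_quadratic`). These facts are put together in `Config.bianticanonical`. -/

theorem mem_maxIdeal {R : LocalSubring K} {z : K} :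
    z ∈ maxIdeal R ↔ z ∈ R.toSubring ∧ (z⁻¹ ∈ R.toSubring → z = 0) := by
  constructor
  · rintro ⟨h, hz⟩
    refine ⟨h, fun hi => ?_⟩
    by_contra h0
    rw [IsLocalRing.mem_maximalIdeal, mem_nonunits_iff] at hz
    exact hz (IsUnit.of_mul_eq_one (⟨z⁻¹, hi⟩ : R.toSubring) (Subtype.ext (mul_inv_cancel₀ h0)))
  · rintro ⟨h, hz⟩
    refine ⟨h, ?_⟩
    rw [IsLocalRing.mem_maximalIdeal, mem_nonunits_iff]
    intro hu
    obtain ⟨w, hw⟩ := hu.exists_right_inv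
    have hw' : z * (w : K) = 1 := congrArg Subtype.val hw
    have h0 : z ≠ 0 := left_ne_zero_of_mul_eq_one hw'
    exact h0 (hz (by rw [inv_eq_of_mul_eq_one_right hw']; exact w.2))

section maxIdeal

variable {R : LocalSubring K} {z w : K}

theorem inv_mem_of_notMem_maxIdeal (h : z ∈ R.toSubring) (hz : z ∉ maxIdeal R) :
    z⁻¹ ∈ R.toSubring := by
  by_contra hi
  exact hz (mem_maxIdeal.mpr ⟨h, fun h' => absurd h' hi⟩)

theorem notMem_maxIdeal_of_inv_mem (h0 : z ≠ 0) (hz : z⁻¹ ∈ R.toSubring) : z ∉ maxIdeal R :=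
  fun h => h0 ((mem_maxIdeal.mp h).2 hz)

theorem zero_mem_maxIdeal : (0 : K) ∈ maxIdeal R :=
  mem_maxIdeal.mpr ⟨zero_mem _, fun _ => rfl⟩

theorem one_notMem_maxIdeal : (1 : K) ∉ maxIdeal R :=
  notMem_maxIdeal_of_inv_mem one_ne_zero (by rw [inv_one]; exact one_mem _)

theorem add_mem_maxIdeal (hz : z ∈ maxIdeal R) (hw : w ∈ maxIdeal R) : z + w ∈ maxIdeal R := by
  obtain ⟨h1, h2⟩ := hz
  obtain ⟨h3, h4⟩ := hw
  exact ⟨add_mem h1 h3, Ideal.add_mem _ h2 h4⟩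

theorem mul_mem_maxIdeal (hz : z ∈ R.toSubring) (hw : w ∈ maxIdeal R) : z * w ∈ maxIdeal R := by
  obtain ⟨h3, h4⟩ := hw
  exact ⟨mul_mem hz h3, Ideal.mul_mem_left _ (⟨z, hz⟩ : R.toSubring) h4⟩

theorem mul_mem_maxIdeal' (hz : z ∈ maxIdeal R) (hw : w ∈ R.toSubring) : z * w ∈ maxIdeal R := by
  rw [mul_comm]; exact mul_mem_maxIdeal hw hz

theorem neg_mem_maxIdeal (hz : z ∈ maxIdeal R) : -z ∈ maxIdeal R := by
  rw [← neg_one_mul]; exact mul_mem_maxIdeal (neg_mem (one_mem _)) hz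

theorem sub_mem_maxIdeal (hz : z ∈ maxIdeal R) (hw : w ∈ maxIdeal R) : z - w ∈ maxIdeal R := by
  rw [sub_eq_add_neg]; exact add_mem_maxIdeal hz (neg_mem_maxIdeal hw)

theorem mul_notMem_maxIdeal (hz : z ∈ R.toSubring) (hw : w ∈ R.toSubring)
    (hz' : z ∉ maxIdeal R) (hw' : w ∉ maxIdeal R) : z * w ∉ maxIdeal R := by
  rintro ⟨h1, h2⟩
  have h3 : (⟨z, hz⟩ * ⟨w, hw⟩ : R.toSubring) ∈ IsLocalRing.maximalIdeal R.toSubring := h2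
  rcases (IsLocalRing.maximalIdeal.isMaximal R.toSubring).isPrime.mem_or_mem h3 with h | h
  · exact hz' ⟨hz, h⟩
  · exact hw' ⟨hw, h⟩

theorem pow_mem_maxIdeal {n : ℕ} (hn : n ≠ 0) (h : z ∈ maxIdeal R) : z ^ n ∈ maxIdeal R := by
  obtain ⟨n, rfl⟩ := Nat.exists_eq_succ_of_ne_zero hn
  rw [pow_succ]
  exact mul_mem_maxIdeal (pow_mem h.1 n) h

end maxIdeal

theorem le_iff_maxIdeal {R R' : LocalSubring K} :
    R ≤ R' ↔ R.toSubring ≤ R'.toSubring ∧ ∀ z ∈ maxIdeal R, z ∈ maxIdeal R' := by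
  rw [LocalSubring.le_def]
  constructor
  · rintro ⟨h, hl⟩
    refine ⟨h, fun z hz => ?_⟩
    obtain ⟨h1, h2⟩ := hz
    exact ⟨h h1, fun hu => h2 (hl.map_nonunit (⟨z, h1⟩ : R.toSubring) hu)⟩
  · rintro ⟨h, hl⟩
    refine ⟨h, ⟨fun z hz => ?_⟩⟩
    by_contra hz'
    obtain ⟨h1, h2⟩ := hl z ⟨z.2, hz'⟩
    exact h2 hz

theorem mem_maxIdeal_of_le {R R' : LocalSubring K} {z : K} (h : R ≤ R') (hz : z ∈ maxIdeal R) :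
    z ∈ maxIdeal R' := (le_iff_maxIdeal.mp h).2 z hz

theorem mem_of_le {R R' : LocalSubring K} {z : K} (h : R ≤ R') (hz : z ∈ R.toSubring) :
    z ∈ R'.toSubring := h.1 hz

/-- A nonunit of an overring is a nonunit. -/
theorem mem_maxIdeal_of_liesOn {R R' : LocalSubring K} {z : K} (h : LiesOn R R')
    (hz : z ∈ R.toSubring) (hz' : z ∈ maxIdeal R') : z ∈ maxIdeal R :=
  mem_maxIdeal.mpr ⟨hz, fun hi => (mem_maxIdeal.mp hz').2 (h hi)⟩

/-! ### Local rings of affine schemes -/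

/-- The fractions `s / t` with `s, t ∈ A` and `t` invertible in `R`. -/
def fractionsIn (A : Subring K) (R : Subring K) : Subring K where
  carrier := {z | ∃ s ∈ A, ∃ t ∈ A, t ≠ 0 ∧ t⁻¹ ∈ R ∧ z = s * t⁻¹}
  one_mem' := ⟨1, one_mem _, 1, one_mem _, one_ne_zero, by simp, by simp⟩
  zero_mem' := ⟨0, zero_mem _, 1, one_mem _, one_ne_zero, by simp, by simp⟩
  mul_mem' := by
    rintro _ _ ⟨s, hs, t, ht, h0, hi, rfl⟩ ⟨s', hs', t', ht', h0', hi', rfl⟩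
    refine ⟨s * s', mul_mem hs hs', t * t', mul_mem ht ht', mul_ne_zero h0 h0', ?_, ?_⟩
    · rw [mul_inv]; exact mul_mem hi hi'
    · rw [mul_inv]; ring
  add_mem' := by
    rintro _ _ ⟨s, hs, t, ht, h0, hi, rfl⟩ ⟨s', hs', t', ht', h0', hi', rfl⟩
    refine ⟨s * t' + s' * t, add_mem (mul_mem hs ht') (mul_mem hs' ht), t * t', mul_mem ht ht',
      mul_ne_zero h0 h0', ?_, ?_⟩
    · rw [mul_inv]; exact mul_mem hi hi'
    · field_simp
  neg_mem' := by
    rintro _ ⟨s, hs, t, ht, h0, hi, rfl⟩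
    exact ⟨-s, neg_mem hs, t, ht, h0, hi, by ring⟩

theorem le_fractionsIn (A R : Subring K) : A ≤ fractionsIn A R := fun z hz =>
  ⟨z, hz, 1, one_mem _, one_ne_zero, by simp, by simp⟩

theorem inv_mem_fractionsIn {A R : Subring K} {t : K} (ht : t ∈ A) (h0 : t ≠ 0) (hi : t⁻¹ ∈ R) :
    t⁻¹ ∈ fractionsIn A R := ⟨1, one_mem _, t, ht, h0, hi, by simp⟩

theorem mem_ofPrime {A : Subring K} {P : Ideal A} [P.IsPrime] {z : K} :
    z ∈ (LocalSubring.ofPrime A P).toSubring ↔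
      ∃ s t : A, t ∉ P ∧ z = (s : K) * (t : K)⁻¹ := by
  have hne : ∀ t : A, t ∉ P → (t : K) ≠ 0 := by
    intro t ht h0
    exact ht (by rw [show t = 0 from Subtype.ext h0]; exact zero_mem _)
  constructor
  · intro hz
    obtain ⟨s, t, h⟩ := IsLocalization.exists_mk'_eq P.primeCompl
      (⟨z, hz⟩ : (LocalSubring.ofPrime A P).toSubring)
    refine ⟨s, t, t.2, ?_⟩
    have h1 := IsLocalization.mk'_spec (LocalSubring.ofPrime A P).toSubring s t
    rw [h] at h1
    have h2 : z * (t : K) = s := congrArg Subtype.val h1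
    rw [← h2, mul_inv_cancel_right₀ (hne _ t.2)]
  · rintro ⟨s, t, ht, rfl⟩
    have h1 := IsLocalization.mk'_spec (LocalSubring.ofPrime A P).toSubring s
      (⟨t, ht⟩ : P.primeCompl)
    have h2 : ((IsLocalization.mk' (LocalSubring.ofPrime A P).toSubring s
      (⟨t, ht⟩ : P.primeCompl) : (LocalSubring.ofPrime A P).toSubring) : K) * (t : K) = s :=
      congrArg Subtype.val h1
    rw [← h2, mul_inv_cancel_right₀ (hne _ ht)]
    exact Subtype.property _

theorem mem_maxIdeal_ofPrime {A : Subring K} {P : Ideal A} [P.IsPrime] {z : K} (hz : z ∈ A) :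
    z ∈ maxIdeal (LocalSubring.ofPrime A P) ↔ (⟨z, hz⟩ : A) ∈ P := by
  rw [mem_maxIdeal]
  constructor
  · rintro ⟨-, h⟩
    by_contra hP
    have h0 := h (mem_ofPrime.mpr ⟨1, ⟨z, hz⟩, hP, by simp⟩)
    exact hP (by rw [show (⟨z, hz⟩ : A) = 0 from Subtype.ext h0]; exact zero_mem _)
  · intro hP
    refine ⟨LocalSubring.le_ofPrime A P hz, fun hi => ?_⟩
    obtain ⟨s, t, ht, h⟩ := mem_ofPrime.mp hi
    by_contra h0
    have ht0 : (t : K) ≠ 0 := by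
      intro h0
      exact ht (by rw [show t = 0 from Subtype.ext h0]; exact zero_mem _)
    apply ht
    have : t = s * ⟨z, hz⟩ := by
      apply Subtype.ext
      change (t : K) = s * z
      field_simp at h
      rw [h, mul_comm]
    rw [this]
    exact Ideal.mul_mem_left _ _ hP

/-- The prime is recovered as the contraction of the maximal ideal of `R`. This form mentions no
primes, so the local rings of different affine charts can be compared by elements alone. -/
theorem mem_localRings_iff {A : Subring K} {R : LocalSubring K} :
    R ∈ localRings A ↔ A ≤ R.toSubring ∧ R.toSubring ≤ fractionsIn A R.toSubring := by
  constructor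
  · rintro ⟨P, hP, rfl⟩
    refine ⟨LocalSubring.le_ofPrime A P, fun z hz => ?_⟩
    obtain ⟨s, t, ht, rfl⟩ := mem_ofPrime.mp hz
    refine ⟨s, s.2, t, t.2, ?_, ?_, rfl⟩
    · intro h0
      exact ht (by rw [show t = 0 from Subtype.ext h0]; exact zero_mem _)
    · exact mem_ofPrime.mpr ⟨1, t, ht, by simp⟩
  · rintro ⟨h1, h2⟩
    let P : Ideal A := (IsLocalRing.maximalIdeal R.toSubring).comap (Subring.inclusion h1)
    have hPp : P.IsPrime := Ideal.IsPrime.comap _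
    have hP : ∀ t : A, t ∈ P ↔ (t : K) ∈ maxIdeal R := fun t =>
      ⟨fun h => ⟨h1 t.2, h⟩, fun h => h.2⟩
    refine ⟨P, hPp, LocalSubring.toSubring_injective (le_antisymm ?_ ?_)⟩
    · intro z hz
      obtain ⟨s, hs, t, ht, h0, hi, rfl⟩ := h2 hz
      exact mem_ofPrime.mpr ⟨⟨s, hs⟩, ⟨t, ht⟩,
        fun h => notMem_maxIdeal_of_inv_mem h0 hi ((hP _).mp h), rfl⟩
    · intro z hz
      obtain ⟨s, t, ht, rfl⟩ := mem_ofPrime.mp hz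
      rw [hP] at ht
      exact mul_mem (h1 s.2) (inv_mem_of_notMem_maxIdeal (h1 t.2) ht)

theorem localRings_le {A : Subring K} {R : LocalSubring K} (h : R ∈ localRings A) :
    A ≤ R.toSubring := (mem_localRings_iff.mp h).1

/-- If s/t and its inverse lie in `R`, then so does 1/s = (t/s)(1/t), so t/s is again an admissible
fraction. -/
theorem inv_mem_fractionsIn' {A R : Subring K} {z : K} (h : z ∈ fractionsIn A R) (h0 : z ≠ 0)
    (hi : z⁻¹ ∈ R) : z⁻¹ ∈ fractionsIn A R := by
  obtain ⟨s, hs, t, ht, h0', hi', rfl⟩ := h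
  have hs0 : s ≠ 0 := by
    rintro rfl
    exact h0 (zero_mul _)
  refine ⟨t, ht, s, hs, hs0, ?_, ?_⟩
  · have : s⁻¹ = (s * t⁻¹)⁻¹ * t⁻¹ := by
      rw [mul_inv, inv_inv, mul_assoc, mul_inv_cancel₀ h0', mul_one]
    rw [this]
    exact mul_mem hi hi'
  · rw [mul_inv, inv_inv, mul_comm]

/-- Principle for changing charts: only the generators of the old chart have to be written as
fractions over the new one, with denominators invertible at the point. -/
theorem mem_localRings_of_le_fractionsIn {A B : Subring K} {R : LocalSubring K}
    (h : R ∈ localRings A) (hB : B ≤ R.toSubring) (hA : A ≤ fractionsIn B R.toSubring) :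
    R ∈ localRings B := by
  refine mem_localRings_iff.mpr ⟨hB, fun z hz => ?_⟩
  obtain ⟨s, hs, t, ht, h0, hi, rfl⟩ := (mem_localRings_iff.mp h).2 hz
  exact mul_mem (hA hs) (inv_mem_fractionsIn' (hA ht) h0 hi)

/-- Local rings of the same affine scheme, one of which dominates the other, are equal. -/
theorem eq_of_localRings_of_le {A : Subring K} {R R' : LocalSubring K} (h' : R' ∈ localRings A)
    (hA : A ≤ R.toSubring) (hle : R ≤ R') : R = R' := by
  refine le_antisymm hle (le_iff_maxIdeal.mpr ?_)
  have hsub : R'.toSubring ≤ R.toSubring := by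
    intro z hz
    obtain ⟨s, hs, t, ht, h0, hi, rfl⟩ := (mem_localRings_iff.mp h').2 hz
    refine mul_mem (hA hs) (inv_mem_of_notMem_maxIdeal (hA ht) fun hm => ?_)
    exact notMem_maxIdeal_of_inv_mem h0 hi (mem_maxIdeal_of_le hle hm)
  exact ⟨hsub, fun z hz => mem_maxIdeal_of_liesOn hle.1 (hsub hz.1) hz⟩

/-- A local ring of an affine scheme is determined by its prime ideal. -/
theorem eq_of_localRings {A : Subring K} {R R' : LocalSubring K} (h : R ∈ localRings A)
    (h' : R' ∈ localRings A) (hm : ∀ z ∈ A, z ∈ maxIdeal R ↔ z ∈ maxIdeal R') : R = R' := by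
  obtain ⟨P, hP, rfl⟩ := h
  obtain ⟨P', hP', rfl⟩ := h'
  have : P = P' := by
    ext z
    rw [← mem_maxIdeal_ofPrime z.2, ← mem_maxIdeal_ofPrime z.2, hm z z.2]
  subst this
  rfl

/-- Inclusion of primes reverses to inclusion of localizations: a denominator invertible at `R`
stays invertible at `R'`. -/
theorem localRings_liesOn {A : Subring K} {R R' : LocalSubring K} (h : R ∈ localRings A)
    (hA : A ≤ R'.toSubring) (hm : ∀ z ∈ A, z ∈ maxIdeal R' → z ∈ maxIdeal R) : LiesOn R R' := by
  intro z hz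
  obtain ⟨s, hs, t, ht, h0, hi, rfl⟩ := (mem_localRings_iff.mp h).2 hz
  refine mul_mem (hA hs) (inv_mem_of_notMem_maxIdeal (hA ht) fun hm' => ?_)
  exact notMem_maxIdeal_of_inv_mem h0 hi (hm _ ht hm')

/-! ### Affine charts -/

/-- The ring `ℂ[u, v]`. -/
abbrev affineRing (u v : K) : Subring K := (Algebra.adjoin ℂ {u, v}).toSubring

/-- `u` and `v` generate the field `K`. -/
def Coord (u v : K) : Prop :=
  x ∈ IntermediateField.adjoin ℂ {u, v} ∧ y ∈ IntermediateField.adjoin ℂ {u, v}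

/-- The local subring contains the constants. -/
def ContainsConst (R : LocalSubring K) : Prop := ∀ a : ℂ, const a ∈ R.toSubring

/-- The residue field of `R` is `ℂ`. -/
def HasValues (R : LocalSubring K) : Prop :=
  ContainsConst R ∧ ∀ z ∈ R.toSubring, ∃ a : ℂ, z - const a ∈ maxIdeal R

/-- `R` is the local ring of the origin of the chart with coordinates `u`, `v`. -/
structure IsPt (u v : K) (R : LocalSubring K) : Prop where
  mem : R ∈ localRings (affineRing u v)
  left : u ∈ maxIdeal R
  right : v ∈ maxIdeal R

/-- `R` is the local ring of the curve `u = 0` of the chart with coordinates `u`, `v`. -/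
structure IsDv (u v : K) (R : LocalSubring K) : Prop where
  mem : R ∈ localRings (affineRing u v)
  left : u ∈ maxIdeal R
  right : ∀ p : Polynomial ℂ, Polynomial.aeval v p ∈ maxIdeal R → p = 0

section affineRing

variable {u v : K}

theorem left_mem_affineRing (u v : K) : u ∈ affineRing u v :=
  Algebra.subset_adjoin (by simp)

theorem right_mem_affineRing (u v : K) : v ∈ affineRing u v :=
  Algebra.subset_adjoin (by simp)

theorem const_mem_affineRing (u v : K) (a : ℂ) : const a ∈ affineRing u v :=
  Subalgebra.algebraMap_mem _ a

theorem affineRing_le {R : Subring K} (hc : ∀ a, const a ∈ R) (hu : u ∈ R) (hv : v ∈ R) :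
    affineRing u v ≤ R := by
  intro z hz
  induction hz using Algebra.adjoin_induction with
  | mem z hz =>
    rcases hz with rfl | hz
    · exact hu
    · rw [Set.mem_singleton_iff.mp hz]; exact hv
  | algebraMap r => exact hc r
  | add z w _ _ h1 h2 => exact add_mem h1 h2
  | mul z w _ _ h1 h2 => exact mul_mem h1 h2

theorem affineRing_comm (u v : K) : affineRing u v = affineRing v u := by
  rw [affineRing, affineRing, Set.pair_comm]

theorem aeval_mem_of_mem {R : Subring K} (hc : ∀ a, const a ∈ R) (hv : v ∈ R) (p : Polynomial ℂ) :
    Polynomial.aeval v p ∈ R := by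
  induction p using Polynomial.induction_on' with
  | add p q hp hq => rw [map_add]; exact add_mem hp hq
  | monomial n a =>
    rw [Polynomial.aeval_monomial]
    exact mul_mem (hc a) (pow_mem hv n)

theorem aeval_mem_affineRing (u v : K) (p : Polynomial ℂ) :
    Polynomial.aeval v p ∈ affineRing u v :=
  aeval_mem_of_mem (const_mem_affineRing u v) (right_mem_affineRing u v) p

/-- Restriction to the axis u = 0, where the element becomes p(v). Vanishing along the axis is then
the condition p = 0, as used for `IsDv`. -/
theorem exists_eq_aeval_add {z : K} (hz : z ∈ affineRing u v) :
    ∃ p : Polynomial ℂ, ∃ w ∈ affineRing u v, z = Polynomial.aeval v p + u * w := by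
  induction hz using Algebra.adjoin_induction with
  | mem z hz =>
    rcases hz with rfl | hz
    · exact ⟨0, 1, one_mem _, by simp⟩
    · rw [Set.mem_singleton_iff.mp hz]
      exact ⟨Polynomial.X, 0, zero_mem _, by simp⟩
  | algebraMap r => exact ⟨Polynomial.C r, 0, zero_mem _, by simp⟩
  | add z w _ _ h1 h2 =>
    obtain ⟨p, a, ha, rfl⟩ := h1
    obtain ⟨q, b, hb, rfl⟩ := h2
    exact ⟨p + q, a + b, add_mem ha hb, by rw [map_add]; ring⟩
  | mul z w hz hw h1 h2 =>
    obtain ⟨p, a, ha, rfl⟩ := h1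
    obtain ⟨q, b, hb, rfl⟩ := h2
    refine ⟨p * q, a * (Polynomial.aeval v q + u * b) + Polynomial.aeval v p * b,
      add_mem (mul_mem ha hw) (mul_mem (aeval_mem_affineRing u v p) hb), ?_⟩
    rw [map_mul]; ring

theorem aeval_eq_const_add (v : K) (p : Polynomial ℂ) (a : ℂ) :
    ∃ q : Polynomial ℂ, Polynomial.aeval v p =
      const (p.eval a) + (v - const a) * Polynomial.aeval v q := by
  obtain ⟨q, hq⟩ := Polynomial.X_sub_C_dvd_sub_C_eval (a := a) (p := p)
  refine ⟨q, ?_⟩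
  have := congrArg (Polynomial.aeval v) hq
  simp only [map_sub, map_mul, Polynomial.aeval_X, Polynomial.aeval_C] at this
  linear_combination this

theorem exists_eq_const_add {z : K} (hz : z ∈ affineRing u v) :
    ∃ a : ℂ, ∃ w₁ ∈ affineRing u v, ∃ w₂ ∈ affineRing u v,
      z = const a + u * w₁ + v * w₂ := by
  obtain ⟨p, w, hw, rfl⟩ := exists_eq_aeval_add hz
  obtain ⟨q, hq⟩ := aeval_eq_const_add v p 0
  refine ⟨p.eval 0, w, hw, Polynomial.aeval v q, aeval_mem_affineRing u v q, ?_⟩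
  rw [hq, const, const, map_zero]; ring

theorem containsConst_of_mem {R : LocalSubring K} (h : R ∈ localRings (affineRing u v)) :
    ContainsConst R := fun a => localRings_le h (const_mem_affineRing u v a)

theorem left_mem_of_mem {R : LocalSubring K} (h : R ∈ localRings (affineRing u v)) :
    u ∈ R.toSubring := localRings_le h (left_mem_affineRing u v)

theorem right_mem_of_mem {R : LocalSubring K} (h : R ∈ localRings (affineRing u v)) :
    v ∈ R.toSubring := localRings_le h (right_mem_affineRing u v)

/-- Change of the affine chart around a point. -/
theorem mem_localRings_affineRing_of {u' v' : K} {R : LocalSubring K}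
    (h : R ∈ localRings (affineRing u v)) (hu' : u' ∈ R.toSubring) (hv' : v' ∈ R.toSubring)
    (hu : u ∈ fractionsIn (affineRing u' v') R.toSubring)
    (hv : v ∈ fractionsIn (affineRing u' v') R.toSubring) : R ∈ localRings (affineRing u' v') :=
  mem_localRings_of_le_fractionsIn h (affineRing_le (containsConst_of_mem h) hu' hv')
    (affineRing_le (fun a => le_fractionsIn _ _ (const_mem_affineRing _ _ a)) hu hv)

theorem affineRing_eq {u' v' : K} (hu' : u' ∈ affineRing u v) (hv' : v' ∈ affineRing u v)
    (hu : u ∈ affineRing u' v') (hv : v ∈ affineRing u' v') : affineRing u v = affineRing u' v' :=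
  le_antisymm (affineRing_le (const_mem_affineRing _ _) hu hv)
    (affineRing_le (const_mem_affineRing _ _) hu' hv')

theorem affineRing_sub (u v : K) (a b : ℂ) :
    affineRing u v = affineRing (u - const a) (v - const b) := by
  refine affineRing_eq (sub_mem (left_mem_affineRing _ _) (const_mem_affineRing _ _ _))
    (sub_mem (right_mem_affineRing _ _) (const_mem_affineRing _ _ _)) ?_ ?_
  · have := add_mem (left_mem_affineRing (u - const a) (v - const b))
      (const_mem_affineRing (u - const a) (v - const b) a)
    rwa [sub_add_cancel] at this
  · have := add_mem (right_mem_affineRing (u - const a) (v - const b))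
      (const_mem_affineRing (u - const a) (v - const b) b)
    rwa [sub_add_cancel] at this

theorem affineRing_sub_left (u v : K) (a : ℂ) :
    affineRing u v = affineRing (u - const a) v := by
  have := affineRing_sub u v a 0
  rwa [show v - const 0 = v by rw [const, map_zero, sub_zero]] at this

theorem affineRing_sub_right (u v : K) (b : ℂ) :
    affineRing u v = affineRing u (v - const b) := by
  rw [affineRing_comm, affineRing_sub_left v u b, affineRing_comm]

end affineRing

/-! ### Values of functions in the residue field ℂ -/

section values

variable {R : LocalSubring K}

theorem const_notMem_maxIdeal (h : ContainsConst R) {a : ℂ} (ha : a ≠ 0) :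
    const a ∉ maxIdeal R :=
  notMem_maxIdeal_of_inv_mem ((map_ne_zero _).mpr ha) (by rw [← map_inv₀]; exact h _)

theorem eq_zero_of_const_mem (h : ContainsConst R) {a : ℂ} (ha : const a ∈ maxIdeal R) : a = 0 := by
  by_contra h0
  exact const_notMem_maxIdeal h h0 ha

theorem value_unique (h : ContainsConst R) {z : K} {a b : ℂ} (ha : z - const a ∈ maxIdeal R)
    (hb : z - const b ∈ maxIdeal R) : a = b := by
  have h1 := sub_mem_maxIdeal hb ha
  rw [show z - const b - (z - const a) = const (a - b) by simp only [const, map_sub]; ring] at h1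
  exact sub_eq_zero.mp (eq_zero_of_const_mem h h1)

theorem mem_of_sub_const_mem (h : ContainsConst R) {z : K} {a : ℂ}
    (hz : z - const a ∈ R.toSubring) : z ∈ R.toSubring := by
  have := add_mem hz (h a)
  rwa [sub_add_cancel] at this

theorem inv_mem_of_value (h : ContainsConst R) {z : K} {a : ℂ} (ha : a ≠ 0)
    (hz : z - const a ∈ maxIdeal R) : z⁻¹ ∈ R.toSubring := by
  refine inv_mem_of_notMem_maxIdeal (mem_of_sub_const_mem h hz.1) fun hm => ?_
  exact ha (value_unique h hz (b := 0) (by rwa [const, map_zero, sub_zero]))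

theorem value_mul (h : ContainsConst R) {z w : K} {a b : ℂ} (hz : z - const a ∈ maxIdeal R)
    (hw : w - const b ∈ maxIdeal R) : z * w - const (a * b) ∈ maxIdeal R := by
  have h1 := add_mem_maxIdeal (mul_mem_maxIdeal' hz (mem_of_sub_const_mem h hw.1))
    (mul_mem_maxIdeal (h a) hw)
  rwa [show (z - const a) * w + const a * (w - const b) = z * w - const (a * b) by
    simp only [const, map_mul]; ring] at h1

theorem value_add {z w : K} {a b : ℂ} (hz : z - const a ∈ maxIdeal R)
    (hw : w - const b ∈ maxIdeal R) : z + w - const (a + b) ∈ maxIdeal R := by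
  have h1 := add_mem_maxIdeal hz hw
  rwa [show (z - const a) + (w - const b) = z + w - const (a + b) by
    simp only [const, map_add]; ring] at h1

theorem value_const (a : ℂ) : const a - const a ∈ maxIdeal R := by
  rw [sub_self]; exact zero_mem_maxIdeal

theorem value_inv (h : ContainsConst R) {z : K} {a : ℂ} (ha : a ≠ 0)
    (hz : z - const a ∈ maxIdeal R) : z⁻¹ - const a⁻¹ ∈ maxIdeal R := by
  have hz0 : z ≠ 0 := by
    rintro rfl
    exact ha (value_unique h hz (b := 0) (by rw [const, map_zero, sub_zero]; exact zero_mem_maxIdeal))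
  have ha0 : const a ≠ 0 := (map_ne_zero _).mpr ha
  have h1 := mul_mem_maxIdeal (neg_mem (mul_mem (inv_mem_of_value h ha hz) (h a⁻¹))) hz
  rwa [show -(z⁻¹ * const a⁻¹) * (z - const a) = z⁻¹ - const a⁻¹ by
    simp only [const, map_inv₀] at ha0 ⊢; field_simp; ring] at h1

theorem value_of_liesOn {R' : LocalSubring K} (h : LiesOn R R') (hc : ContainsConst R) {z : K}
    {a : ℂ} (hz : z ∈ R.toSubring) (ha : z - const a ∈ maxIdeal R') : z - const a ∈ maxIdeal R :=
  mem_maxIdeal_of_liesOn h (sub_mem hz (hc a)) ha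

/-- Over a local ring with residue field `ℂ`, containment is domination. -/
theorem le_of_liesOn {R' : LocalSubring K} (h : LiesOn R R') (hc : ContainsConst R)
    (hv : HasValues R') : R ≤ R' := by
  refine le_iff_maxIdeal.mpr ⟨h, fun z hz => ?_⟩
  obtain ⟨a, ha⟩ := hv.2 z (h hz.1)
  have h1 := value_of_liesOn h hc hz.1 ha
  have h2 : (0 : ℂ) = a := value_unique hc (by rwa [const, map_zero, sub_zero]) h1
  rwa [← h2, const, map_zero, sub_zero] at ha

/-- Over ℂ the polynomial splits into linear factors, and since the maximal ideal is prime one of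
them lies in it. The recursion removes one factor at a time. -/
theorem exists_value_of_aeval_mem (hc : ContainsConst R) {v : K} (hv : v ∈ R.toSubring)
    {p : Polynomial ℂ} (hp : p ≠ 0) (h : Polynomial.aeval v p ∈ maxIdeal R) :
    ∃ a : ℂ, p.eval a = 0 ∧ v - const a ∈ maxIdeal R := by
  by_cases hd : p.degree = 0
  · rw [Polynomial.eq_C_of_degree_eq_zero hd, Polynomial.aeval_C] at h
    have := eq_zero_of_const_mem hc h
    rw [Polynomial.eq_C_of_degree_eq_zero hd, this] at hp
    simp at hp
  obtain ⟨a, ha⟩ := IsAlgClosed.exists_root p hd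
  obtain ⟨q, hq⟩ := Polynomial.dvd_iff_isRoot.mpr ha
  by_cases hva : v - const a ∈ maxIdeal R
  · exact ⟨a, ha, hva⟩
  have hq0 : q ≠ 0 := by rintro rfl; simp at hq; exact hp hq
  have hqm : Polynomial.aeval v q ∈ maxIdeal R := by
    by_contra hqm
    refine mul_notMem_maxIdeal (sub_mem hv (hc a)) (aeval_mem_of_mem hc hv q) hva hqm ?_
    rw [hq, map_mul, map_sub, Polynomial.aeval_X, Polynomial.aeval_C] at h
    exact h
  have : q.natDegree < p.natDegree := by
    rw [hq, Polynomial.natDegree_mul (Polynomial.X_sub_C_ne_zero a) hq0,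
      Polynomial.natDegree_X_sub_C]
    omega
  obtain ⟨b, hb, hb'⟩ := exists_value_of_aeval_mem hc hv hq0 hqm
  exact ⟨b, by rw [hq, Polynomial.eval_mul, hb, mul_zero], hb'⟩
termination_by p.natDegree

theorem value_aeval (hc : ContainsConst R) {v : K} {a : ℂ} (hv : v - const a ∈ maxIdeal R)
    (p : Polynomial ℂ) : Polynomial.aeval v p - const (p.eval a) ∈ maxIdeal R := by
  obtain ⟨q, hq⟩ := aeval_eq_const_add v p a
  rw [hq, add_sub_cancel_left]
  exact mul_mem_maxIdeal' hv (aeval_mem_of_mem hc (mem_of_sub_const_mem hc hv.1) q)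

end values

/-! ### Origins and axes of affine charts -/

section charts

variable {u v : K} {R R' : LocalSubring K}

theorem IsPt.containsConst (h : IsPt u v R) : ContainsConst R := containsConst_of_mem h.mem

theorem IsDv.containsConst (h : IsDv u v R) : ContainsConst R := containsConst_of_mem h.mem

theorem IsPt.symm (h : IsPt u v R) : IsPt v u R :=
  ⟨by rw [affineRing_comm]; exact h.mem, h.right, h.left⟩

/-- The value at the origin of an element of `ℂ[u, v]`. -/
theorem IsPt.mem_maxIdeal_iff (h : IsPt u v R) {a : ℂ} {w₁ w₂ : K} (h₁ : w₁ ∈ R.toSubring)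
    (h₂ : w₂ ∈ R.toSubring) : const a + u * w₁ + v * w₂ ∈ maxIdeal R ↔ a = 0 := by
  have h3 := add_mem_maxIdeal (mul_mem_maxIdeal' h.left h₁) (mul_mem_maxIdeal' h.right h₂)
  constructor
  · intro h4
    have h5 := sub_mem_maxIdeal h4 h3
    rw [show const a + u * w₁ + v * w₂ - (u * w₁ + v * w₂) = const a by ring] at h5
    exact eq_zero_of_const_mem h.containsConst h5
  · rintro rfl
    rw [show const 0 + u * w₁ + v * w₂ = u * w₁ + v * w₂ by rw [const, map_zero]; ring]
    exact h3

theorem IsPt.hasValues (h : IsPt u v R) : HasValues R := by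
  refine ⟨h.containsConst, fun z hz => ?_⟩
  obtain ⟨s, hs, t, ht, h0, hi, rfl⟩ := (mem_localRings_iff.mp h.mem).2 hz
  have key : ∀ s ∈ affineRing u v, ∃ a : ℂ, s - const a ∈ maxIdeal R := by
    intro s hs
    obtain ⟨a, w₁, h₁, w₂, h₂, rfl⟩ := exists_eq_const_add hs
    refine ⟨a, ?_⟩
    rw [show const a + u * w₁ + v * w₂ - const a = u * w₁ + v * w₂ by ring]
    exact add_mem_maxIdeal (mul_mem_maxIdeal' h.left (localRings_le h.mem h₁))
      (mul_mem_maxIdeal' h.right (localRings_le h.mem h₂))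
  obtain ⟨a, ha⟩ := key s hs
  obtain ⟨b, hb⟩ := key t ht
  have hb0 : b ≠ 0 := by
    rintro rfl
    rw [const, map_zero, sub_zero] at hb
    exact notMem_maxIdeal_of_inv_mem h0 hi hb
  exact ⟨_, value_mul h.containsConst ha (value_inv h.containsConst hb0 hb)⟩

theorem IsPt.eq (h : IsPt u v R) (h' : IsPt u v R') : R = R' := by
  refine eq_of_localRings h.mem h'.mem fun z hz => ?_
  obtain ⟨a, w₁, h₁, w₂, h₂, rfl⟩ := exists_eq_const_add hz
  rw [h.mem_maxIdeal_iff (localRings_le h.mem h₁) (localRings_le h.mem h₂),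
    h'.mem_maxIdeal_iff (localRings_le h'.mem h₁) (localRings_le h'.mem h₂)]

theorem IsDv.mem_maxIdeal_iff (h : IsDv u v R) {p : Polynomial ℂ} {w : K}
    (hw : w ∈ R.toSubring) : Polynomial.aeval v p + u * w ∈ maxIdeal R ↔ p = 0 := by
  have h3 := mul_mem_maxIdeal' h.left hw
  constructor
  · intro h4
    have h5 := sub_mem_maxIdeal h4 h3
    rw [add_sub_cancel_right] at h5
    exact h.right p h5
  · rintro rfl
    rw [map_zero, zero_add]
    exact h3

theorem IsDv.eq (h : IsDv u v R) (h' : IsDv u v R') : R = R' := by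
  refine eq_of_localRings h.mem h'.mem fun z hz => ?_
  obtain ⟨p, w, hw, rfl⟩ := exists_eq_aeval_add hz
  rw [h.mem_maxIdeal_iff (localRings_le h.mem hw), h'.mem_maxIdeal_iff (localRings_le h'.mem hw)]

/-- A prime of ℂ[u, v] that contains u is (u) or (u, v - a), because ℂ is algebraically closed. -/
theorem isDv_or_isPt (h : R ∈ localRings (affineRing u v)) (hu : u ∈ maxIdeal R) :
    IsDv u v R ∨ ∃ a : ℂ, IsPt u (v - const a) R := by
  by_cases hp : ∃ p : Polynomial ℂ, p ≠ 0 ∧ Polynomial.aeval v p ∈ maxIdeal R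
  · obtain ⟨p, hp0, hp⟩ := hp
    obtain ⟨a, -, ha⟩ := exists_value_of_aeval_mem (containsConst_of_mem h) (right_mem_of_mem h) hp0 hp
    exact Or.inr ⟨a, by rw [← affineRing_sub_right]; exact h, hu, ha⟩
  · push Not at hp
    exact Or.inl ⟨h, hu, fun p hm => by_contra fun h0 => hp p h0 hm⟩

/-- The origin lies on the axis `v = 0`. -/
theorem IsPt.liesOn (h : IsPt u v R) (h' : IsDv v u R') : LiesOn R R' := by
  refine localRings_liesOn h.mem (by rw [affineRing_comm]; exact localRings_le h'.mem) ?_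
  intro z hz hm
  rw [affineRing_comm] at hz
  obtain ⟨p, w, hw, rfl⟩ := exists_eq_aeval_add hz
  rw [h'.mem_maxIdeal_iff (localRings_le h'.mem hw)] at hm
  subst hm
  rw [map_zero, zero_add]
  rw [affineRing_comm] at hw
  exact mul_mem_maxIdeal' h.right (localRings_le h.mem hw)

/-! ### Existence of the local rings of a chart -/

theorem mem_adjoin_of_coord (h : Coord u v) (z : K) : z ∈ IntermediateField.adjoin ℂ {u, v} := by
  obtain ⟨a, b, -, rfl⟩ := IsFractionRing.div_surjective (A := MvPolynomial (Fin 2) ℂ) z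
  have key : ∀ f : MvPolynomial (Fin 2) ℂ,
      algebraMap (MvPolynomial (Fin 2) ℂ) K f ∈ IntermediateField.adjoin ℂ {u, v} := by
    intro f
    induction f using MvPolynomial.induction_on with
    | C a =>
      rw [← MvPolynomial.algebraMap_eq, ← IsScalarTower.algebraMap_apply]
      exact IntermediateField.algebraMap_mem _ a
    | add f g hf hg => rw [map_add]; exact add_mem hf hg
    | mul_X f i hf =>
      rw [map_mul]
      refine mul_mem hf ?_
      fin_cases i
      · exact h.1
      · exact h.2
  exact div_mem (key a) (key b)

theorem Coord.of_mem (h : Coord u v) {u' v' : K}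
    (hu : u ∈ IntermediateField.adjoin ℂ {u', v'})
    (hv : v ∈ IntermediateField.adjoin ℂ {u', v'}) : Coord u' v' := by
  have hle : IntermediateField.adjoin ℂ {u, v} ≤ IntermediateField.adjoin ℂ {u', v'} := by
    rw [IntermediateField.adjoin_le_iff]
    rintro z (rfl | hz)
    · exact hu
    · rw [Set.mem_singleton_iff.mp hz]; exact hv
  exact ⟨hle h.1, hle h.2⟩

theorem coord_xy : Coord x y :=
  ⟨IntermediateField.subset_adjoin _ _ (by simp), IntermediateField.subset_adjoin _ _ (by simp)⟩

theorem left_mem_adjoin (u v : K) : u ∈ IntermediateField.adjoin ℂ {u, v} :=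
  IntermediateField.subset_adjoin _ _ (by simp)

theorem right_mem_adjoin (u v : K) : v ∈ IntermediateField.adjoin ℂ {u, v} :=
  IntermediateField.subset_adjoin _ _ (by simp)

theorem Coord.symm (h : Coord u v) : Coord v u := h.of_mem (right_mem_adjoin _ _) (left_mem_adjoin _ _)

theorem Coord.sub_left (h : Coord u v) (a : ℂ) : Coord (u - const a) v :=
  h.of_mem (by
    have := add_mem (left_mem_adjoin (u - const a) v) (IntermediateField.algebraMap_mem _ a)
    rwa [sub_add_cancel] at this) (right_mem_adjoin _ _)

theorem Coord.sub_right (h : Coord u v) (a : ℂ) : Coord u (v - const a) := (h.symm.sub_left a).symm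

theorem Coord.inv_left (h : Coord u v) : Coord u⁻¹ v :=
  h.of_mem (by simpa using inv_mem (left_mem_adjoin u⁻¹ v)) (right_mem_adjoin _ _)

theorem Coord.inv_right (h : Coord u v) : Coord u v⁻¹ := h.symm.inv_left.symm

theorem Coord.indep (h : Coord u v) : AlgebraicIndependent ℂ ![u, v] :=
  algIndep_of_generate u v h.1 h.2

theorem Coord.left_ne_zero (h : Coord u v) : u ≠ 0 := by
  simpa using h.indep.ne_zero 0

theorem Coord.right_ne_zero (h : Coord u v) : v ≠ 0 := h.symm.left_ne_zero

theorem Coord.div_right (h : Coord u v) : Coord u (v / u) := by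
  refine h.of_mem (left_mem_adjoin _ _) ?_
  have := mul_mem (left_mem_adjoin u (v / u)) (right_mem_adjoin u (v / u))
  rwa [mul_div_cancel₀ _ h.left_ne_zero] at this

theorem Coord.left_sub_ne_zero (h : Coord u v) (a : ℂ) : u - const a ≠ 0 :=
  (h.sub_left a).left_ne_zero

theorem Coord.right_sub_ne_zero (h : Coord u v) (a : ℂ) : v - const a ≠ 0 :=
  (h.sub_right a).right_ne_zero

theorem mem_affineRing_iff {z : K} :
    z ∈ affineRing u v ↔ ∃ f : MvPolynomial (Fin 2) ℂ, MvPolynomial.aeval ![u, v] f = z := by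
  have h : Algebra.adjoin ℂ {u, v} = (MvPolynomial.aeval ![u, v] : _ →ₐ[ℂ] K).range := by
    rw [← Algebra.adjoin_range_eq_range_aeval]
    congr 1
    ext z
    simp [eq_comm, or_comm]
  change z ∈ Algebra.adjoin ℂ {u, v} ↔ _
  rw [h]
  rfl

/-- The isomorphism of a chart with the affine plane. -/
def Coord.equiv (h : Coord u v) : MvPolynomial (Fin 2) ℂ ≃+* affineRing u v :=
  RingEquiv.ofBijective
    (((MvPolynomial.aeval ![u, v] : _ →ₐ[ℂ] K) : MvPolynomial (Fin 2) ℂ →+* K).codRestrict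
      (affineRing u v) fun f => mem_affineRing_iff.mpr ⟨f, rfl⟩)
    ⟨fun f g hfg => h.indep (congrArg Subtype.val hfg), fun z => by
      obtain ⟨f, hf⟩ := mem_affineRing_iff.mp z.2
      exact ⟨f, Subtype.ext hf⟩⟩

theorem Coord.coe_equiv (h : Coord u v) (f : MvPolynomial (Fin 2) ℂ) :
    (h.equiv f : K) = MvPolynomial.aeval ![u, v] f := rfl

theorem Coord.exists_isPt (h : Coord u v) : ∃ R, IsPt u v R := by
  let φ : affineRing u v →+* ℂ :=
    (MvPolynomial.eval (fun _ => (0 : ℂ))).comp h.equiv.symm.toRingHom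
  have key : ∀ f, φ (h.equiv f) = MvPolynomial.eval (fun _ => 0) f := fun f => by
    simp [φ]
  have := RingHom.ker_isPrime φ
  refine ⟨LocalSubring.ofPrime (affineRing u v) (RingHom.ker φ), ⟨_, RingHom.ker_isPrime φ, rfl⟩,
    ?_, ?_⟩
  · rw [mem_maxIdeal_ofPrime (left_mem_affineRing u v), RingHom.mem_ker]
    have : h.equiv (MvPolynomial.X 0) = ⟨u, left_mem_affineRing u v⟩ :=
      Subtype.ext (by rw [h.coe_equiv]; simp)
    rw [← this, key]; simp
  · rw [mem_maxIdeal_ofPrime (right_mem_affineRing u v), RingHom.mem_ker]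
    have : h.equiv (MvPolynomial.X 1) = ⟨v, right_mem_affineRing u v⟩ :=
      Subtype.ext (by rw [h.coe_equiv]; simp)
    rw [← this, key]; simp

/-- The prime is the kernel of u ↦ 0 with values in ℂ[v]; the target is a domain in which v
satisfies no relation. -/
theorem Coord.exists_isDv (h : Coord u v) : ∃ R, IsDv u v R := by
  let ψ : MvPolynomial (Fin 2) ℂ →ₐ[ℂ] Polynomial ℂ :=
    MvPolynomial.aeval ![0, (Polynomial.X : Polynomial ℂ)]
  let φ : affineRing u v →+* Polynomial ℂ :=
    (ψ : MvPolynomial (Fin 2) ℂ →+* Polynomial ℂ).comp h.equiv.symm.toRingHom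
  have key : ∀ f, φ (h.equiv f) = ψ f := fun f => by
    simp [φ]
  have := RingHom.ker_isPrime φ
  refine ⟨LocalSubring.ofPrime (affineRing u v) (RingHom.ker φ), ⟨_, RingHom.ker_isPrime φ, rfl⟩,
    ?_, ?_⟩
  · rw [mem_maxIdeal_ofPrime (left_mem_affineRing u v), RingHom.mem_ker]
    have : h.equiv (MvPolynomial.X 0) = ⟨u, left_mem_affineRing u v⟩ :=
      Subtype.ext (by rw [h.coe_equiv]; simp)
    rw [← this, key]; simp [ψ]
  · intro p hp
    rw [mem_maxIdeal_ofPrime (aeval_mem_affineRing u v p), RingHom.mem_ker] at hp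
    have : h.equiv (Polynomial.aeval (MvPolynomial.X 1) p) =
        ⟨Polynomial.aeval v p, aeval_mem_affineRing u v p⟩ :=
      Subtype.ext (by
        rw [h.coe_equiv, ← Polynomial.aeval_algHom_apply]; simp)
    rw [← this, key, ← Polynomial.aeval_algHom_apply] at hp
    simpa [ψ] using hp

end charts

/-! ### Orders along curves -/

section ord

variable {C : LocalSubring K} {f g : K}

theorem ord_mul (C : LocalSubring K) (hf : f ≠ 0) (hg : g ≠ 0) :
    ord C (f * g) = ord C f + ord C g := by
  unfold ord
  split_ifs with hC
  · have := hC.1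
    have := hC.2
    rw [map_mul, WithZero.log_mul ((Valuation.ne_zero_iff _).mpr hf)
      ((Valuation.ne_zero_iff _).mpr hg)]
    ring
  · rfl

theorem ord_one (C : LocalSubring K) : ord C 1 = 0 := by
  have := ord_mul C (one_ne_zero (α := K)) one_ne_zero
  rw [mul_one] at this
  linarith

theorem ord_inv (C : LocalSubring K) (hf : f ≠ 0) : ord C f⁻¹ = -ord C f := by
  have := ord_mul C hf (inv_ne_zero hf)
  rw [mul_inv_cancel₀ hf, ord_one] at this
  linarith

theorem ord_div (C : LocalSubring K) (hf : f ≠ 0) (hg : g ≠ 0) :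
    ord C (f / g) = ord C f - ord C g := by
  rw [div_eq_mul_inv, ord_mul C hf (inv_ne_zero hg), ord_inv C hg]; ring

theorem ord_pow (C : LocalSubring K) (hf : f ≠ 0) (n : ℕ) : ord C (f ^ n) = n * ord C f := by
  induction n with
  | zero => simp [ord_one]
  | succ n ih => rw [pow_succ, ord_mul C (pow_ne_zero n hf) hf, ih]; push_cast; ring

theorem mem_iff_ord_nonneg (hC : IsDVR C) (hf : f ≠ 0) : f ∈ C.toSubring ↔ 0 ≤ ord C f := by
  have := hC.1
  have := hC.2
  have h1 : 0 ≤ ord C f ↔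
      (IsDiscreteValuationRing.maximalIdeal C.toSubring).valuation K f ≤ 1 := by
    rw [ord, dif_pos hC, neg_nonneg, ← WithZero.log_one,
      WithZero.log_le_log ((Valuation.ne_zero_iff _).mpr hf) one_ne_zero]
  rw [h1]
  constructor
  · intro h
    exact IsDedekindDomain.HeightOneSpectrum.valuation_le_one _ (⟨f, h⟩ : C.toSubring)
  · intro h
    obtain ⟨a, rfl⟩ := IsDiscreteValuationRing.exists_lift_of_le_one h
    exact a.2

theorem mem_maxIdeal_iff_ord_pos (hC : IsDVR C) (hf : f ≠ 0) : f ∈ maxIdeal C ↔ 0 < ord C f := by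
  rw [mem_maxIdeal, mem_iff_ord_nonneg hC hf, mem_iff_ord_nonneg hC (inv_ne_zero hf), ord_inv C hf]
  simp only [hf, imp_false]
  omega

theorem ord_eq_zero (hC : IsDVR C) (hf : f ≠ 0) (h : f ∈ C.toSubring) (h' : f ∉ maxIdeal C) :
    ord C f = 0 := by
  rw [mem_iff_ord_nonneg hC hf] at h
  rw [mem_maxIdeal_iff_ord_pos hC hf] at h'
  omega

/-- Compare with a uniformizer π: f has positive order, and π/f is regular, so ord f ≤ ord π = 1. -/
theorem ord_uniformizer (hC : IsDVR C) (hf : f ≠ 0) (h : f ∈ maxIdeal C)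
    (hdvd : ∀ z ∈ maxIdeal C, z / f ∈ C.toSubring) : ord C f = 1 := by
  have := hC.1
  have := hC.2
  obtain ⟨π, hπ⟩ := (IsDiscreteValuationRing.maximalIdeal C.toSubring).valuation_exists_uniformizer K
  have hπ0 : π ≠ 0 := by
    rintro rfl
    rw [map_zero] at hπ
    exact WithZero.exp_ne_zero hπ.symm
  have h1 : ord C π = 1 := by
    rw [ord, dif_pos hC, hπ]
    simp
  have h2 := hdvd π ((mem_maxIdeal_iff_ord_pos hC hπ0).mpr (by omega))
  rw [mem_iff_ord_nonneg hC (div_ne_zero hπ0 hf), ord_div C hπ0 hf] at h2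
  rw [mem_maxIdeal_iff_ord_pos hC hf] at h
  omega

end ord

/-! ### Curves as discrete valuation rings; functions without poles -/

section dvr

variable {u v : K} {R : LocalSubring K}

theorem Coord.exists_fraction (h : Coord u v) (z : K) :
    ∃ s ∈ affineRing u v, ∃ t ∈ affineRing u v, z = s / t := by
  obtain ⟨a, ha, b, hb, rfl⟩ := IntermediateField.mem_adjoin_iff_div.mp (mem_adjoin_of_coord h z)
  exact ⟨a, ha, b, hb, rfl⟩

theorem Coord.isFractionRing (h : Coord u v) {A : Subring K} (hA : affineRing u v ≤ A) :
    IsFractionRing A K := by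
  refine IsFractionRing.of_field A K fun z => ?_
  obtain ⟨s, hs, t, ht, rfl⟩ := h.exists_fraction z
  exact ⟨⟨s, hA hs⟩, ⟨t, hA ht⟩, rfl⟩

theorem Coord.isNoetherianRing (h : Coord u v) (hR : R ∈ localRings (affineRing u v)) :
    IsNoetherianRing R.toSubring := by
  obtain ⟨P, hP, rfl⟩ := hR
  have : IsNoetherianRing (affineRing u v) := isNoetherianRing_of_ringEquiv _ h.equiv
  exact IsLocalization.isNoetherianRing P.primeCompl _ this

/-- A Noetherian local domain whose maximal ideal is nonzero and principal is a discrete valuation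
ring. Noetherianity comes from the polynomial ring in two variables. -/
theorem Coord.isDVR_of_uniformizer (h : Coord u v) (hR : R ∈ localRings (affineRing u v)) {t : K}
    (ht0 : t ≠ 0) (ht : t ∈ maxIdeal R) (hdvd : ∀ z ∈ maxIdeal R, z / t ∈ R.toSubring) :
    IsDVR R := by
  refine ⟨?_, h.isFractionRing (localRings_le hR)⟩
  have := h.isNoetherianRing hR
  obtain ⟨htR, htm⟩ := ht
  have hnf : ¬ IsField R.toSubring := by
    rw [IsLocalRing.isField_iff_maximalIdeal_eq]
    intro hbot
    rw [hbot, Ideal.mem_bot] at htm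
    exact ht0 (congrArg Subtype.val htm)
  have hiff : IsDiscreteValuationRing R.toSubring ↔
      (IsLocalRing.maximalIdeal R.toSubring).IsPrincipal :=
    (IsDiscreteValuationRing.TFAE R.toSubring hnf).out 0 4
  refine hiff.mpr ⟨⟨⟨t, htR⟩, ?_⟩⟩
  refine le_antisymm (fun z hz => ?_) ?_
  · rw [Submodule.mem_span_singleton]
    refine ⟨⟨(z : K) / t, hdvd z ⟨z.2, hz⟩⟩, Subtype.ext ?_⟩
    change (z : K) / t * t = z
    rw [div_mul_cancel₀ _ ht0]
  · rw [Submodule.span_singleton_le_iff_mem]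
    exact htm

theorem IsDv.div_mem (h : IsDv u v R) (hu : u ≠ 0) {z : K} (hz : z ∈ maxIdeal R) :
    z / u ∈ R.toSubring := by
  obtain ⟨s, hs, t, ht, h0, hi, rfl⟩ := (mem_localRings_iff.mp h.mem).2 hz.1
  obtain ⟨p, w, hw, rfl⟩ := exists_eq_aeval_add hs
  have hs' : Polynomial.aeval v p + u * w ∈ maxIdeal R := by
    have := mul_mem_maxIdeal' hz (localRings_le h.mem ht)
    rwa [inv_mul_cancel_right₀ h0] at this
  rw [h.mem_maxIdeal_iff (localRings_le h.mem hw)] at hs'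
  subst hs'
  rw [map_zero, zero_add, mul_assoc, mul_div_cancel_left₀ _ hu]
  exact mul_mem (localRings_le h.mem hw) hi

theorem IsDv.isDVR (h : IsDv u v R) (hc : Coord u v) : IsDVR R :=
  hc.isDVR_of_uniformizer h.mem hc.left_ne_zero h.left fun _ => h.div_mem hc.left_ne_zero

theorem IsDv.ord_left (h : IsDv u v R) (hc : Coord u v) : ord R u = 1 :=
  ord_uniformizer (h.isDVR hc) hc.left_ne_zero h.left fun _ => h.div_mem hc.left_ne_zero

theorem IsDv.right_notMem (h : IsDv u v R) (a : ℂ) : v - const a ∉ maxIdeal R := by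
  intro hm
  refine Polynomial.X_sub_C_ne_zero a (h.right (Polynomial.X - Polynomial.C a) ?_)
  simpa using hm

theorem IsDv.right_notMem' (h : IsDv u v R) : v ∉ maxIdeal R := by
  have := h.right_notMem 0
  rwa [const, map_zero, sub_zero] at this

theorem IsDv.right_inv_mem (h : IsDv u v R) : v⁻¹ ∈ R.toSubring :=
  inv_mem_of_notMem_maxIdeal (right_mem_of_mem h.mem) h.right_notMem'

theorem IsDv.ord_aeval (h : IsDv u v R) (hc : Coord u v) {p : Polynomial ℂ} (hp : p ≠ 0) :
    ord R (Polynomial.aeval v p) = 0 := by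
  have hm : Polynomial.aeval v p ∉ maxIdeal R := fun hm => hp (h.right p hm)
  refine ord_eq_zero (h.isDVR hc) ?_
    (aeval_mem_of_mem h.containsConst (right_mem_of_mem h.mem) p) hm
  intro h0
  exact hm (by rw [h0]; exact zero_mem_maxIdeal)

theorem IsDv.ord_sub_right (h : IsDv u v R) (hc : Coord u v) (a : ℂ) : ord R (v - const a) = 0 := by
  have := h.ord_aeval hc (Polynomial.X_sub_C_ne_zero a)
  simpa using this

theorem IsDv.ord_right (h : IsDv u v R) (hc : Coord u v) : ord R v = 0 := by
  have := h.ord_aeval hc Polynomial.X_ne_zero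
  simpa using this

/-- A valuation ring would contain v/u or u/v. If v/u = s/t at the origin, then v t = u s;
restriction to u = 0 shows that t vanishes on that axis, hence at the origin, so t is no admissible
denominator. The roles of u and v are symmetric. -/
theorem IsPt.not_isDVR (h : IsPt u v R) (hc : Coord u v) : ¬ IsDVR R := by
  suffices H : ∀ u v : K, IsPt u v R → Coord u v → v / u ∉ R.toSubring by
    intro hD
    have h1 := H u v h hc
    have h2 := H v u h.symm hc.symm
    have hu := hc.left_ne_zero
    have hv := hc.right_ne_zero
    rw [mem_iff_ord_nonneg hD (div_ne_zero hv hu), ord_div R hv hu] at h1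
    rw [mem_iff_ord_nonneg hD (div_ne_zero hu hv), ord_div R hu hv] at h2
    omega
  intro u v h hc hm
  obtain ⟨s, hs, t, ht, h0, hi, e⟩ := (mem_localRings_iff.mp h.mem).2 hm
  obtain ⟨V, hV⟩ := hc.exists_isDv
  have e' : v * t = u * s := by
    have := hc.left_ne_zero
    field_simp at e
    linear_combination e
  have h1 : v * t ∈ maxIdeal V := by
    rw [e']; exact mul_mem_maxIdeal' hV.left (localRings_le hV.mem hs)
  have h2 : t ∈ maxIdeal V := by
    by_contra h2
    exact mul_notMem_maxIdeal (right_mem_of_mem hV.mem) (localRings_le hV.mem ht)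
      hV.right_notMem' h2 h1
  obtain ⟨p, w, hw, rfl⟩ := exists_eq_aeval_add ht
  rw [hV.mem_maxIdeal_iff (localRings_le hV.mem hw)] at h2
  subst h2
  rw [map_zero, zero_add] at h0 hi
  exact notMem_maxIdeal_of_inv_mem h0 hi (mul_mem_maxIdeal' h.left (localRings_le h.mem hw))

/-- A curve in an affine chart on which `u` vanishes is the axis `u = 0`. -/
theorem isDv_of_isDVR (hc : Coord u v) (h : R ∈ localRings (affineRing u v)) (hu : u ∈ maxIdeal R)
    (hD : IsDVR R) : IsDv u v R := by
  rcases isDv_or_isPt h hu with h | ⟨a, h⟩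
  · exact h
  · exact absurd hD (h.not_isDVR (hc.sub_right a))

theorem Coord.uniqueFactorizationMonoid (h : Coord u v) :
    UniqueFactorizationMonoid (affineRing u v) :=
  h.equiv.toMulEquiv.uniqueFactorizationMonoid inferInstance

/-- A rational function without poles along the curves of an affine chart is a polynomial. -/
theorem Coord.mem_affineRing_of_ord_nonneg (h : Coord u v) {f : K} (hf : f ≠ 0)
    (hord : ∀ R ∈ localRings (affineRing u v), IsDVR R → 0 ≤ ord R f) : f ∈ affineRing u v := by
  have := h.uniqueFactorizationMonoid
  have := h.isFractionRing le_rfl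
  obtain ⟨a, ⟨b, hb⟩, hab, rfl⟩ := IsFractionRing.exists_reduced_fraction (affineRing u v) f
  by_cases hu : IsUnit b
  · obtain ⟨b', hb'⟩ := hu.exists_right_inv
    have : IsLocalization.mk' K a ⟨b, hb⟩ = algebraMap (affineRing u v) K (a * b') := by
      rw [IsLocalization.mk'_eq_iff_eq_mul, ← map_mul, mul_assoc, mul_comm b', hb', mul_one]
    rw [this]
    exact (a * b').2
  exfalso
  have hb0 : b ≠ 0 := nonZeroDivisors.ne_zero hb
  -- An irreducible factor p of the reduced denominator defines a curve. Regularity of the fraction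
  -- there would force p to divide the numerator as well.
  obtain ⟨p, hp, hpb⟩ := WfDvdMonoid.exists_irreducible_factor hu hb0
  have hpp : Prime p := hp.prime
  have hP : (Ideal.span {p}).IsPrime := (Ideal.span_singleton_prime hpp.ne_zero).mpr hpp
  set R := LocalSubring.ofPrime (affineRing u v) (Ideal.span {p}) with hRdef
  have hR : R ∈ localRings (affineRing u v) := ⟨_, hP, rfl⟩
  have hmem : ∀ z : affineRing u v, (z : K) ∈ maxIdeal R ↔ p ∣ z := fun z => by
    rw [hRdef, mem_maxIdeal_ofPrime z.2, Ideal.mem_span_singleton]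
  have hp0 : (p : K) ≠ 0 := fun h0 => hpp.ne_zero (Subtype.ext h0)
  have hD : IsDVR R := by
    refine h.isDVR_of_uniformizer hR hp0 ((hmem p).mpr dvd_rfl) fun z hz => ?_
    obtain ⟨s, hs, t, ht, h0, hi, rfl⟩ := (mem_localRings_iff.mp hR).2 hz.1
    have hs' : s ∈ maxIdeal R := by
      have := mul_mem_maxIdeal' hz (localRings_le hR ht)
      rwa [inv_mul_cancel_right₀ h0] at this
    obtain ⟨w, hw⟩ := (hmem ⟨s, hs⟩).mp hs'
    have hw' : s = p * w := congrArg Subtype.val hw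
    rw [hw', mul_assoc, mul_div_cancel_left₀ _ hp0]
    exact mul_mem (localRings_le hR w.2) hi
  have h1 := (mem_iff_ord_nonneg hD hf).mpr (hord R hR hD)
  have h2 : IsLocalization.mk' K a ⟨b, hb⟩ * (b : K) = a :=
    IsLocalization.mk'_spec K a ⟨b, hb⟩
  have h3 : (a : K) ∈ maxIdeal R := by
    rw [← h2]
    exact mul_mem_maxIdeal h1 ((hmem b).mpr hpb)
  exact hpp.not_isUnit (hab ((hmem a).mp h3) hpb)

end dvr

/-! ### The exceptional curve of the blow-up of a point -/

section exceptional

variable {u v : K} {P R : LocalSubring K}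

theorem IsPt.exists_eq (h : IsPt u v P) {z : K} (hz : z ∈ maxIdeal P) :
    ∃ a ∈ P.toSubring, ∃ b ∈ P.toSubring, z = a * u + b * v := by
  obtain ⟨s, hs, t, ht, h0, hi, rfl⟩ := (mem_localRings_iff.mp h.mem).2 hz.1
  obtain ⟨a, w₁, h₁, w₂, h₂, rfl⟩ := exists_eq_const_add hs
  have hs' : const a + u * w₁ + v * w₂ ∈ maxIdeal P := by
    have := mul_mem_maxIdeal' hz (localRings_le h.mem ht)
    rwa [inv_mul_cancel_right₀ h0] at this
  rw [h.mem_maxIdeal_iff (localRings_le h.mem h₁) (localRings_le h.mem h₂)] at hs'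
  subst hs'
  refine ⟨w₁ * t⁻¹, mul_mem (localRings_le h.mem h₁) hi, w₂ * t⁻¹,
    mul_mem (localRings_le h.mem h₂) hi, ?_⟩
  rw [const, map_zero]; ring

theorem affineRing_le_affineRing_div (hu : u ≠ 0) : affineRing u v ≤ affineRing u (v / u) := by
  refine affineRing_le (const_mem_affineRing _ _) (left_mem_affineRing _ _) ?_
  have := mul_mem (left_mem_affineRing u (v / u)) (right_mem_affineRing u (v / u))
  rwa [mul_div_cancel₀ _ hu] at this

/-- A local ring that contains `ℂ[u, v]` and in which `u`, `v` are not invertible dominates the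
local ring of the origin. -/
theorem IsPt.le_of_mem (h : IsPt u v P) (hc : ContainsConst R) (hu : u ∈ maxIdeal R)
    (hv : v ∈ maxIdeal R) : P ≤ R := by
  have hA : affineRing u v ≤ R.toSubring := affineRing_le hc hu.1 hv.1
  have hsub : LiesOn P R := by
    refine localRings_liesOn h.mem hA fun z hz hm => ?_
    obtain ⟨a, w₁, h₁, w₂, h₂, rfl⟩ := exists_eq_const_add hz
    rw [h.mem_maxIdeal_iff (localRings_le h.mem h₁) (localRings_le h.mem h₂)]
    have h3 := sub_mem_maxIdeal (sub_mem_maxIdeal hm (mul_mem_maxIdeal' hu (hA h₁)))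
      (mul_mem_maxIdeal' hv (hA h₂))
    rw [show const a + u * w₁ + v * w₂ - u * w₁ - v * w₂ = const a by ring] at h3
    exact eq_zero_of_const_mem hc h3
  refine le_iff_maxIdeal.mpr ⟨hsub, fun z hz => ?_⟩
  obtain ⟨a, ha, b, hb, rfl⟩ := h.exists_eq hz
  exact add_mem_maxIdeal (mul_mem_maxIdeal (hsub ha) hu) (mul_mem_maxIdeal (hsub hb) hv)

/-- `exceptionalFibre` admits every nonzero z of the maximal ideal as denominator. Where u/z is a
unit, z may be exchanged for u, and the chart becomes the standard one with coordinates u, v/u. -/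
theorem IsPt.mem_localRings_of_blowUpChart (h : IsPt u v P) (hu : u ≠ 0) (hle : P ≤ R) {z : K}
    (hz : z ∈ maxIdeal P) (hz0 : z ≠ 0) (hR : R ∈ localRings (blowUpChart P z))
    (hunit : u / z ∉ maxIdeal R) : R ∈ localRings (affineRing u (v / u)) := by
  have hchart : ∀ w ∈ maxIdeal P, w / z ∈ R.toSubring := fun w hw =>
    localRings_le hR (Subring.subset_closure (Or.inr ⟨w, hw, rfl⟩))
  have hzu : z / u ∈ R.toSubring := by
    have := inv_mem_of_notMem_maxIdeal (hchart u h.left) hunit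
    rwa [inv_div] at this
  have hvu : v / u ∈ R.toSubring := by
    have := mul_mem (hchart v h.right) hzu
    rwa [div_mul_div_cancel₀ hz0] at this
  have hc : ContainsConst R := fun a => mem_of_le hle (h.containsConst a)
  have hA : affineRing u (v / u) ≤ R.toSubring := affineRing_le hc (mem_of_le hle h.left.1) hvu
  have hP : P.toSubring ≤ fractionsIn (affineRing u (v / u)) R.toSubring := by
    intro w hw
    obtain ⟨s, hs, t, ht, h0, hi, rfl⟩ := (mem_localRings_iff.mp h.mem).2 hw
    exact ⟨s, affineRing_le_affineRing_div hu hs, t, affineRing_le_affineRing_div hu ht, h0,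
      mem_of_le hle hi, rfl⟩
  have hmu : ∀ w ∈ maxIdeal P, w / u ∈ fractionsIn (affineRing u (v / u)) R.toSubring := by
    intro w hw
    obtain ⟨a, ha, b, hb, rfl⟩ := h.exists_eq hw
    rw [show (a * u + b * v) / u = a + b * (v / u) by field_simp]
    exact add_mem (hP ha) (mul_mem (hP hb) (le_fractionsIn _ _ (right_mem_affineRing _ _)))
  refine mem_localRings_of_le_fractionsIn hR hA ?_
  rw [blowUpChart, Subring.closure_le]
  rintro w (hw | ⟨w, hw, rfl⟩)
  · exact hP hw
  · rw [← div_mul_div_cancel₀ (a := w) (c := z) hu]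
    refine mul_mem (hmu w hw) ?_
    have := inv_mem_fractionsIn' (hmu z hz) (div_ne_zero hz0 hu)
      (by rw [inv_div]; exact hchart u h.left)
    rwa [inv_div] at this

theorem IsPt.mem_exceptionalFibre (h : IsPt u v P) (hu : u ≠ 0)
    (hR : R ∈ localRings (affineRing u (v / u))) (hm : u ∈ maxIdeal R) :
    R ∈ exceptionalFibre P := by
  have hc := containsConst_of_mem hR
  have hv : v ∈ maxIdeal R := by
    have := mul_mem_maxIdeal' hm (right_mem_of_mem hR)
    rwa [mul_div_cancel₀ _ hu] at this
  have hle := h.le_of_mem hc hm hv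
  refine ⟨hle, u, h.left, hu, ?_⟩
  have hB : blowUpChart P u ≤ R.toSubring := by
    rw [blowUpChart, Subring.closure_le]
    rintro w (hw | ⟨w, hw, rfl⟩)
    · exact mem_of_le hle hw
    · obtain ⟨a, ha, b, hb, rfl⟩ := h.exists_eq hw
      rw [show (a * u + b * v) / u = a + b * (v / u) by field_simp]
      exact add_mem (mem_of_le hle ha) (mul_mem (mem_of_le hle hb) (right_mem_of_mem hR))
  refine mem_localRings_of_le_fractionsIn hR hB (le_trans ?_ (le_fractionsIn _ _))
  exact affineRing_le (fun a => Subring.subset_closure (Or.inl (h.containsConst a)))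
    (Subring.subset_closure (Or.inl h.left.1))
    (Subring.subset_closure (Or.inr ⟨v, h.right, rfl⟩))

/-- Writing z = a u + b v gives 1 = a (u/z) + b (v/z), so u/z or v/z is a unit and one of the two
standard charts applies. -/
theorem IsPt.exceptionalFibre_iff (h : IsPt u v P) (hc : Coord u v) :
    R ∈ exceptionalFibre P ↔ (R ∈ localRings (affineRing u (v / u)) ∧ u ∈ maxIdeal R) ∨
      (R ∈ localRings (affineRing v (u / v)) ∧ v ∈ maxIdeal R) := by
  have hu := hc.left_ne_zero
  have hv := hc.right_ne_zero
  constructor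
  · rintro ⟨hle, z, hz, hz0, hR⟩
    obtain ⟨a, ha, b, hb, e⟩ := h.exists_eq hz
    by_cases hunit : u / z ∈ maxIdeal R
    · refine Or.inr ⟨h.symm.mem_localRings_of_blowUpChart hv hle hz hz0 hR fun hunit' => ?_,
        mem_maxIdeal_of_le hle h.right⟩
      have h1 := add_mem_maxIdeal (mul_mem_maxIdeal (mem_of_le hle ha) hunit)
        (mul_mem_maxIdeal (mem_of_le hle hb) hunit')
      rw [show a * (u / z) + b * (v / z) = 1 by
        rw [mul_div_assoc', mul_div_assoc', ← add_div, ← e, div_self hz0]] at h1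
      exact one_notMem_maxIdeal h1
    · exact Or.inl ⟨h.mem_localRings_of_blowUpChart hu hle hz hz0 hR hunit,
        mem_maxIdeal_of_le hle h.left⟩
  · rintro (⟨h1, h2⟩ | ⟨h1, h2⟩)
    · exact h.mem_exceptionalFibre hu h1 h2
    · exact h.symm.mem_exceptionalFibre hv h1 h2

/-- The exceptional curve is the same in both charts: the ratio u/v is a unit at its generic point.
-/
theorem IsDv.swap_chart (h : IsDv v (u / v) R) (hc : Coord u v) : IsDv u (v / u) R := by
  have hu := hc.left_ne_zero
  have hv := hc.right_ne_zero
  have hvu : v / u ∈ R.toSubring := by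
    have := h.right_inv_mem
    rwa [inv_div] at this
  have hum : u ∈ maxIdeal R := by
    have := mul_mem_maxIdeal' h.left (right_mem_of_mem h.mem)
    rwa [mul_div_cancel₀ _ hv] at this
  refine isDv_of_isDVR hc.div_right ?_ hum (h.isDVR hc.symm.div_right)
  refine mem_localRings_affineRing_of h.mem hum.1 hvu ?_ ?_
  · have := mul_mem (left_mem_affineRing u (v / u)) (right_mem_affineRing u (v / u))
    rw [mul_div_cancel₀ _ hu] at this
    exact le_fractionsIn _ _ this
  · have := inv_mem_fractionsIn (R := R.toSubring) (right_mem_affineRing u (v / u))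
      (div_ne_zero hv hu) (by rw [inv_div]; exact right_mem_of_mem h.mem)
    rwa [inv_div] at this

/-- The exceptional curve is unique. -/
theorem IsPt.isDv_of_exceptionalFibre (h : IsPt u v P) (hc : Coord u v)
    (hR : R ∈ exceptionalFibre P) (hD : IsDVR R) : IsDv u (v / u) R := by
  rcases (h.exceptionalFibre_iff hc).mp hR with ⟨h1, h2⟩ | ⟨h1, h2⟩
  · exact isDv_of_isDVR hc.div_right h1 h2 hD
  · exact (isDv_of_isDVR hc.symm.div_right h1 h2 hD).swap_chart hc

/-- The point of the exceptional curve that lies on the strict transform of `v = 0`. -/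
theorem IsPt.isPt_of_liesOn_strictTransform (h : IsPt u v P) (hc : Coord u v)
    (hR : R ∈ exceptionalFibre P) {D : LocalSubring K} (hD : IsDv v u D)
    (hRD : LiesOn R D) : IsPt u (v / u) R := by
  have hv := hc.right_ne_zero
  rcases (h.exceptionalFibre_iff hc).mp hR with ⟨h1, h2⟩ | ⟨h1, h2⟩
  · have hw : v / u ∈ maxIdeal D := by
      rw [div_eq_mul_inv]
      exact mul_mem_maxIdeal' hD.left hD.right_inv_mem
    exact ⟨h1, h2, mem_maxIdeal_of_liesOn hRD (right_mem_of_mem h1) hw⟩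
  · exfalso
    apply hD.right_notMem'
    have := mul_mem_maxIdeal' hD.left (hRD (right_mem_of_mem h1))
    rwa [mul_div_cancel₀ _ hv] at this

end exceptional

/-! ### Closed points -/

section closed

variable {u v : K} {R : LocalSubring K}

theorem IsPt.value_aeval {a b : ℂ} (h : IsPt (u - const a) (v - const b) R)
    (f : MvPolynomial (Fin 2) ℂ) :
    MvPolynomial.aeval ![u, v] f - const (MvPolynomial.eval ![a, b] f) ∈ maxIdeal R := by
  induction f using MvPolynomial.induction_on with
  | C r =>
    rw [MvPolynomial.aeval_C, MvPolynomial.eval_C]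
    exact value_const r
  | add f g hf hg => rw [map_add, map_add]; exact value_add hf hg
  | mul_X f i hf =>
    rw [map_mul, map_mul, MvPolynomial.aeval_X, MvPolynomial.eval_X]
    refine value_mul h.containsConst hf ?_
    fin_cases i
    · exact h.left
    · exact h.right

/-- Every point of an affine chart either is a closed point, or has infinitely many closed points
of the chart in its closure. -/
theorem Coord.isPt_or_exists (hc : Coord u v) (hR : R ∈ localRings (affineRing u v))
    {T : Set (LocalSubring K)} (hT : T.Finite) :
    (∃ a b : ℂ, IsPt (u - const a) (v - const b) R) ∨
      ∃ R', ∃ a b : ℂ, IsPt (u - const a) (v - const b) R' ∧ LiesOn R' R ∧ R' ∉ T := by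
  by_contra! hcon
  obtain ⟨hcon1, hcon2⟩ := hcon
  obtain ⟨P, hP, rfl⟩ := hR
  set R := LocalSubring.ofPrime (affineRing u v) P with hRdef
  have hR : R ∈ localRings (affineRing u v) := ⟨P, hP, rfl⟩
  let Q : Ideal (MvPolynomial (Fin 2) ℂ) := P.comap hc.equiv.toRingHom
  have hQp : Q.IsPrime := Ideal.IsPrime.comap _
  have hQ : ∀ f, f ∈ Q ↔ MvPolynomial.aeval ![u, v] f ∈ maxIdeal R := fun f => by
    rw [hRdef, mem_maxIdeal_ofPrime (mem_affineRing_iff.mpr ⟨f, rfl⟩)]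
    rfl
  have hex : ∀ a : Fin 2 → ℂ, ∃ R', IsPt (u - const (a 0)) (v - const (a 1)) R' := fun a =>
    ((hc.sub_left (a 0)).sub_right (a 1)).exists_isPt
  choose pt hpt using hex
  have hval : ∀ a f, MvPolynomial.aeval ![u, v] f - const (MvPolynomial.eval a f) ∈
      maxIdeal (pt a) := fun a f => by
    have := (hpt a).value_aeval f
    rwa [show ![a 0, a 1] = a by ext i; fin_cases i <;> rfl] at this
  have hinj : Function.Injective pt := fun a b hab => by
    have h1 := hpt a
    rw [hab] at h1
    ext i
    fin_cases i
    · exact value_unique h1.containsConst h1.left (hpt b).left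
    · exact value_unique h1.containsConst h1.right (hpt b).right
  have hloc : ∀ a ∈ MvPolynomial.zeroLocus ℂ Q, pt a ∈ T := fun a ha => by
    refine hcon2 _ _ _ (hpt a) ?_
    refine localRings_liesOn (A := affineRing u v) ?_ (localRings_le hR) fun z hz hm => ?_
    · rw [affineRing_sub u v (a 0) (a 1)]; exact (hpt a).mem
    · obtain ⟨f, rfl⟩ := mem_affineRing_iff.mp hz
      have h1 := MvPolynomial.mem_zeroLocus_iff.mp ha f ((hQ f).mpr hm)
      have h2 := hval a f
      rw [MvPolynomial.aeval_eq_eval] at h1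
      rwa [show MvPolynomial.eval a f = 0 from h1, const, map_zero, sub_zero] at h2
  have hfin : (MvPolynomial.zeroLocus ℂ Q).Finite :=
    (hT.preimage (hinj.injOn)).subset hloc
  -- By the Nullstellensatz the prime Q is the ideal of its zero locus. If that locus is finite, Q
  -- contains a finite intersection of maximal ideals, hence contains one of them, so the point is
  -- closed.
  have hle : hfin.toFinset.inf (fun a => MvPolynomial.vanishingIdeal ℂ {a}) ≤ Q := by
    refine le_trans ?_ (MvPolynomial.IsPrime.vanishingIdeal_zeroLocus (K := ℂ) Q).le
    intro f hf a ha
    have h1 := (Finset.inf_le (f := fun a => MvPolynomial.vanishingIdeal ℂ {a})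
      (hfin.mem_toFinset.mpr ha)) hf
    exact h1 a rfl
  obtain ⟨a, ha, hle⟩ := hQp.inf_le'.mp hle
  have hmemQ : ∀ f, MvPolynomial.eval a f = 0 → MvPolynomial.aeval ![u, v] f ∈ maxIdeal R := by
    intro f hf
    rw [← hQ]
    apply hle
    rw [MvPolynomial.mem_vanishingIdeal_singleton_iff, MvPolynomial.aeval_eq_eval]
    exact hf
  refine hcon1 (a 0) (a 1) ⟨by rw [← affineRing_sub]; exact hR, ?_, ?_⟩
  · have := hmemQ (MvPolynomial.X 0 - MvPolynomial.C (a 0)) (by simp)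
    simpa using this
  · have := hmemQ (MvPolynomial.X 1 - MvPolynomial.C (a 1)) (by simp)
    simpa using this

/-- Around each of its points, `M` is an affine plane without a finite set of points. -/
def IsCharted (M : Set (LocalSubring K)) : Prop :=
  ∀ R ∈ M, ∃ u v, Coord u v ∧ R ∈ localRings (affineRing u v) ∧ ∃ T : Set (LocalSubring K),
    T.Finite ∧ ∀ R' ∈ localRings (affineRing u v), LiesOn R' R → R' ∈ M ∪ T

/-- Closedness is defined in `M`, not in the chart. A point that is not closed in the chart
specializes to infinitely many closed points of the chart; one of them avoids the finite exceptional
set, hence lies in `M` and must coincide with the given point. -/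
theorem IsCharted.exists_isPt {M : Set (LocalSubring K)} (hM : IsCharted M)
    (hR : IsClosedPoint M R) : ∃ u v, Coord u v ∧ IsPt u v R := by
  obtain ⟨u, v, hc, hmem, T, hT, hloc⟩ := hM R hR.1
  rcases hc.isPt_or_exists hmem hT with ⟨a, b, h⟩ | ⟨R', a, b, h, hl, hnT⟩
  · exact ⟨_, _, (hc.sub_left a).sub_right b, h⟩
  · have h' : R' ∈ localRings (affineRing u v) := by
      rw [affineRing_sub u v a b]; exact h.mem
    rcases hloc R' h' hl with h1 | h1
    · rw [← hR.2 R' h1 hl]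
      exact ⟨_, _, (hc.sub_left a).sub_right b, h⟩
    · exact absurd h1 hnT

theorem IsCharted.hasValues {M : Set (LocalSubring K)} (hM : IsCharted M)
    (hR : IsClosedPoint M R) : HasValues R := by
  obtain ⟨u, v, -, h⟩ := hM.exists_isPt hR
  exact h.hasValues

theorem IsCharted.containsConst {M : Set (LocalSubring K)} (hM : IsCharted M)
    (hR : R ∈ M) : ContainsConst R := by
  obtain ⟨u, v, -, h, -⟩ := hM R hR
  exact containsConst_of_mem h

theorem coord_of_mem_pair {X Y : K} (hc : Coord X Y) (hu : u ∈ ({X, X⁻¹} : Set K))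
    (hv : v ∈ ({Y, Y⁻¹} : Set K)) : Coord u v := by
  rcases hu with rfl | hu <;> rcases hv with rfl | hv
  · exact hc
  · rw [Set.mem_singleton_iff.mp hv]; exact hc.inv_right
  · rw [Set.mem_singleton_iff.mp hu]; exact hc.inv_left
  · rw [Set.mem_singleton_iff.mp hu, Set.mem_singleton_iff.mp hv]; exact hc.inv_left.inv_right

theorem isCharted_P1P1 : IsCharted P1P1 := by
  rintro R ⟨u, hu, v, hv, hR⟩
  exact ⟨u, v, coord_of_mem_pair coord_xy hu hv, hR, ∅, Set.finite_empty,
    fun R' hR' _ => Or.inl ⟨u, hu, v, hv, hR'⟩⟩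

/-- Away from the exceptional curves the old chart survives with the centres added to the omitted
points. On an exceptional curve a standard chart omits nothing, since specializations of its points
stay on the curve. -/
theorem IsCharted.blowUp {M Z : Set (LocalSubring K)} (hM : IsCharted M) (hZ : Z.Finite)
    (hpt : ∀ P ∈ Z, ∃ u v, Coord u v ∧ IsPt u v P) : IsCharted (blowUp M Z) := by
  rintro R (⟨hR, hRZ⟩ | hR)
  · obtain ⟨u, v, hc, hmem, T, hT, hloc⟩ := hM R hR
    refine ⟨u, v, hc, hmem, T ∪ Z, hT.union hZ, fun R' hR' hl => ?_⟩
    rcases hloc R' hR' hl with h | h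
    · by_cases hz : R' ∈ Z
      · exact Or.inr (Or.inr hz)
      · exact Or.inl (Or.inl ⟨h, hz⟩)
    · exact Or.inr (Or.inl h)
  · simp only [Set.mem_iUnion] at hR
    obtain ⟨P, hP, hR⟩ := hR
    obtain ⟨u, v, hc, h⟩ := hpt P hP
    have key : ∀ R' ∈ exceptionalFibre P, R' ∈ BlowUpSurface.blowUp M Z := fun R' hR' => by
      refine Or.inr ?_
      simp only [Set.mem_iUnion]
      exact ⟨P, hP, hR'⟩
    rcases (h.exceptionalFibre_iff hc).mp hR with ⟨h1, h2⟩ | ⟨h1, h2⟩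
    · exact ⟨_, _, hc.div_right, h1, ∅, Set.finite_empty, fun R' hR' hl => Or.inl (key R'
        ((h.exceptionalFibre_iff hc).mpr (Or.inl ⟨hR',
          mem_maxIdeal_of_liesOn hl (left_mem_of_mem hR') h2⟩)))⟩
    · exact ⟨_, _, hc.symm.div_right, h1, ∅, Set.finite_empty, fun R' hR' hl => Or.inl (key R'
        ((h.exceptionalFibre_iff hc).mpr (Or.inr ⟨hR',
          mem_maxIdeal_of_liesOn hl (left_mem_of_mem hR') h2⟩)))⟩

theorem mem_blowUp_iff {M Z : Set (LocalSubring K)} :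
    R ∈ blowUp M Z ↔ (R ∈ M ∧ R ∉ Z) ∨ ∃ P ∈ Z, R ∈ exceptionalFibre P := by
  simp [blowUp]

end closed

/-! ### Rational 2-forms -/

/-- The 2-form `du ∧ dv`. -/
def wedge (u v : K) : RatForm :=
  exteriorPower.ιMulti K 2 ![KaehlerDifferential.D ℂ K u, KaehlerDifferential.D ℂ K v]

theorem smul_add_smul_add {F M : Type*} [CommRing F] [AddCommGroup M] [Module F M] (p q : M)
    (a b c d : F) : (a • p + b • q) + (c • p + d • q) = (a + c) • p + (b + d) • q := by
  module

theorem smul_smul_add_smul {F M : Type*} [CommRing F] [AddCommGroup M] [Module F M] (p q : M)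
    (a b c : F) : c • (a • p + b • q) = (c * a) • p + (c * b) • q := by
  module

theorem ιMulti_pair {F M : Type*} [CommRing F] [AddCommGroup M] [Module F M] (p q : M)
    (a b c d : F) : exteriorPower.ιMulti F 2 ![a • p + b • q, c • p + d • q] =
      (a * d - b * c) • exteriorPower.ιMulti F 2 ![p, q] := by
  apply Subtype.ext
  have hι : ∀ m n : M, ((exteriorPower.ιMulti F 2 ![m, n] : ⋀[F]^2 M) : ExteriorAlgebra F M) =
      ExteriorAlgebra.ι F m * ExteriorAlgebra.ι F n := fun m n => by
    rw [exteriorPower.ιMulti_apply_coe, ExteriorAlgebra.ιMulti_apply]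
    simp
  rw [hι, Submodule.coe_smul, hι]
  have hqp : ExteriorAlgebra.ι F q * ExteriorAlgebra.ι F p =
      -(ExteriorAlgebra.ι F p * ExteriorAlgebra.ι F q) :=
    eq_neg_of_add_eq_zero_left (ExteriorAlgebra.ι_add_mul_swap q p)
  simp only [map_add, map_smul, add_mul, mul_add, smul_mul_smul_comm, ExteriorAlgebra.ι_sq_zero,
    hqp, smul_zero, smul_neg]
  module

section wedge

variable {u v : K}

/-- Product rule for polynomials in u and v, then the quotient rule; the coefficients stay regular
because the denominators are units at `R`. -/
theorem exists_D_eq {R : LocalSubring K} (hR : R ∈ localRings (affineRing u v)) {f : K}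
    (hf : f ∈ R.toSubring) : ∃ a ∈ R.toSubring, ∃ b ∈ R.toSubring,
      KaehlerDifferential.D ℂ K f =
        a • KaehlerDifferential.D ℂ K u + b • KaehlerDifferential.D ℂ K v := by
  have key : ∀ s ∈ affineRing u v, ∃ a ∈ R.toSubring, ∃ b ∈ R.toSubring,
      KaehlerDifferential.D ℂ K s =
        a • KaehlerDifferential.D ℂ K u + b • KaehlerDifferential.D ℂ K v := by
    intro s hs
    induction hs using Algebra.adjoin_induction with
    | mem s hs =>
      rcases hs with rfl | hs
      · exact ⟨1, one_mem _, 0, zero_mem _, by simp⟩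
      · rw [Set.mem_singleton_iff.mp hs]
        exact ⟨0, zero_mem _, 1, one_mem _, by simp⟩
    | algebraMap r => exact ⟨0, zero_mem _, 0, zero_mem _, by simp⟩
    | add s t _ _ h1 h2 =>
      obtain ⟨a, ha, b, hb, e⟩ := h1
      obtain ⟨a', ha', b', hb', e'⟩ := h2
      exact ⟨a + a', add_mem ha ha', b + b', add_mem hb hb', by
        rw [map_add, e, e', smul_add_smul_add]⟩
    | mul s t hs ht h1 h2 =>
      obtain ⟨a, ha, b, hb, e⟩ := h1
      obtain ⟨a', ha', b', hb', e'⟩ := h2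
      have hs' := localRings_le hR hs
      have ht' := localRings_le hR ht
      exact ⟨s * a' + t * a, add_mem (mul_mem hs' ha') (mul_mem ht' ha), s * b' + t * b,
        add_mem (mul_mem hs' hb') (mul_mem ht' hb), by
          rw [Derivation.leibniz, e, e', smul_smul_add_smul, smul_smul_add_smul, smul_add_smul_add]⟩
  obtain ⟨s, hs, t, ht, h0, hi, rfl⟩ := (mem_localRings_iff.mp hR).2 hf
  obtain ⟨a, ha, b, hb, e⟩ := key s hs
  obtain ⟨a', ha', b', hb', e'⟩ := key t ht
  have hs' := localRings_le hR hs
  have hr : s * -t⁻¹ ^ 2 ∈ R.toSubring := mul_mem hs' (neg_mem (pow_mem hi 2))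
  refine ⟨s * -t⁻¹ ^ 2 * a' + t⁻¹ * a, add_mem (mul_mem hr ha') (mul_mem hi ha),
    s * -t⁻¹ ^ 2 * b' + t⁻¹ * b, add_mem (mul_mem hr hb') (mul_mem hi hb), ?_⟩
  rw [Derivation.leibniz, Derivation.leibniz_inv, smul_smul, e, e', smul_smul_add_smul,
    smul_smul_add_smul, smul_add_smul_add]

theorem Coord.exists_generic (h : Coord u v) : ∃ R ∈ localRings (affineRing u v),
    ∀ z : K, z ∈ R.toSubring := by
  have hb : (⊥ : Ideal (affineRing u v)).IsPrime := Ideal.isPrime_bot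
  refine ⟨LocalSubring.ofPrime (affineRing u v) ⊥, ⟨⊥, hb, rfl⟩, fun z => ?_⟩
  obtain ⟨s, hs, t, ht, rfl⟩ := h.exists_fraction z
  rcases eq_or_ne t 0 with rfl | h0
  · rw [div_zero]; exact zero_mem _
  · exact mem_ofPrime.mpr ⟨⟨s, hs⟩, ⟨t, ht⟩, fun hm => h0 (congrArg Subtype.val (Ideal.mem_bot.mp hm)),
      div_eq_mul_inv _ _⟩

/-- The generic point has local ring K, so there `exists_D_eq` says that du and dv span all
differentials; the 2-forms are then spanned by du ∧ dv. -/
theorem Coord.exists_eq_smul_wedge (h : Coord u v) (ω : RatForm) : ∃ f : K, ω = f • wedge u v := by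
  obtain ⟨R, hR, htop⟩ := h.exists_generic
  have hD : ∀ m : Ω[K⁄ℂ], ∃ a b : K, m =
      a • KaehlerDifferential.D ℂ K u + b • KaehlerDifferential.D ℂ K v := by
    intro m
    have hm : m ∈ Submodule.span K (Set.range (KaehlerDifferential.D ℂ K)) := by
      rw [KaehlerDifferential.span_range_derivation]; trivial
    induction hm using Submodule.span_induction with
    | mem m hm =>
      obtain ⟨f, rfl⟩ := hm
      obtain ⟨a, -, b, -, e⟩ := exists_D_eq hR (htop f)
      exact ⟨a, b, e⟩
    | zero => exact ⟨0, 0, by simp⟩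
    | add m n _ _ h1 h2 =>
      obtain ⟨a, b, rfl⟩ := h1
      obtain ⟨a', b', rfl⟩ := h2
      exact ⟨a + a', b + b', smul_add_smul_add _ _ _ _ _ _⟩
    | smul c m _ h1 =>
      obtain ⟨a, b, rfl⟩ := h1
      exact ⟨c * a, c * b, smul_smul_add_smul _ _ _ _ _⟩
  have hω : ω ∈ Submodule.span K (Set.range (exteriorPower.ιMulti K 2 (M := Ω[K⁄ℂ]))) := by
    rw [exteriorPower.ιMulti_span]; trivial
  induction hω using Submodule.span_induction with
  | mem ω hω =>
    obtain ⟨m, rfl⟩ := hω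
    obtain ⟨a, b, h0⟩ := hD (m 0)
    obtain ⟨c, d, h1⟩ := hD (m 1)
    refine ⟨a * d - b * c, ?_⟩
    rw [wedge, ← ιMulti_pair, ← h0, ← h1]
    congr 1
    ext i
    fin_cases i <;> rfl
  | zero => exact ⟨0, by simp⟩
  | add m n _ _ h1 h2 =>
    obtain ⟨f, rfl⟩ := h1
    obtain ⟨g, rfl⟩ := h2
    exact ⟨f + g, (add_smul f g _).symm⟩
  | smul c m _ h1 =>
    obtain ⟨f, rfl⟩ := h1
    exact ⟨c * f, smul_smul c f _⟩

theorem mem_regularForms {R : LocalSubring K} (hR : R ∈ localRings (affineRing u v)) {η : RatForm} :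
    η ∈ regularForms R ↔ ∃ f ∈ R.toSubring, η = f • wedge u v := by
  constructor
  · intro h
    induction h using Submodule.span_induction with
    | mem η h =>
      obtain ⟨f, hf, g, hg, rfl⟩ := h
      obtain ⟨a, ha, b, hb, e⟩ := exists_D_eq hR hf
      obtain ⟨c, hc, d, hd, e'⟩ := exists_D_eq hR hg
      refine ⟨a * d - b * c, sub_mem (mul_mem ha hd) (mul_mem hb hc), ?_⟩
      rw [wedge, ← ιMulti_pair, ← e, ← e']
    | zero => exact ⟨0, zero_mem _, by simp⟩
    | add m n _ _ h1 h2 =>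
      obtain ⟨f, hf, rfl⟩ := h1
      obtain ⟨g, hg, rfl⟩ := h2
      exact ⟨f + g, add_mem hf hg, (add_smul f g _).symm⟩
    | smul c m _ h1 =>
      obtain ⟨f, hf, rfl⟩ := h1
      refine ⟨c * f, mul_mem c.2 hf, ?_⟩
      rw [mul_smul]; rfl
  · rintro ⟨f, hf, rfl⟩
    exact Submodule.smul_mem (regularForms R) (⟨f, hf⟩ : R.toSubring) (Submodule.subset_span
      ⟨u, left_mem_of_mem hR, v, right_mem_of_mem hR, rfl⟩)

/-- The regular forms are the regular multiples of du ∧ dv, so the supremum defining `ordForm` is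
attained by f itself. That du ∧ dv is nonzero follows from the form being nonzero. -/
theorem ordForm_smul_wedge {R : LocalSubring K} (hR : R ∈ localRings (affineRing u v))
    (hD : IsDVR R) {f : K} (hω : f • wedge u v ≠ 0) : ordForm R (f • wedge u v) = ord R f := by
  have hf : f ≠ 0 := fun h => hω (by rw [h, zero_smul])
  have hw : wedge u v ≠ 0 := fun h => hω (by rw [h, smul_zero])
  have hmax : IsGreatest {m | ∃ g : K, g ≠ 0 ∧ ord R g = m ∧
      ∃ η ∈ regularForms R, f • wedge u v = g • η} (ord R f) := by
    refine ⟨⟨f, hf, rfl, wedge u v, (mem_regularForms hR).mpr ⟨1, one_mem _, by simp⟩, rfl⟩, ?_⟩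
    rintro m ⟨g, hg, rfl, η, hη, e⟩
    obtain ⟨r, hr, rfl⟩ := (mem_regularForms hR).mp hη
    rw [smul_smul] at e
    have e' : f = g * r := smul_left_injective K hw e
    have hr0 : r ≠ 0 := by rintro rfl; exact hf (by rw [e', mul_zero])
    rw [e', ord_mul R hg hr0]
    have := (mem_iff_ord_nonneg hD hr0).mp hr
    omega
  exact hmax.csSup_eq

/-- Source of the double pole of dX ∧ dY at infinity. -/
theorem wedge_inv_left (hu : u ≠ 0) (v : K) : wedge u v = (-u ^ 2) • wedge u⁻¹ v := by
  have e : KaehlerDifferential.D ℂ K u =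
      (-u ^ 2) • KaehlerDifferential.D ℂ K u⁻¹ + (0 : K) • KaehlerDifferential.D ℂ K v := by
    rw [Derivation.leibniz_inv, smul_smul, zero_smul, add_zero]
    rw [show -u ^ 2 * -u⁻¹ ^ 2 = 1 by field_simp, one_smul]
  have h := ιMulti_pair (KaehlerDifferential.D ℂ K u⁻¹) (KaehlerDifferential.D ℂ K v) (-u ^ 2) 0 0 1
  rw [← e] at h
  simpa [wedge] using h

theorem wedge_inv_right (u : K) (hv : v ≠ 0) : wedge u v = (-v ^ 2) • wedge u v⁻¹ := by
  have e : KaehlerDifferential.D ℂ K v =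
      (0 : K) • KaehlerDifferential.D ℂ K u + (-v ^ 2) • KaehlerDifferential.D ℂ K v⁻¹ := by
    rw [Derivation.leibniz_inv, smul_smul, zero_smul, zero_add]
    rw [show -v ^ 2 * -v⁻¹ ^ 2 = 1 by field_simp, one_smul]
  have h := ιMulti_pair (KaehlerDifferential.D ℂ K u) (KaehlerDifferential.D ℂ K v⁻¹) 1 0 0 (-v ^ 2)
  rw [← e] at h
  simpa [wedge] using h

theorem wedge_sub_const (u v : K) (a b : ℂ) : wedge (u - const a) (v - const b) = wedge u v := by
  simp [wedge]

/-- Source of the simple zero that each blow-up adds to the canonical divisor. -/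
theorem wedge_div (hu : u ≠ 0) (v : K) : wedge u v = u • wedge u (v / u) := by
  have e : KaehlerDifferential.D ℂ K v =
      (v / u) • KaehlerDifferential.D ℂ K u + u • KaehlerDifferential.D ℂ K (v / u) := by
    conv_lhs => rw [← mul_div_cancel₀ v hu]
    rw [Derivation.leibniz, add_comm]
  have h := ιMulti_pair (KaehlerDifferential.D ℂ K u) (KaehlerDifferential.D ℂ K (v / u)) 1 0 (v / u) u
  rw [← e] at h
  simpa [wedge] using h

end wedge

/-! ### Polynomials of bounded bidegree -/

/-- The polynomials in `z` of degree at most `d`. -/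
def polyLE (z : K) (d : ℕ) : Submodule ℂ K :=
  (Polynomial.degreeLE ℂ d).map (Polynomial.aeval z : Polynomial ℂ →ₐ[ℂ] K).toLinearMap

/-- The polynomials in `X`, `Y` of bidegree at most `(d, e)`. -/
def bideg (X Y : K) (d e : ℕ) : Submodule ℂ K := polyLE X d * polyLE Y e

section bideg

variable {X Y : K} {d e : ℕ} {f : K}

theorem mem_polyLE {z : K} {w : K} :
    w ∈ polyLE z d ↔ ∃ p : Polynomial ℂ, p.natDegree ≤ d ∧ w = Polynomial.aeval z p := by
  rw [polyLE, Submodule.mem_map]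
  simp only [Polynomial.mem_degreeLE, Polynomial.natDegree_le_iff_degree_le]
  exact ⟨fun ⟨p, h, e⟩ => ⟨p, h, e.symm⟩, fun ⟨p, h, e⟩ => ⟨p, h, e.symm⟩⟩

theorem aeval_mem_polyLE {z : K} {p : Polynomial ℂ} (h : p.natDegree ≤ d) :
    Polynomial.aeval z p ∈ polyLE z d := mem_polyLE.mpr ⟨p, h, rfl⟩

theorem polyLE_mono {z : K} {d d' : ℕ} (h : d ≤ d') : polyLE z d ≤ polyLE z d' := by
  intro w hw
  obtain ⟨p, hp, rfl⟩ := mem_polyLE.mp hw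
  exact aeval_mem_polyLE (hp.trans h)

theorem polyLE_zero_eq (z : K) {w : K} (hw : w ∈ polyLE z 0) : ∃ a : ℂ, w = const a := by
  obtain ⟨p, hp, rfl⟩ := mem_polyLE.mp hw
  refine ⟨p.coeff 0, ?_⟩
  rw [Polynomial.eq_C_of_natDegree_le_zero hp, Polynomial.aeval_C]
  simp

theorem bideg_comm (X Y : K) (d e : ℕ) : bideg X Y d e = bideg Y X e d := mul_comm _ _

theorem bideg_mono {d' e' : ℕ} (hd : d ≤ d') (he : e ≤ e') : bideg X Y d e ≤ bideg X Y d' e' :=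
  mul_le_mul' (polyLE_mono hd) (polyLE_mono he)

theorem bideg_le_affineRing (hf : f ∈ bideg X Y d e) : f ∈ affineRing X Y := by
  induction hf using Submodule.mul_induction_on' with
  | mem_mul_mem m hm n hn =>
    obtain ⟨p, -, rfl⟩ := mem_polyLE.mp hm
    obtain ⟨q, -, rfl⟩ := mem_polyLE.mp hn
    refine mul_mem ?_ (aeval_mem_affineRing X Y q)
    rw [affineRing_comm]; exact aeval_mem_affineRing Y X p
  | add f _ g _ h1 h2 => exact add_mem h1 h2

theorem exists_mem_bideg (hf : f ∈ affineRing X Y) : ∃ N, f ∈ bideg X Y N N := by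
  have hone : ∀ z, (1 : K) ∈ polyLE z 0 := fun z => mem_polyLE.mpr ⟨1, by simp, by simp⟩
  have hmul : ∀ (z : K) (d e : ℕ), polyLE z d * polyLE z e ≤ polyLE z (d + e) := by
    intro z d e
    rw [Submodule.mul_le]
    intro m hm n hn
    obtain ⟨p, hp, rfl⟩ := mem_polyLE.mp hm
    obtain ⟨q, hq, rfl⟩ := mem_polyLE.mp hn
    rw [← map_mul]
    exact aeval_mem_polyLE (Polynomial.natDegree_mul_le_of_le hp hq)
  induction hf using Algebra.adjoin_induction with
  | mem f hf =>
    rcases hf with rfl | hf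
    · refine ⟨1, ?_⟩
      rw [← mul_one f]
      exact Submodule.mul_mem_mul (mem_polyLE.mpr ⟨Polynomial.X, by simp, by simp⟩)
        (polyLE_mono zero_le_one (hone _))
    · rw [Set.mem_singleton_iff.mp hf]
      refine ⟨1, ?_⟩
      rw [← one_mul Y]
      exact Submodule.mul_mem_mul (polyLE_mono zero_le_one (hone _))
        (mem_polyLE.mpr ⟨Polynomial.X, by simp, by simp⟩)
  | algebraMap r =>
    refine ⟨0, ?_⟩
    rw [← mul_one (algebraMap ℂ K r)]
    exact Submodule.mul_mem_mul (mem_polyLE.mpr ⟨Polynomial.C r, by simp, by simp⟩) (hone _)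
  | add f g _ _ h1 h2 =>
    obtain ⟨N, h1⟩ := h1
    obtain ⟨M, h2⟩ := h2
    exact ⟨max N M, add_mem (bideg_mono (le_max_left _ _) (le_max_left _ _) h1)
      (bideg_mono (le_max_right _ _) (le_max_right _ _) h2)⟩
  | mul f g _ _ h1 h2 =>
    obtain ⟨N, h1⟩ := h1
    obtain ⟨M, h2⟩ := h2
    refine ⟨N + M, ?_⟩
    have h3 := Submodule.mul_mem_mul h1 h2
    rw [bideg, bideg, mul_mul_mul_comm] at h3
    exact mul_le_mul' (hmul X N M) (hmul Y N M) h3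

/-- Here p is the restriction of f to the line X = a; showing p = 0 is how divisibility by X - a is
proved later. -/
theorem bideg_split (a : ℂ) (hf : f ∈ bideg X Y (d + 1) e) :
    ∃ p : Polynomial ℂ, p.natDegree ≤ e ∧ ∃ g ∈ bideg X Y d e,
      f = Polynomial.aeval Y p + (X - const a) * g := by
  induction hf using Submodule.mul_induction_on' with
  | mem_mul_mem m hm n hn =>
    obtain ⟨p, hp, rfl⟩ := mem_polyLE.mp hm
    obtain ⟨q, hq, rfl⟩ := mem_polyLE.mp hn
    obtain ⟨r, hr⟩ := Polynomial.X_sub_C_dvd_sub_C_eval (a := a) (p := p)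
    have hrd : r.natDegree ≤ d := by
      rcases eq_or_ne r 0 with rfl | hr0
      · simp
      have h1 : (p - Polynomial.C (p.eval a)).natDegree ≤ d + 1 := by
        rw [Polynomial.natDegree_sub_C]; exact hp
      rw [hr, Polynomial.natDegree_mul (Polynomial.X_sub_C_ne_zero a) hr0,
        Polynomial.natDegree_X_sub_C] at h1
      omega
    refine ⟨Polynomial.C (p.eval a) * q, (Polynomial.natDegree_C_mul_le _ _).trans hq,
      Polynomial.aeval X r * Polynomial.aeval Y q,
      Submodule.mul_mem_mul (aeval_mem_polyLE hrd) (aeval_mem_polyLE hq), ?_⟩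
    have := congrArg (Polynomial.aeval X) hr
    simp only [map_sub, map_mul, Polynomial.aeval_X, Polynomial.aeval_C] at this ⊢
    linear_combination Polynomial.aeval Y q * this
  | add f _ g _ h1 h2 =>
    obtain ⟨p, hp, f', hf', e1⟩ := h1
    obtain ⟨q, hq, g', hg', e2⟩ := h2
    exact ⟨p + q, Polynomial.natDegree_add_le_of_degree_le hp hq, f' + g', add_mem hf' hg', by
      rw [e1, e2, map_add]; ring⟩

theorem bideg_top (hf : f ∈ bideg X Y (d + 1) e) :
    ∃ p : Polynomial ℂ, ∃ g ∈ bideg X Y d e, f = Polynomial.aeval Y p * X ^ (d + 1) + g := by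
  induction hf using Submodule.mul_induction_on' with
  | mem_mul_mem m hm n hn =>
    obtain ⟨p, hp, rfl⟩ := mem_polyLE.mp hm
    obtain ⟨q, hq, rfl⟩ := mem_polyLE.mp hn
    have hp' : (p - Polynomial.monomial (d + 1) (p.coeff (d + 1))).natDegree ≤ d := by
      rw [Polynomial.natDegree_le_iff_coeff_eq_zero]
      intro N hN
      rw [Polynomial.coeff_sub, Polynomial.coeff_monomial]
      split_ifs with h
      · rw [h, sub_self]
      · rw [sub_zero]
        exact Polynomial.coeff_eq_zero_of_natDegree_lt (by omega)
    refine ⟨Polynomial.C (p.coeff (d + 1)) * q, _,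
      Submodule.mul_mem_mul (aeval_mem_polyLE hp') (aeval_mem_polyLE hq), ?_⟩
    simp only [map_sub, map_mul, Polynomial.aeval_C, Polynomial.aeval_monomial]
    ring
  | add f _ g _ h1 h2 =>
    obtain ⟨p, f', hf', e1⟩ := h1
    obtain ⟨q, g', hg', e2⟩ := h2
    exact ⟨p + q, f' + g', add_mem hf' hg', by rw [e1, e2, map_add]; ring⟩

theorem bideg_zero (hf : f ∈ bideg X Y 0 e) :
    ∃ p : Polynomial ℂ, p.natDegree ≤ e ∧ f = Polynomial.aeval Y p := by
  rw [← mem_polyLE]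
  induction hf using Submodule.mul_induction_on' with
  | mem_mul_mem m hm n hn =>
    obtain ⟨a, rfl⟩ := polyLE_zero_eq X hm
    rw [← Algebra.smul_def]
    exact Submodule.smul_mem _ a hn
  | add f _ g _ h1 h2 => exact add_mem h1 h2

/-- On the curve `X = ∞`, a polynomial of degree `d` in `X` has a pole of order `d`. -/
theorem div_pow_mem {C : LocalSubring K} (hC : IsDv X⁻¹ Y C) (hX : X ≠ 0)
    (hf : f ∈ bideg X Y d e) : f / X ^ d ∈ C.toSubring := by
  induction hf using Submodule.mul_induction_on' with
  | mem_mul_mem m hm n hn =>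
    obtain ⟨p, hp, rfl⟩ := mem_polyLE.mp hm
    obtain ⟨q, hq, rfl⟩ := mem_polyLE.mp hn
    rw [mul_div_right_comm]
    refine mul_mem ?_ (aeval_mem_of_mem hC.containsConst (right_mem_of_mem hC.mem) q)
    rw [Polynomial.aeval_eq_sum_range' (n := d + 1) (by omega), Finset.sum_div]
    refine sum_mem fun i hi => ?_
    have : p.coeff i • X ^ i / X ^ d = const (p.coeff i) * X⁻¹ ^ (d - i) := by
      rw [Algebra.smul_def, mul_div_assoc]
      congr 1
      rw [inv_pow, div_eq_iff (pow_ne_zero _ hX), eq_inv_mul_iff_mul_eq₀ (pow_ne_zero _ hX),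
        ← pow_add]
      congr 1
      have := Finset.mem_range.mp hi
      omega
    rw [this]
    exact mul_mem (hC.containsConst _) (pow_mem (left_mem_of_mem hC.mem) _)
  | add f _ g _ h1 h2 => rw [add_div]; exact add_mem h1 h2

/-- If the top coefficient in X is p(Y), then p(Y) is X⁻¹ times a function regular along X = ∞, so
it vanishes there; as Y satisfies no relation on that curve, p = 0. -/
theorem bideg_reduce {C : LocalSubring K} (hC : IsDv X⁻¹ Y C) (hc : Coord X Y) (hf0 : f ≠ 0)
    (hf : f ∈ bideg X Y (d + 1) e) (hord : -(d : ℤ) ≤ ord C f) : f ∈ bideg X Y d e := by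
  obtain ⟨p, g, hg, rfl⟩ := bideg_top hf
  have hX := hc.left_ne_zero
  have hXord : ord C X = -1 := by
    have := hC.ord_left hc.inv_left
    rw [ord_inv C hX] at this
    omega
  have hp : p = 0 := by
    refine hC.right p ?_
    have h1 : (Polynomial.aeval Y p * X ^ (d + 1) + g) / X ^ d ∈ C.toSubring := by
      rw [mem_iff_ord_nonneg (hC.isDVR hc.inv_left) (div_ne_zero hf0 (pow_ne_zero _ hX)),
        ord_div C hf0 (pow_ne_zero _ hX), ord_pow C hX, hXord]
      omega
    have h2 := mul_mem_maxIdeal' hC.left (sub_mem h1 (div_pow_mem hC hX hg))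
    rwa [show X⁻¹ * ((Polynomial.aeval Y p * X ^ (d + 1) + g) / X ^ d - g / X ^ d) =
      Polynomial.aeval Y p by field_simp; ring] at h2
  subst hp
  rw [map_zero, zero_mul, zero_add]
  exact hg

theorem bideg_reduce_iter {C : LocalSubring K} (hC : IsDv X⁻¹ Y C) (hc : Coord X Y) (hf0 : f ≠ 0)
    {N : ℕ} (hf : f ∈ bideg X Y (d + N) e) (hord : -(d : ℤ) ≤ ord C f) : f ∈ bideg X Y d e := by
  induction N with
  | zero => exact hf
  | succ N ih =>
    refine ih (bideg_reduce hC hc hf0 (by rwa [add_assoc]) ?_)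
    push_cast
    omega

/-- A polynomial with poles of order at most `d` and `e` along the two curves at infinity has
bidegree at most `(d, e)`. -/
theorem mem_bideg_of_ord {C C' : LocalSubring K} (hc : Coord X Y) (hC : IsDv X⁻¹ Y C)
    (hC' : IsDv Y⁻¹ X C') (hf0 : f ≠ 0) (hf : f ∈ affineRing X Y) (hd : -(d : ℤ) ≤ ord C f)
    (he : -(e : ℤ) ≤ ord C' f) : f ∈ bideg X Y d e := by
  obtain ⟨N, hN⟩ := exists_mem_bideg hf
  have h1 : f ∈ bideg X Y d N := bideg_reduce_iter (N := N) hC hc hf0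
    (bideg_mono (by omega) le_rfl hN) hd
  rw [bideg_comm] at h1 ⊢
  exact bideg_reduce_iter (N := N) hC' hc.symm hf0 (bideg_mono (by omega) le_rfl h1) he

end bideg

/-! ### Divisibility of polynomials by the equations of fibres -/

section divisibility

theorem IsDv.exists_eq_pow_mul {u w f : K} {C : LocalSubring K} (hC : IsDv u w C) (hc : Coord u w)
    (hf : f ≠ 0) {N : ℕ} (h : (N : ℤ) ≤ ord C f) : ∃ r ∈ C.toSubring, f = u ^ N * r := by
  have hu := pow_ne_zero N hc.left_ne_zero
  refine ⟨f / u ^ N, ?_, by rw [mul_div_cancel₀ _ hu]⟩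
  rw [mem_iff_ord_nonneg (hC.isDVR hc) (div_ne_zero hf hu), ord_div C hf hu,
    ord_pow C hc.left_ne_zero, hC.ord_left hc]
  omega

theorem IsDv.linear_eq_zero {u w : K} {C : LocalSubring K} (hC : IsDv u w C) {a b : ℂ}
    (h : const a + const b * w ∈ maxIdeal C) : a = 0 ∧ b = 0 := by
  have h1 := hC.right (Polynomial.C a + Polynomial.C b * Polynomial.X) (by simpa using h)
  have h2 := congrArg (fun p => p.coeff 0) h1
  have h3 := congrArg (fun p => p.coeff 1) h1
  simp [Polynomial.coeff_C] at h2 h3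
  exact ⟨h2, h3⟩

variable {X Y : K} {d e : ℕ} {f : K}

/-- The restriction to `X = a` of a polynomial with a double point at `(a, b)` has a double
zero at `b`. -/
theorem sq_dvd_of_ord_two {a b : ℂ} {C : LocalSubring K} (hc : Coord X Y)
    (hC : IsDv (X - const a) ((Y - const b) / (X - const a)) C) (hf0 : f ≠ 0)
    (hord : 2 ≤ ord C f) {p : Polynomial ℂ} {g : K} (hg : g ∈ affineRing X Y)
    (hf : f = Polynomial.aeval Y p + (X - const a) * g) : (Polynomial.X - Polynomial.C b) ^ 2 ∣ p := by
  have hc' : Coord (X - const a) (Y - const b) := (hc.sub_left a).sub_right b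
  obtain ⟨r, hr, e1⟩ := hC.exists_eq_pow_mul hc'.div_right hf0 (N := 2) (by exact_mod_cast hord)
  set u := X - const a with hu
  set w := (Y - const b) / u with hw
  have hu0 : u ≠ 0 := hc'.left_ne_zero
  have hv : Y - const b = u * w := by rw [hw, mul_div_cancel₀ _ hu0]
  obtain ⟨p₁, h1⟩ := Polynomial.X_sub_C_dvd_sub_C_eval (a := b) (p := p)
  obtain ⟨p₂, h2⟩ := Polynomial.X_sub_C_dvd_sub_C_eval (a := b) (p := p₁)
  have h1' := congrArg (Polynomial.aeval Y) h1
  have h2' := congrArg (Polynomial.aeval Y) h2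
  simp only [map_sub, map_mul, Polynomial.aeval_X, Polynomial.aeval_C] at h1' h2'
  rw [affineRing_sub X Y a b] at hg
  obtain ⟨γ, w₁, hw₁, w₂, hw₂, e2⟩ := exists_eq_const_add hg
  have hwC : w ∈ C.toSubring := right_mem_of_mem hC.mem
  have hYC : Y ∈ C.toSubring := by
    refine mem_of_sub_const_mem hC.containsConst (a := b) ?_
    rw [hv]; exact mul_mem hC.left.1 hwC
  have hA : affineRing u (Y - const b) ≤ C.toSubring :=
    affineRing_le hC.containsConst hC.left.1 (sub_mem hYC (hC.containsConst b))
  have hp₂ : Polynomial.aeval Y p₂ ∈ C.toSubring := aeval_mem_of_mem hC.containsConst hYC p₂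
  set t := w ^ 2 * Polynomial.aeval Y p₂ + (w₁ + w * w₂) with ht
  have htC : t ∈ C.toSubring := add_mem (mul_mem (pow_mem hwC 2) hp₂)
    (add_mem (hA hw₁) (mul_mem hwC (hA hw₂)))
  -- Expansion of f in powers of u along the exceptional curve, where Y - b = u w. Since f = u² r,
  -- the coefficients of 1 and of u vanish on the curve; w is free there, so the latter, linear in
  -- w, has zero coefficients.
  have key : const (p.eval b) + u * (const γ + const (p₁.eval b) * w) = u ^ 2 * (r - t) := by
    rw [hv] at h1' h2' e2
    have e1' := e1
    rw [hf, e2] at e1'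
    simp only [const, ht] at *
    linear_combination e1' - h1' - u * w * h2'
  have hp0 : p.eval b = 0 := by
    refine eq_zero_of_const_mem hC.containsConst ?_
    rw [show const (p.eval b) = u * (u * (r - t) - (const γ + const (p₁.eval b) * w)) by
      linear_combination key]
    exact mul_mem_maxIdeal' hC.left (sub_mem (mul_mem hC.left.1 (sub_mem hr htC))
      (add_mem (hC.containsConst _) (mul_mem (hC.containsConst _) hwC)))
  have hp1 : p₁.eval b = 0 := by
    refine (hC.linear_eq_zero (a := γ) (b := p₁.eval b) ?_).2
    have : const γ + const (p₁.eval b) * w = u * (r - t) := by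
      apply mul_left_cancel₀ hu0
      rw [hp0, const, map_zero, zero_add] at key
      linear_combination key
    rw [this]
    exact mul_mem_maxIdeal' hC.left (sub_mem hr htC)
  refine ⟨p₂, ?_⟩
  rw [hp0, map_zero, sub_zero] at h1
  rw [hp1, map_zero, sub_zero] at h2
  rw [h1, h2]; ring

/-- The restriction to X = a has degree at most e and a double zero at every bᵢ, hence more zeros
than its degree allows. -/
theorem exists_eq_mul_of_double_points {ι : Type*} [Fintype ι] {a : ℂ} {b : ι → ℂ}
    (hb : Function.Injective b) (hcard : e < 2 * Fintype.card ι) (hc : Coord X Y) (hf0 : f ≠ 0)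
    (hf : f ∈ bideg X Y (d + 1) e) {C : ι → LocalSubring K}
    (hC : ∀ i, IsDv (X - const a) ((Y - const (b i)) / (X - const a)) (C i))
    (hord : ∀ i, 2 ≤ ord (C i) f) : ∃ g ∈ bideg X Y d e, f = (X - const a) * g := by
  obtain ⟨p, hp, g, hg, e1⟩ := bideg_split a hf
  have hdvd : ∏ i, (Polynomial.X - Polynomial.C (b i)) ^ 2 ∣ p := by
    refine Finset.prod_dvd_of_coprime (fun i _ j _ hij => ?_) fun i _ =>
      sq_dvd_of_ord_two hc (hC i) hf0 (hord i) (bideg_le_affineRing hg) e1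
    exact (Polynomial.pairwise_coprime_X_sub_C hb hij).pow
  have hp0 : p = 0 := by
    refine Polynomial.eq_zero_of_dvd_of_natDegree_lt hdvd ?_
    rw [Polynomial.natDegree_prod_of_monic _ _ fun i _ => (Polynomial.monic_X_sub_C _).pow 2]
    simp only [Polynomial.natDegree_pow, Polynomial.natDegree_X_sub_C, mul_one, Finset.sum_const,
      Finset.card_univ, smul_eq_mul]
    omega
  refine ⟨g, hg, ?_⟩
  rw [e1, hp0, map_zero, zero_add]

/-- Vanishing at (a, bᵢ) may be tested at any local ring lying over that point, in particular along
an exceptional curve; then the zeros of the restriction to X = a are counted. -/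
theorem exists_eq_mul_of_simple_points {ι : Type*} [Fintype ι] {a : ℂ} {b : ι → ℂ}
    (hb : Function.Injective b) (hcard : e < Fintype.card ι)
    (hf : f ∈ bideg X Y (d + 1) e) {C : ι → LocalSubring K} (hC : ∀ i, ContainsConst (C i))
    (hX : ∀ i, X - const a ∈ maxIdeal (C i)) (hY : ∀ i, Y - const (b i) ∈ maxIdeal (C i))
    (hm : ∀ i, f ∈ maxIdeal (C i)) : ∃ g ∈ bideg X Y d e, f = (X - const a) * g := by
  obtain ⟨p, hp, g, hg, e1⟩ := bideg_split a hf
  have hroot : ∀ i, p.eval (b i) = 0 := by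
    intro i
    have hgC : g ∈ (C i).toSubring :=
      affineRing_le (hC i) (mem_of_sub_const_mem (hC i) (hX i).1)
        (mem_of_sub_const_mem (hC i) (hY i).1) (bideg_le_affineRing hg)
    have h1 := sub_mem_maxIdeal (hm i) (mul_mem_maxIdeal' (hX i) hgC)
    rw [e1, add_sub_cancel_right] at h1
    exact value_unique (hC i) (value_aeval (hC i) (hY i) p) (by rwa [const, map_zero, sub_zero])
  have hp0 : p = 0 := by
    by_contra hp0
    have h1 := Polynomial.card_le_degree_of_subset_roots (p := p) (Z := Finset.univ.image b) (by
      intro z hz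
      rw [Finset.mem_val, Finset.mem_image] at hz
      obtain ⟨i, -, rfl⟩ := hz
      exact (Polynomial.mem_roots hp0).mpr (hroot i))
    rw [Finset.card_image_of_injective _ hb, Finset.card_univ] at h1
    omega
  refine ⟨g, hg, ?_⟩
  rw [e1, hp0, map_zero, zero_add]

/-- A polynomial of degree at most `2` in `X` that vanishes to order `3` along the exceptional
curve over the point infinitely near to `(a, b)` on `Y = b` is divisible by `Y - b`. -/
theorem exists_eq_mul_of_tangent {a b : ℂ} {C : LocalSubring K} (hc : Coord X Y)
    (hC : IsDv (X - const a) ((Y - const b) / (X - const a) / (X - const a)) C) (hf0 : f ≠ 0)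
    (hord : 3 ≤ ord C f) (hf : f ∈ bideg X Y 2 (e + 1)) :
    ∃ g ∈ bideg X Y 2 e, f = (Y - const b) * g := by
  have hc' : Coord (X - const a) (Y - const b) := (hc.sub_left a).sub_right b
  obtain ⟨r, hr, e1⟩ := hC.exists_eq_pow_mul hc'.div_right.div_right hf0 (N := 3)
    (by exact_mod_cast hord)
  rw [bideg_comm] at hf
  obtain ⟨p, hp, g, hg, e0⟩ := bideg_split b hf
  have hg' := bideg_le_affineRing hg
  rw [bideg_comm] at hg
  rw [affineRing_comm, affineRing_sub X Y a b] at hg'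
  set u := X - const a with hu
  set w := (Y - const b) / u / u with hw
  have hu0 : u ≠ 0 := hc'.left_ne_zero
  have hv : Y - const b = u ^ 2 * w := by rw [hw]; field_simp
  obtain ⟨p₁, h1⟩ := Polynomial.X_sub_C_dvd_sub_C_eval (a := a) (p := p)
  obtain ⟨p₂, h2⟩ := Polynomial.X_sub_C_dvd_sub_C_eval (a := a) (p := p₁)
  obtain ⟨p₃, h3⟩ := Polynomial.X_sub_C_dvd_sub_C_eval (a := a) (p := p₂)
  have h1' := congrArg (Polynomial.aeval X) h1
  have h2' := congrArg (Polynomial.aeval X) h2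
  have h3' := congrArg (Polynomial.aeval X) h3
  simp only [map_sub, map_mul, Polynomial.aeval_X, Polynomial.aeval_C] at h1' h2' h3'
  obtain ⟨γ, w₁, hw₁, w₂, hw₂, e2⟩ := exists_eq_const_add hg'
  have hwC : w ∈ C.toSubring := right_mem_of_mem hC.mem
  have hXC : X ∈ C.toSubring := mem_of_sub_const_mem hC.containsConst hC.left.1
  have hA : affineRing u (Y - const b) ≤ C.toSubring := by
    refine affineRing_le hC.containsConst hC.left.1 ?_
    rw [hv]; exact mul_mem (pow_mem hC.left.1 2) hwC
  have hp₃ : Polynomial.aeval X p₃ ∈ C.toSubring := aeval_mem_of_mem hC.containsConst hXC p₃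
  set t := Polynomial.aeval X p₃ + (w * w₁ + u * w ^ 2 * w₂) with ht
  have htC : t ∈ C.toSubring := add_mem hp₃ (add_mem (mul_mem hwC (hA hw₁))
    (mul_mem (mul_mem hC.left.1 (pow_mem hwC 2)) (hA hw₂)))
  -- On this curve Y - b = u² w, so the term (Y - b) g first contributes in degree 2, through γ w.
  -- Order 3 therefore kills the Taylor coefficients of p in degrees 0 and 1, and in degree 2 the
  -- independence of 1 and w separates p₂(a) from γ.
  have key : const (p.eval a) + u * const (p₁.eval a) +
      u ^ 2 * (const (p₂.eval a) + const γ * w) = u ^ 3 * (r - t) := by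
    have e1' := e1
    rw [e0, e2, hv] at e1'
    simp only [const, ht] at *
    linear_combination e1' - h1' - u * h2' - u ^ 2 * h3'
  have hlin : const (p₂.eval a) + const γ * w ∈ C.toSubring :=
    add_mem (hC.containsConst _) (mul_mem (hC.containsConst _) hwC)
  have hu2 : u ^ 2 * (r - t) ∈ C.toSubring := mul_mem (pow_mem hC.left.1 2) (sub_mem hr htC)
  have hp0 : p.eval a = 0 := by
    refine eq_zero_of_const_mem hC.containsConst ?_
    rw [show const (p.eval a) = u * (u ^ 2 * (r - t) - const (p₁.eval a) -
      u * (const (p₂.eval a) + const γ * w)) by linear_combination key]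
    exact mul_mem_maxIdeal' hC.left (sub_mem (sub_mem hu2 (hC.containsConst _))
      (mul_mem hC.left.1 hlin))
  rw [hp0, const, map_zero, zero_add] at key
  have hp1 : p₁.eval a = 0 := by
    refine eq_zero_of_const_mem hC.containsConst ?_
    rw [show const (p₁.eval a) = u * (u * (r - t) - (const (p₂.eval a) + const γ * w)) by
      apply mul_left_cancel₀ hu0
      linear_combination key]
    exact mul_mem_maxIdeal' hC.left (sub_mem (mul_mem hC.left.1 (sub_mem hr htC)) hlin)
  rw [hp1, const, map_zero, mul_zero, zero_add] at key
  have hp2 : p₂.eval a = 0 := by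
    refine (hC.linear_eq_zero (a := p₂.eval a) (b := γ) ?_).1
    rw [show const (p₂.eval a) + const γ * w = u * (r - t) by
      apply mul_left_cancel₀ (pow_ne_zero 2 hu0)
      linear_combination key]
    exact mul_mem_maxIdeal' hC.left (sub_mem hr htC)
  have hpz : p = 0 := by
    rw [hp0, map_zero, sub_zero] at h1
    rw [hp1, map_zero, sub_zero] at h2
    rw [hp2, map_zero, sub_zero] at h3
    -- A triple zero is impossible for a nonzero polynomial of degree at most 2.
    have hdvd : (Polynomial.X - Polynomial.C a) ^ 3 ∣ p := ⟨p₃, by rw [h1, h2, h3]; ring⟩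
    refine Polynomial.eq_zero_of_dvd_of_natDegree_lt hdvd ?_
    rw [Polynomial.natDegree_pow, Polynomial.natDegree_X_sub_C]
    omega
  refine ⟨g, hg, ?_⟩
  rw [e0, hpz, map_zero, zero_add]

end divisibility

/-! ### Frames of `CP¹ × CP¹` -/

/-- `X` and `Y` are affine coordinates of the two factors of `CP¹ × CP¹`. -/
structure IsFrame (X Y : K) : Prop where
  coord : Coord X Y
  mem_iff : ∀ R, R ∈ P1P1 ↔ ∃ u ∈ ({X, X⁻¹} : Set K), ∃ v ∈ ({Y, Y⁻¹} : Set K),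
    R ∈ localRings (affineRing u v)

section chart

variable {X Y : K} {R : LocalSubring K}

theorem mem_localRings_of_inv_left (h : R ∈ localRings (affineRing X⁻¹ Y)) (hX : X ≠ 0)
    (hm : X⁻¹ ∉ maxIdeal R) : R ∈ localRings (affineRing X Y) := by
  have hXR := inv_mem_of_notMem_maxIdeal (left_mem_of_mem h) hm
  rw [inv_inv] at hXR
  exact mem_localRings_affineRing_of h hXR (right_mem_of_mem h)
    (inv_mem_fractionsIn (left_mem_affineRing _ _) hX (left_mem_of_mem h))
    (le_fractionsIn _ _ (right_mem_affineRing _ _))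

theorem mem_localRings_of_inv_right (h : R ∈ localRings (affineRing X Y⁻¹)) (hY : Y ≠ 0)
    (hm : Y⁻¹ ∉ maxIdeal R) : R ∈ localRings (affineRing X Y) := by
  rw [affineRing_comm] at h ⊢
  exact mem_localRings_of_inv_left h hY hm

/-- An inverse coordinate is kept only where it vanishes; elsewhere it can be inverted and the
finite chart used. -/
theorem IsFrame.cases (h : IsFrame X Y) (hR : R ∈ P1P1) :
    R ∈ localRings (affineRing X Y) ∨
      (R ∈ localRings (affineRing X⁻¹ Y) ∧ X⁻¹ ∈ maxIdeal R) ∨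
      (R ∈ localRings (affineRing X Y⁻¹) ∧ Y⁻¹ ∈ maxIdeal R) ∨
      (R ∈ localRings (affineRing X⁻¹ Y⁻¹) ∧ X⁻¹ ∈ maxIdeal R ∧ Y⁻¹ ∈ maxIdeal R) := by
  have hX := h.coord.left_ne_zero
  have hY := h.coord.right_ne_zero
  obtain ⟨u, hu, v, hv, hR⟩ := (h.mem_iff R).mp hR
  rcases hu with rfl | hu <;> rcases hv with rfl | hv
  · exact Or.inl hR
  · rw [Set.mem_singleton_iff.mp hv] at hR
    by_cases hm : Y⁻¹ ∈ maxIdeal R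
    · exact Or.inr (Or.inr (Or.inl ⟨hR, hm⟩))
    · exact Or.inl (mem_localRings_of_inv_right hR hY hm)
  · rw [Set.mem_singleton_iff.mp hu] at hR
    by_cases hm : X⁻¹ ∈ maxIdeal R
    · exact Or.inr (Or.inl ⟨hR, hm⟩)
    · exact Or.inl (mem_localRings_of_inv_left hR hX hm)
  · rw [Set.mem_singleton_iff.mp hu, Set.mem_singleton_iff.mp hv] at hR
    by_cases hm : X⁻¹ ∈ maxIdeal R <;> by_cases hm' : Y⁻¹ ∈ maxIdeal R
    · exact Or.inr (Or.inr (Or.inr ⟨hR, hm, hm'⟩))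
    · exact Or.inr (Or.inl ⟨mem_localRings_of_inv_right hR hY hm', hm⟩)
    · exact Or.inr (Or.inr (Or.inl ⟨mem_localRings_of_inv_left hR hX hm, hm'⟩))
    · exact Or.inl (mem_localRings_of_inv_left (mem_localRings_of_inv_right hR hY hm') hX hm)

/-- The corner X = Y = ∞ drops out, because both inverse coordinates cannot vanish along a curve. -/
theorem IsFrame.curve_cases (h : IsFrame X Y) (hR : R ∈ P1P1) (hD : IsDVR R) :
    R ∈ localRings (affineRing X Y) ∨ IsDv X⁻¹ Y R ∨ IsDv Y⁻¹ X R := by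
  rcases h.cases hR with h1 | ⟨h1, h2⟩ | ⟨h1, h2⟩ | ⟨h1, h2, h3⟩
  · exact Or.inl h1
  · exact Or.inr (Or.inl (isDv_of_isDVR h.coord.inv_left h1 h2 hD))
  · rw [affineRing_comm] at h1
    exact Or.inr (Or.inr (isDv_of_isDVR h.coord.symm.inv_left h1 h2 hD))
  · exact absurd h3 (isDv_of_isDVR h.coord.inv_left.inv_right h1 h2 hD).right_notMem'

theorem IsFrame.mem_of_affine (h : IsFrame X Y) (hR : R ∈ localRings (affineRing X Y)) : R ∈ P1P1 :=
  (h.mem_iff R).mpr ⟨X, by simp, Y, by simp, hR⟩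

theorem IsFrame.mem_of_isDv_inv_left (h : IsFrame X Y) (hR : IsDv X⁻¹ Y R) : R ∈ P1P1 :=
  (h.mem_iff R).mpr ⟨X⁻¹, by simp, Y, by simp, hR.mem⟩

theorem IsFrame.mem_of_isDv_inv_right (h : IsFrame X Y) (hR : IsDv Y⁻¹ X R) : R ∈ P1P1 :=
  (h.mem_iff R).mpr ⟨X, by simp, Y⁻¹, by simp, by rw [affineRing_comm]; exact hR.mem⟩

/-! ### Orders of the coordinates along the curves -/

theorem ord_sub_const_eq_zero (hD : IsDVR R) (hc : ContainsConst R) {z : K} {a b : ℂ}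
    (hz : z - const a ∈ maxIdeal R) (hab : b ≠ a) (h0 : z - const b ≠ 0) :
    ord R (z - const b) = 0 :=
  ord_eq_zero hD h0 (sub_mem (mem_of_sub_const_mem hc hz.1) (hc b))
    fun hm => hab (value_unique hc hm hz)

/-- At a pole of z the second factor of z - a = z (1 - a/z) is a unit. -/
theorem ord_sub_const_of_inv_mem (hD : IsDVR R) (hc : ContainsConst R) {z : K}
    (hz0 : z ≠ 0) (hz : z⁻¹ ∈ maxIdeal R) (a : ℂ) (h0 : z - const a ≠ 0) :
    ord R (z - const a) = ord R z := by
  have e : z - const a = z * (1 - const a * z⁻¹) := by field_simp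
  have h1 : (1 - const a * z⁻¹) ≠ 0 := fun h => h0 (by rw [e, h, mul_zero])
  rw [e, ord_mul R hz0 h1, ord_eq_zero hD h1 (sub_mem (one_mem _) (mul_mem (hc a) hz.1)), add_zero]
  intro hm
  have := add_mem_maxIdeal hm (mul_mem_maxIdeal (hc a) hz)
  rw [sub_add_cancel] at this
  exact one_notMem_maxIdeal this

theorem ord_fibre (hc : Coord X Y) {a : ℂ} (hR : IsDv (X - const a) Y R) :
    ord R (X - const a) = 1 ∧ (∀ a', a' ≠ a → ord R (X - const a') = 0) ∧
      ∀ b, ord R (Y - const b) = 0 :=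
  ⟨hR.ord_left (hc.sub_left a), fun a' ha' => ord_sub_const_eq_zero (hR.isDVR (hc.sub_left a))
    hR.containsConst hR.left ha' (hc.left_sub_ne_zero a'),
    fun b => hR.ord_sub_right (hc.sub_left a) b⟩

theorem ord_infinity (hc : Coord X Y) (hR : IsDv X⁻¹ Y R) :
    (∀ a, ord R (X - const a) = -1) ∧ ∀ b, ord R (Y - const b) = 0 := by
  have hX := hc.left_ne_zero
  have h1 := hR.ord_left hc.inv_left
  rw [ord_inv R hX] at h1
  refine ⟨fun a => ?_, fun b => hR.ord_sub_right hc.inv_left b⟩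
  rw [ord_sub_const_of_inv_mem (hR.isDVR hc.inv_left) hR.containsConst hX hR.left a
    (hc.left_sub_ne_zero a)]
  omega

theorem coord_exceptional (hc : Coord X Y) (a b : ℂ) :
    Coord (X - const a) ((Y - const b) / (X - const a)) := ((hc.sub_left a).sub_right b).div_right

theorem coord_exceptional_near (hc : Coord X Y) (a b : ℂ) :
    Coord (X - const a) ((Y - const b) / (X - const a) / (X - const a)) :=
  (coord_exceptional hc a b).div_right

theorem value_exceptional (hc : Coord X Y) {a b : ℂ}
    (hR : IsDv (X - const a) ((Y - const b) / (X - const a)) R) : Y - const b ∈ maxIdeal R := by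
  rw [← mul_div_cancel₀ (Y - const b) (hc.left_sub_ne_zero a)]
  exact mul_mem_maxIdeal' hR.left (right_mem_of_mem hR.mem)

theorem value_exceptional_near (hc : Coord X Y) {a b : ℂ}
    (hR : IsDv (X - const a) ((Y - const b) / (X - const a) / (X - const a)) R) :
    Y - const b ∈ maxIdeal R := by
  have hu := hc.left_sub_ne_zero a
  rw [show Y - const b = (X - const a) *
    ((X - const a) * ((Y - const b) / (X - const a) / (X - const a))) by field_simp]
  exact mul_mem_maxIdeal' hR.left (mul_mem hR.left.1 (right_mem_of_mem hR.mem))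

theorem ord_exceptional (hc : Coord X Y) {a b : ℂ}
    (hR : IsDv (X - const a) ((Y - const b) / (X - const a)) R) :
    ord R (X - const a) = 1 ∧ (∀ a', a' ≠ a → ord R (X - const a') = 0) ∧
      ord R (Y - const b) = 1 ∧ ∀ b', b' ≠ b → ord R (Y - const b') = 0 := by
  have hc' := coord_exceptional hc a b
  have hD := hR.isDVR hc'
  have h1 := hR.ord_left hc'
  have h2 := hR.ord_right hc'
  rw [ord_div R (hc.right_sub_ne_zero b) (hc.left_sub_ne_zero a)] at h2
  exact ⟨h1, fun a' ha' => ord_sub_const_eq_zero hD hR.containsConst hR.left ha'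
    (hc.left_sub_ne_zero a'), by omega, fun b' hb' => ord_sub_const_eq_zero hD hR.containsConst
      (value_exceptional hc hR) hb' (hc.right_sub_ne_zero b')⟩

/-- The ratio (Y - b)/(X - a)² is a coordinate along this curve and has order 0, so Y - b has twice
the order of X - a. -/
theorem ord_exceptional_near (hc : Coord X Y) {a b : ℂ}
    (hR : IsDv (X - const a) ((Y - const b) / (X - const a) / (X - const a)) R) :
    ord R (X - const a) = 1 ∧ (∀ a', a' ≠ a → ord R (X - const a') = 0) ∧
      ord R (Y - const b) = 2 ∧ ∀ b', b' ≠ b → ord R (Y - const b') = 0 := by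
  have hc' := coord_exceptional_near hc a b
  have hD := hR.isDVR hc'
  have h1 := hR.ord_left hc'
  have h2 := hR.ord_right hc'
  have hu := hc.left_sub_ne_zero a
  have hv := hc.right_sub_ne_zero b
  rw [ord_div R (div_ne_zero hv hu) hu, ord_div R hv hu] at h2
  exact ⟨h1, fun a' ha' => ord_sub_const_eq_zero hD hR.containsConst hR.left ha'
    (hc.left_sub_ne_zero a'), by omega, fun β hβ => ord_sub_const_eq_zero hD hR.containsConst
      (value_exceptional_near hc hR) hβ (hc.right_sub_ne_zero β)⟩

/-! ### Orders of 2-forms along the curves -/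

theorem ordForm_affine (hR : R ∈ localRings (affineRing X Y)) (hD : IsDVR R) {h : K}
    (hω : h • wedge X Y ≠ 0) : ordForm R (h • wedge X Y) = ord R h :=
  ordForm_smul_wedge hR hD hω

theorem ordForm_eq_of_wedge_eq {u v h j : K} (hR : R ∈ localRings (affineRing u v)) (hD : IsDVR R)
    (hω : h • wedge X Y ≠ 0) (e : wedge X Y = j • wedge u v) :
    ordForm R (h • wedge X Y) = ord R h + ord R j := by
  rw [e, smul_smul] at hω ⊢
  have h0 : h * j ≠ 0 := fun h0 => hω (by rw [h0, zero_smul])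
  rw [ordForm_smul_wedge hR hD hω, ord_mul R (left_ne_zero_of_mul h0) (right_ne_zero_of_mul h0)]

theorem ord_neg_sq {f : K} (hf : f ≠ 0) : ord R (-f ^ 2) = 2 * ord R f := by
  have := ord_const_mul R (-1) (by norm_num) (f ^ 2)
  rw [neg_one_smul] at this
  rw [this, ord_pow R hf]
  norm_num

theorem ordForm_infinity_left (hc : Coord X Y) (hR : IsDv X⁻¹ Y R) {h : K}
    (hω : h • wedge X Y ≠ 0) : ordForm R (h • wedge X Y) = ord R h - 2 := by
  have h1 := hR.ord_left hc.inv_left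
  rw [ord_inv R hc.left_ne_zero] at h1
  rw [ordForm_eq_of_wedge_eq hR.mem (hR.isDVR hc.inv_left) hω
    (wedge_inv_left hc.left_ne_zero Y), ord_neg_sq hc.left_ne_zero]
  omega

theorem ordForm_infinity_right (hc : Coord X Y) (hR : IsDv Y⁻¹ X R) {h : K}
    (hω : h • wedge X Y ≠ 0) : ordForm R (h • wedge X Y) = ord R h - 2 := by
  have h1 := hR.ord_left hc.symm.inv_left
  rw [ord_inv R hc.right_ne_zero] at h1
  rw [ordForm_eq_of_wedge_eq (by rw [affineRing_comm]; exact hR.mem) (hR.isDVR hc.symm.inv_left) hω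
    (wedge_inv_right X hc.right_ne_zero), ord_neg_sq hc.right_ne_zero]
  omega

theorem ordForm_exceptional (hc : Coord X Y) {a b : ℂ}
    (hR : IsDv (X - const a) ((Y - const b) / (X - const a)) R) {h : K}
    (hω : h • wedge X Y ≠ 0) : ordForm R (h • wedge X Y) = ord R h + 1 := by
  have hc' := coord_exceptional hc a b
  rw [ordForm_eq_of_wedge_eq hR.mem (hR.isDVR hc') hω
    ((wedge_sub_const X Y a b).symm.trans (wedge_div (hc.left_sub_ne_zero a) _)), hR.ord_left hc']

/-- Each of the two successive blow-ups contributes one factor X - a, whence the discrepancy 2. -/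
theorem ordForm_exceptional_near (hc : Coord X Y) {a b : ℂ}
    (hR : IsDv (X - const a) ((Y - const b) / (X - const a) / (X - const a)) R) {h : K}
    (hω : h • wedge X Y ≠ 0) : ordForm R (h • wedge X Y) = ord R h + 2 := by
  have hc' := coord_exceptional_near hc a b
  have hu := hc.left_sub_ne_zero a
  have e : wedge X Y = ((X - const a) * (X - const a)) •
      wedge (X - const a) ((Y - const b) / (X - const a) / (X - const a)) := by
    rw [mul_smul, ← wedge_div hu, ← wedge_div hu, wedge_sub_const]
  rw [ordForm_eq_of_wedge_eq hR.mem (hR.isDVR hc') hω e, ord_mul R hu hu, hR.ord_left hc']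
  norm_num

end chart

/-! ### The surface -/

/-- `S` is the blow-up of `CP¹ × CP¹` at the points `(c, bᵢ)`, `(c', b'ᵢ)`, and at the points
infinitely near to `(c, bₖ)`, `(c', b'ₖ)` on the curves `Y = bₖ`, `Y = b'ₖ`. -/
structure Config (X Y : K) (c c' : ℂ) {ι : Type} [Fintype ι] (b b' : ι → ℂ) (k : ι)
    (S : Set (LocalSubring K)) : Prop where
  frame : IsFrame X Y
  ne : c ≠ c'
  inj : Function.Injective b
  inj' : Function.Injective b'
  -- This is n - 1 ≥ 3. It makes three double zeros too many for degree 4, and three simple zeros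
  -- too many for degree 2.
  card : 3 ≤ Fintype.card ι
  gen : ∀ i, b k ≠ b' i
  gen' : ∀ i, b' k ≠ b i
  exists_points : ∃ (p p' : ι → LocalSubring K) (q q' : LocalSubring K),
    (∀ i, IsPt (X - const c) (Y - const (b i)) (p i)) ∧
    (∀ i, IsPt (X - const c') (Y - const (b' i)) (p' i)) ∧
    IsPt (X - const c) ((Y - const (b k)) / (X - const c)) q ∧
    IsPt (X - const c') ((Y - const (b' k)) / (X - const c')) q' ∧
    S = blowUp (blowUp P1P1 (Set.range p ∪ Set.range p')) {q, q'}

namespace Config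

variable {X Y : K} {c c' : ℂ} {ι : Type} [Fintype ι] {b b' : ι → ℂ} {k : ι}
  {S : Set (LocalSubring K)} {C : LocalSubring K}

theorem coord (h : Config X Y c c' b b' k S) : Coord X Y := h.frame.coord

theorem symm (h : Config X Y c c' b b' k S) : Config X Y c' c b' b k S where
  frame := h.frame
  ne := h.ne.symm
  inj := h.inj'
  inj' := h.inj
  card := h.card
  gen := h.gen'
  gen' := h.gen
  exists_points := by
    obtain ⟨p, p', q, q', h1, h2, h3, h4, h5⟩ := h.exists_points
    exact ⟨p', p, q', q, h2, h1, h4, h3, by rw [h5, Set.union_comm, Set.pair_comm]⟩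

theorem isCharted (h : Config X Y c c' b b' k S) : IsCharted S := by
  obtain ⟨p, p', q, q', h1, h2, h3, h4, rfl⟩ := h.exists_points
  have hc := h.coord
  refine (isCharted_P1P1.blowUp ((Set.finite_range p).union (Set.finite_range p')) ?_).blowUp
    (Set.toFinite _) ?_
  · rintro P (⟨i, rfl⟩ | ⟨i, rfl⟩)
    · exact ⟨_, _, (hc.sub_left c).sub_right (b i), h1 i⟩
    · exact ⟨_, _, (hc.sub_left c').sub_right (b' i), h2 i⟩
  · rintro P (rfl | hP)
    · exact ⟨_, _, coord_exceptional hc c (b k), h3⟩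
    · rw [Set.mem_singleton_iff.mp hP]
      exact ⟨_, _, coord_exceptional hc c' (b' k), h4⟩

/-- A curve on S is a curve of CP¹ × CP¹ or lies over a centre, and over each centre there is
exactly one curve. -/
theorem curve_cases (h : Config X Y c c' b b' k S) (hC : IsCurve S C) :
    C ∈ localRings (affineRing X Y) ∨ IsDv X⁻¹ Y C ∨ IsDv Y⁻¹ X C ∨
      (∃ i, IsDv (X - const c) ((Y - const (b i)) / (X - const c)) C) ∨
      (∃ i, IsDv (X - const c') ((Y - const (b' i)) / (X - const c')) C) ∨
      IsDv (X - const c) ((Y - const (b k)) / (X - const c) / (X - const c)) C ∨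
      IsDv (X - const c') ((Y - const (b' k)) / (X - const c') / (X - const c')) C := by
  obtain ⟨p, p', q, q', h1, h2, h3, h4, rfl⟩ := h.exists_points
  have hc := h.coord
  obtain ⟨hmem, hD⟩ := hC
  rcases mem_blowUp_iff.mp hmem with ⟨hmem, -⟩ | ⟨P, hP, hfib⟩
  · rcases mem_blowUp_iff.mp hmem with ⟨hmem, -⟩ | ⟨P, ⟨i, rfl⟩ | ⟨i, rfl⟩, hmem⟩
    · rcases h.frame.curve_cases hmem hD with h5 | h5 | h5
      · exact Or.inl h5
      · exact Or.inr (Or.inl h5)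
      · exact Or.inr (Or.inr (Or.inl h5))
    · exact Or.inr (Or.inr (Or.inr (Or.inl ⟨i, (h1 i).isDv_of_exceptionalFibre
        ((hc.sub_left c).sub_right (b i)) hmem hD⟩)))
    · exact Or.inr (Or.inr (Or.inr (Or.inr (Or.inl ⟨i, (h2 i).isDv_of_exceptionalFibre
        ((hc.sub_left c').sub_right (b' i)) hmem hD⟩))))
  · rcases hP with rfl | hP
    · exact Or.inr (Or.inr (Or.inr (Or.inr (Or.inr (Or.inl (h3.isDv_of_exceptionalFibre
        (coord_exceptional hc c (b k)) hfib hD))))))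
    · rw [Set.mem_singleton_iff.mp hP] at hfib
      exact Or.inr (Or.inr (Or.inr (Or.inr (Or.inr (Or.inr (h4.isDv_of_exceptionalFibre
        (coord_exceptional hc c' (b' k)) hfib hD))))))

/-- Curves survive both blow-ups as the same local rings, since the centres are not discrete
valuation rings. -/
theorem isCurve_of_P1P1 (h : Config X Y c c' b b' k S) (hC : C ∈ P1P1) (hD : IsDVR C) :
    IsCurve S C := by
  obtain ⟨p, p', q, q', h1, h2, h3, h4, rfl⟩ := h.exists_points
  have hc := h.coord
  refine ⟨mem_blowUp_iff.mpr (Or.inl ⟨mem_blowUp_iff.mpr (Or.inl ⟨hC, ?_⟩), ?_⟩), hD⟩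
  · rintro (⟨i, rfl⟩ | ⟨i, rfl⟩)
    · exact (h1 i).not_isDVR ((hc.sub_left c).sub_right (b i)) hD
    · exact (h2 i).not_isDVR ((hc.sub_left c').sub_right (b' i)) hD
  · rintro (rfl | hP)
    · exact h3.not_isDVR (coord_exceptional hc c (b k)) hD
    · rw [Set.mem_singleton_iff.mp hP] at hD
      exact h4.not_isDVR (coord_exceptional hc c' (b' k)) hD

theorem isCurve_exceptional (h : Config X Y c c' b b' k S) {i : ι}
    (hC : IsDv (X - const c) ((Y - const (b i)) / (X - const c)) C) : IsCurve S C := by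
  obtain ⟨p, p', q, q', h1, h2, h3, h4, rfl⟩ := h.exists_points
  have hc := h.coord
  have hD := hC.isDVR (coord_exceptional hc c (b i))
  refine ⟨mem_blowUp_iff.mpr (Or.inl ⟨mem_blowUp_iff.mpr (Or.inr ⟨p i, Or.inl ⟨i, rfl⟩,
    (h1 i).mem_exceptionalFibre (hc.left_sub_ne_zero c) hC.mem hC.left⟩), ?_⟩), hD⟩
  rintro (rfl | hP)
  · exact h3.not_isDVR (coord_exceptional hc c (b k)) hD
  · rw [Set.mem_singleton_iff.mp hP] at hD
    exact h4.not_isDVR (coord_exceptional hc c' (b' k)) hD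

theorem isCurve_exceptional_near (h : Config X Y c c' b b' k S)
    (hC : IsDv (X - const c) ((Y - const (b k)) / (X - const c) / (X - const c)) C) :
    IsCurve S C := by
  obtain ⟨p, p', q, q', h1, h2, h3, h4, rfl⟩ := h.exists_points
  have hc := h.coord
  exact ⟨mem_blowUp_iff.mpr (Or.inr ⟨q, Or.inl rfl,
    h3.mem_exceptionalFibre (hc.left_sub_ne_zero c) hC.mem hC.left⟩),
    hC.isDVR (coord_exceptional_near hc c (b k))⟩

theorem isCurve_affine (h : Config X Y c c' b b' k S) (hC : C ∈ localRings (affineRing X Y))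
    (hD : IsDVR C) : IsCurve S C := h.isCurve_of_P1P1 (h.frame.mem_of_affine hC) hD

theorem isCurve_fibre_left (h : Config X Y c c' b b' k S) {a : ℂ} (hC : IsDv (X - const a) Y C) :
    IsCurve S C :=
  h.isCurve_affine (by rw [affineRing_sub_left X Y a]; exact hC.mem) (hC.isDVR (h.coord.sub_left a))

theorem isCurve_fibre_right (h : Config X Y c c' b b' k S) {a : ℂ} (hC : IsDv (Y - const a) X C) :
    IsCurve S C :=
  h.isCurve_affine (by rw [affineRing_sub_right X Y a, affineRing_comm]; exact hC.mem)
    (hC.isDVR (h.coord.symm.sub_left a))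

theorem isCurve_infinity_left (h : Config X Y c c' b b' k S) (hC : IsDv X⁻¹ Y C) : IsCurve S C :=
  h.isCurve_of_P1P1 (h.frame.mem_of_isDv_inv_left hC) (hC.isDVR h.coord.inv_left)

theorem isCurve_infinity_right (h : Config X Y c c' b b' k S) (hC : IsDv Y⁻¹ X C) : IsCurve S C :=
  h.isCurve_of_P1P1 (h.frame.mem_of_isDv_inv_right hC) (hC.isDVR h.coord.symm.inv_left)

/-- The equation `(X - c)² (X - c')² (Y - bₖ) (Y - b'ₖ)`. -/
def fixedEq (X Y : K) (c c' β β' : ℂ) : K :=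
  (X - const c) ^ 2 * (X - const c') ^ 2 * ((Y - const β) * (Y - const β'))

theorem fixedEq_ne_zero (hc : Coord X Y) (c c' β β' : ℂ) : fixedEq X Y c c' β β' ≠ 0 :=
  mul_ne_zero (mul_ne_zero (pow_ne_zero 2 (hc.left_sub_ne_zero c))
    (pow_ne_zero 2 (hc.left_sub_ne_zero c')))
    (mul_ne_zero (hc.right_sub_ne_zero β) (hc.right_sub_ne_zero β'))

theorem ord_fixedEq (hc : Coord X Y) (c c' β β' : ℂ) (C : LocalSubring K) :
    ord C (fixedEq X Y c c' β β') = 2 * ord C (X - const c) + 2 * ord C (X - const c') +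
      (ord C (Y - const β) + ord C (Y - const β')) := by
  have h1 := hc.left_sub_ne_zero c
  have h2 := hc.left_sub_ne_zero c'
  have h3 := hc.right_sub_ne_zero β
  have h4 := hc.right_sub_ne_zero β'
  rw [fixedEq, ord_mul C (mul_ne_zero (pow_ne_zero 2 h1) (pow_ne_zero 2 h2)) (mul_ne_zero h3 h4),
    ord_mul C (pow_ne_zero 2 h1) (pow_ne_zero 2 h2), ord_mul C h3 h4, ord_pow C h1, ord_pow C h2]
  norm_num

/-- The sections of the bi-anticanonical bundle are the multiples of the fixed part. -/
theorem exists_eq_fixedEq_mul (h : Config X Y c c' b b' k S) {g : K} (hg : g ≠ 0)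
    (haff : ∀ C ∈ localRings (affineRing X Y), IsDVR C → 0 ≤ ord C g)
    (hleft : ∀ C, IsDv X⁻¹ Y C → -4 ≤ ord C g) (hright : ∀ C, IsDv Y⁻¹ X C → -4 ≤ ord C g)
    (hE : ∀ i C, IsDv (X - const c) ((Y - const (b i)) / (X - const c)) C → 2 ≤ ord C g)
    (hE' : ∀ i C, IsDv (X - const c') ((Y - const (b' i)) / (X - const c')) C → 2 ≤ ord C g)
    (hN : ∀ C, IsDv (X - const c) ((Y - const (b k)) / (X - const c) / (X - const c)) C →
      4 ≤ ord C g)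
    (hN' : ∀ C, IsDv (X - const c') ((Y - const (b' k)) / (X - const c') / (X - const c')) C →
      4 ≤ ord C g) :
    ∃ r : Polynomial ℂ, r.natDegree ≤ 2 ∧
      g = fixedEq X Y c c' (b k) (b' k) * Polynomial.aeval Y r := by
  classical
  have hc := h.coord
  have hcard := h.card
  have hu := hc.left_sub_ne_zero c
  have hu' := hc.left_sub_ne_zero c'
  have hv := hc.right_sub_ne_zero (b k)
  have hv' := hc.right_sub_ne_zero (b' k)
  obtain ⟨CX, hCX⟩ := hc.inv_left.exists_isDv
  obtain ⟨CY, hCY⟩ := hc.symm.inv_left.exists_isDv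
  choose E hEdv using fun i => (coord_exceptional hc c (b i)).exists_isDv
  choose E' hEdv' using fun i => (coord_exceptional hc c' (b' i)).exists_isDv
  obtain ⟨N, hNdv⟩ := (coord_exceptional_near hc c (b k)).exists_isDv
  obtain ⟨N', hNdv'⟩ := (coord_exceptional_near hc c' (b' k)).exists_isDv
  have oE := fun i => ord_exceptional hc (hEdv i)
  have oE' := fun i => ord_exceptional hc (hEdv' i)
  have oN := ord_exceptional_near hc hNdv
  have oN' := ord_exceptional_near hc hNdv'
  have hgE := fun i => hE i _ (hEdv i)
  have hgE' := fun i => hE' i _ (hEdv' i)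
  have hgN := hN _ hNdv
  have hgN' := hN' _ hNdv'
  have hg44 : g ∈ bideg X Y 4 4 := mem_bideg_of_ord hc hCX hCY hg
    (hc.mem_affineRing_of_ord_nonneg hg haff) (by exact_mod_cast hleft _ hCX)
    (by exact_mod_cast hright _ hCY)
  -- first division by the two fibres of the first projection
  obtain ⟨g₁, hg₁, rfl⟩ := exists_eq_mul_of_double_points (d := 3) h.inj (by omega) hc hg hg44
    hEdv hgE
  have hg₁0 := right_ne_zero_of_mul hg
  -- X - c has order 1 along the Eᵢ and N and order 0 along the E'ᵢ and N'. The order along N drops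
  -- from 4 to 3, just what `exists_eq_mul_of_tangent` needs.
  simp only [ord_mul _ hu hg₁0, oE, (oE' _).2.1 c h.ne, oN, oN'.2.1 c h.ne] at hgE hgE' hgN hgN'
  obtain ⟨g₂, hg₂, rfl⟩ := exists_eq_mul_of_double_points (d := 2) h.inj' (by omega) hc hg₁0 hg₁
    hEdv' (fun i => by have := hgE' i; omega)
  have hg₂0 := right_ne_zero_of_mul hg₁0
  simp only [ord_mul _ hu' hg₂0, oE', (oE _).2.1 c' h.ne.symm, oN', oN.2.1 c' h.ne.symm]
    at hgE hgE' hgN hgN'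
  -- division by the two fibres of the second projection
  obtain ⟨g₃, hg₃, rfl⟩ := exists_eq_mul_of_tangent (e := 3) hc hNdv hg₂0 (by omega) hg₂
  have hg₃0 := right_ne_zero_of_mul hg₂0
  simp only [ord_mul _ hv hg₃0, oN, oN'.2.2.2 (b k) (h.gen k)] at hgE hgE' hgN hgN'
  obtain ⟨g₄, hg₄, rfl⟩ := exists_eq_mul_of_tangent (e := 2) hc hNdv' hg₃0 (by omega) hg₃
  have hg₄0 := right_ne_zero_of_mul hg₃0
  simp only [ord_mul _ hv' hg₄0, oN', oN.2.2.2 (b' k) (h.gen k).symm] at hgE hgE' hgN hgN'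
  -- second division by the two fibres of the first projection
  have key : ∀ (i : ι), ∃ D, ContainsConst D ∧ X - const c ∈ maxIdeal D ∧
      Y - const (b i) ∈ maxIdeal D ∧ g₄ ∈ maxIdeal D := by
    intro i
    -- For i = k the curve E k yields nothing, as 2 - 1 - 1 = 0, whereas along N there remains 4 - 1
    -- - 2 = 1. For i ≠ k the factors Y - bₖ and Y - b'ₖ are units along Eᵢ, by injectivity and by
    -- the assumption on C₄, so 2 - 1 = 1 remains.
    by_cases hik : i = k
    · subst hik
      refine ⟨N, hNdv.containsConst, hNdv.left, value_exceptional_near hc hNdv, ?_⟩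
      rw [mem_maxIdeal_iff_ord_pos (hNdv.isDVR (coord_exceptional_near hc c _)) hg₄0]
      omega
    · refine ⟨E i, (hEdv i).containsConst, (hEdv i).left, value_exceptional hc (hEdv i), ?_⟩
      rw [mem_maxIdeal_iff_ord_pos ((hEdv i).isDVR (coord_exceptional hc c _)) hg₄0]
      have h1 := hgE i
      rw [(oE i).2.2.2 (b k) (fun e => hik (h.inj e).symm), (oE i).2.2.2 (b' k) (h.gen' i)] at h1
      omega
  choose D hDc hDX hDY hDm using key
  obtain ⟨g₅, hg₅, rfl⟩ := exists_eq_mul_of_simple_points (d := 1) h.inj (by omega) hg₄ hDc hDX hDY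
    hDm
  have hg₅0 := right_ne_zero_of_mul hg₄0
  simp only [ord_mul _ hu hg₅0, (oE' _).2.1 c h.ne, oN'.2.1 c h.ne] at hgE' hgN'
  have key' : ∀ (i : ι), ∃ D, ContainsConst D ∧ X - const c' ∈ maxIdeal D ∧
      Y - const (b' i) ∈ maxIdeal D ∧ g₅ ∈ maxIdeal D := by
    intro i
    by_cases hik : i = k
    · subst hik
      refine ⟨N', hNdv'.containsConst, hNdv'.left, value_exceptional_near hc hNdv', ?_⟩
      rw [mem_maxIdeal_iff_ord_pos (hNdv'.isDVR (coord_exceptional_near hc c' _)) hg₅0]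
      omega
    · refine ⟨E' i, (hEdv' i).containsConst, (hEdv' i).left, value_exceptional hc (hEdv' i), ?_⟩
      rw [mem_maxIdeal_iff_ord_pos ((hEdv' i).isDVR (coord_exceptional hc c' _)) hg₅0]
      have h1 := hgE' i
      rw [(oE' i).2.2.2 (b' k) (fun e => hik (h.inj' e).symm), (oE' i).2.2.2 (b k) (h.gen i)] at h1
      omega
  choose D' hDc' hDX' hDY' hDm' using key'
  obtain ⟨g₆, hg₆, rfl⟩ := exists_eq_mul_of_simple_points (d := 0) h.inj' (by omega) hg₅ hDc' hDX'
    hDY' hDm'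
  obtain ⟨r, hr, rfl⟩ := bideg_zero hg₆
  exact ⟨r, hr, by rw [fixedEq]; ring⟩

end Config

open Classical in
theorem single_apply (D C : LocalSubring K) : single D C = if C = D then 1 else 0 := by
  unfold single
  rw [Pi.single_apply]

/-- `CP¹ × CP¹` is separated. -/
theorem IsFrame.eq_of_le {X Y : K} (h : IsFrame X Y) {R R' : LocalSubring K} (hR : R ∈ P1P1)
    (hR' : R' ∈ P1P1) (hle : R' ≤ R) : R' = R := by
  -- If R' only offers u⁻¹, then u⁻¹ must be a unit there: otherwise domination would make it a
  -- nonunit at R, where u is regular.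
  have key : ∀ z u : K, u ≠ 0 → u ∈ R.toSubring → (z = u ∨ z = u⁻¹) → z ∈ R'.toSubring →
      u ∈ R'.toSubring := by
    intro z u hu huR hz hzR
    rcases hz with rfl | rfl
    · exact hzR
    · by_cases hm : u⁻¹ ∈ maxIdeal R'
      · exact absurd (mem_maxIdeal_of_le hle hm)
          (notMem_maxIdeal_of_inv_mem (inv_ne_zero hu) (by rwa [inv_inv]))
      · have := inv_mem_of_notMem_maxIdeal hzR hm
        rwa [inv_inv] at this
  obtain ⟨u, hu, v, hv, hRuv⟩ := (h.mem_iff R).mp hR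
  obtain ⟨u', hu', v', hv', hRuv'⟩ := (h.mem_iff R').mp hR'
  have hc := coord_of_mem_pair h.coord hu hv
  have hpair : ∀ z u u' : K, u ∈ ({z, z⁻¹} : Set K) → u' ∈ ({z, z⁻¹} : Set K) →
      u' = u ∨ u' = u⁻¹ := by
    intro z u u' h1 h2
    rcases h1 with rfl | h1 <;> rcases h2 with rfl | h2
    · exact Or.inl rfl
    · exact Or.inr h2
    · rw [Set.mem_singleton_iff.mp h1, inv_inv]; exact Or.inr rfl
    · rw [Set.mem_singleton_iff.mp h1, Set.mem_singleton_iff.mp h2]; exact Or.inl rfl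
  refine eq_of_localRings_of_le hRuv (affineRing_le (containsConst_of_mem hRuv') ?_ ?_) hle
  · exact key u' u hc.left_ne_zero (left_mem_of_mem hRuv) (hpair _ _ _ hu hu')
      (left_mem_of_mem hRuv')
  · exact key v' v hc.right_ne_zero (right_mem_of_mem hRuv) (hpair _ _ _ hv hv')
      (right_mem_of_mem hRuv')

/-! ### Closed points of S and the divisor of the fixed equation -/

namespace Config

variable {X Y : K} {c c' : ℂ} {ι : Type} [Fintype ι] {b b' : ι → ℂ} {k : ι}
  {S : Set (LocalSubring K)} {C R : LocalSubring K}

theorem right_mem_of_isPt {a β : ℂ} {P : LocalSubring K}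
    (h : IsPt (X - const a) (Y - const β) P) (hle : P ≤ R) : Y ∈ R.toSubring :=
  mem_of_le hle (mem_of_sub_const_mem h.containsConst h.right.1)

theorem right_value_near (hc : Coord X Y) {a β : ℂ} {P : LocalSubring K}
    (h : IsPt (X - const a) ((Y - const β) / (X - const a)) P) : Y - const β ∈ maxIdeal P := by
  rw [← mul_div_cancel₀ (Y - const β) (hc.left_sub_ne_zero a)]
  exact mul_mem_maxIdeal' h.left h.right.1

/-- Y defines a morphism from S to CP¹: the second projection, which stays defined on all
exceptional curves because Y is finite at their centres. -/
theorem right_mem_or (h : Config X Y c c' b b' k S) (hR : R ∈ S) :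
    Y ∈ R.toSubring ∨ Y⁻¹ ∈ maxIdeal R := by
  obtain ⟨p, p', q, q', h1, h2, h3, h4, rfl⟩ := h.exists_points
  have hc := h.coord
  rcases mem_blowUp_iff.mp hR with ⟨hR, -⟩ | ⟨P, hP, hfib⟩
  · rcases mem_blowUp_iff.mp hR with ⟨hR, -⟩ | ⟨P, ⟨i, rfl⟩ | ⟨i, rfl⟩, hfib⟩
    · rcases h.frame.cases hR with h5 | ⟨h5, -⟩ | ⟨-, h5⟩ | ⟨-, -, h5⟩
      · exact Or.inl (right_mem_of_mem h5)
      · exact Or.inl (right_mem_of_mem h5)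
      · exact Or.inr h5
      · exact Or.inr h5
    · exact Or.inl (right_mem_of_isPt (h1 i) hfib.1)
    · exact Or.inl (right_mem_of_isPt (h2 i) hfib.1)
  · rcases hP with rfl | hP
    · exact Or.inl (mem_of_le hfib.1 (mem_of_sub_const_mem h3.containsConst
        (right_value_near hc h3).1))
    · rw [Set.mem_singleton_iff.mp hP] at hfib
      exact Or.inl (mem_of_le hfib.1 (mem_of_sub_const_mem h4.containsConst
        (right_value_near hc h4).1))

/-- Points off the fibres `X = c`, `X = c'` are not affected by the blow-ups. -/
theorem isClosedPoint_of_value (h : Config X Y c c' b b' k S) (hR : R ∈ P1P1) (hv : HasValues R)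
    {d : ℂ} (hd : X - const d ∈ maxIdeal R) (hdc : d ≠ c) (hdc' : d ≠ c') : IsClosedPoint S R := by
  have hchart := h.isCharted
  obtain ⟨p, p', q, q', h1, h2, h3, h4, rfl⟩ := h.exists_points
  have key : ∀ P, P ≤ R → X - const c ∉ maxIdeal P := fun P hP hm =>
    hdc (value_unique hv.1 hd (mem_maxIdeal_of_le hP hm))
  have key' : ∀ P, P ≤ R → X - const c' ∉ maxIdeal P := fun P hP hm =>
    hdc' (value_unique hv.1 hd (mem_maxIdeal_of_le hP hm))
  refine ⟨mem_blowUp_iff.mpr (Or.inl ⟨mem_blowUp_iff.mpr (Or.inl ⟨hR, ?_⟩), ?_⟩), ?_⟩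
  · rintro (⟨i, rfl⟩ | ⟨i, rfl⟩)
    · exact key _ le_rfl (h1 i).left
    · exact key' _ le_rfl (h2 i).left
  · rintro (rfl | hP)
    · exact key _ le_rfl h3.left
    · exact key' R le_rfl (by rw [Set.mem_singleton_iff.mp hP]; exact h4.left)
  · intro R' hR' hl
    -- Since `R` has residue field ℂ, a specialization of `R` is dominated by `R`. It cannot lie
    -- over a centre, because X would then take the value c or c' as well as d.
    have hle := le_of_liesOn hl (hchart.containsConst hR') hv
    rcases mem_blowUp_iff.mp hR' with ⟨hR', -⟩ | ⟨P, hP, hfib⟩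
    · rcases mem_blowUp_iff.mp hR' with ⟨hR', -⟩ | ⟨P, ⟨i, rfl⟩ | ⟨i, rfl⟩, hfib⟩
      · exact h.frame.eq_of_le hR hR' hle
      · exact absurd (h1 i).left (key _ (hfib.1.trans hle))
      · exact absurd (h2 i).left (key' _ (hfib.1.trans hle))
    · rcases hP with rfl | hP
      · exact absurd h3.left (key _ (hfib.1.trans hle))
      · rw [Set.mem_singleton_iff.mp hP] at hfib
        exact absurd h4.left (key' _ (hfib.1.trans hle))

theorem right_mem_of_isCurve (h : Config X Y c c' b b' k S) (hC : IsCurve S C)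
    (hinf : ¬ IsDv Y⁻¹ X C) : Y ∈ C.toSubring := by
  have hc := h.coord
  rcases h.curve_cases hC with h1 | h1 | h1 | ⟨i, h1⟩ | ⟨i, h1⟩ | h1 | h1
  · exact right_mem_of_mem h1
  · exact right_mem_of_mem h1.mem
  · exact absurd h1 hinf
  · exact mem_of_sub_const_mem h1.containsConst (value_exceptional hc h1).1
  · exact mem_of_sub_const_mem h1.containsConst (value_exceptional hc h1).1
  · exact mem_of_sub_const_mem h1.containsConst (value_exceptional_near hc h1).1
  · exact mem_of_sub_const_mem h1.containsConst (value_exceptional_near hc h1).1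

/-- The six curves of the fixed component. -/
structure FixedCurves (X Y : K) (c c' β β' : ℂ) (C₁ C₂ C₄ C₁' C₂' C₄' : LocalSubring K) : Prop where
  h1 : IsDv (X - const c) Y C₁
  h2 : IsDv (X - const c) ((Y - const β) / (X - const c)) C₂
  h4 : IsDv (Y - const β) X C₄
  h1' : IsDv (X - const c') Y C₁'
  h2' : IsDv (X - const c') ((Y - const β') / (X - const c')) C₂'
  h4' : IsDv (Y - const β') X C₄'

variable {C₁ C₂ C₄ C₁' C₂' C₄' : LocalSubring K}

open Classical in
-- The divisor of η²Φ as a bi-anticanonical section, curve by curve; the contribution of η cancels.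
-- The fibres X = c, c' get 2 and Y = bₖ, b'ₖ get 1 from Φ. The exceptional curves with i ≠ k get 2
-- - 2 = 0, those with i = k get 3 - 2 = 1, and the curves over q and its conjugate get 4 - 4 = 0.
-- At X = ∞ one has -4 + 4 = 0 and at Y = ∞ one has -2 + 4 = 2.
theorem fixed_table (h : Config X Y c c' b b' k S)
    (hF : FixedCurves X Y c c' (b k) (b' k) C₁ C₂ C₄ C₁' C₂' C₄')
    {CI : LocalSubring K} (hI : IsDv Y⁻¹ X CI) (hC : IsCurve S C) {η : K}
    (hω : η • wedge X Y ≠ 0) :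
    2 * ord C η + ord C (fixedEq X Y c c' (b k) (b' k)) - 2 * ordForm C (η • wedge X Y) =
      (2 • single C₁ + single C₂ + single C₄ + 2 • single C₁' + single C₂' + single C₄') C +
        2 * (if C = CI then 1 else 0) := by
  have hc := h.coord
  rw [ord_fixedEq hc]
  obtain ⟨a1, a2, a3⟩ := ord_fibre hc hF.h1
  obtain ⟨b1, b2, b3, b4⟩ := ord_exceptional hc hF.h2
  obtain ⟨c1, c2, c3⟩ := ord_fibre hc.symm hF.h4
  obtain ⟨a1', a2', a3'⟩ := ord_fibre hc hF.h1'
  obtain ⟨b1', b2', b3', b4'⟩ := ord_exceptional hc hF.h2'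
  obtain ⟨c1', c2', c3'⟩ := ord_fibre hc.symm hF.h4'
  obtain ⟨d1, d2⟩ := ord_infinity hc.symm hI
  have n1 := h.ne
  have n2 := h.gen k
  replace a2 := a2 c' n1.symm
  replace a2' := a2' c n1
  replace b2 := b2 c' n1.symm
  replace b2' := b2' c n1
  replace b4 := b4 (b' k) n2.symm
  replace b4' := b4' (b k) n2
  replace c2 := c2 (b' k) n2.symm
  replace c2' := c2' (b k) n2
  have a3k := a3 (b k)
  have a3k' := a3 (b' k)
  have a3'k := a3' (b k)
  have a3'k' := a3' (b' k)
  have c3c := c3 c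
  have c3c' := c3 c'
  have c3'c := c3' c
  have c3'c' := c3' c'
  have d1k := d1 (b k)
  have d1k' := d1 (b' k)
  have d2c := d2 c
  have d2c' := d2 c'
  have hev : (2 • single C₁ + single C₂ + single C₄ + 2 • single C₁' + single C₂' + single C₄') C =
      2 * (if C = C₁ then 1 else 0) + (if C = C₂ then 1 else 0) + (if C = C₄ then 1 else 0) +
      2 * (if C = C₁' then 1 else 0) + (if C = C₂' then 1 else 0) + (if C = C₄' then 1 else 0) := by
    simp only [Pi.add_apply, Pi.smul_apply, single_apply]
    simp only [nsmul_eq_mul, Nat.cast_ofNat]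
  rw [hev]
  rcases h.curve_cases hC with e | e | e | ⟨i, e⟩ | ⟨i, e⟩ | e | e
  · rw [ordForm_affine e hC.2 hω]
    -- Inside the affine plane a curve with X - c vanishing is the whole line, on which Y is not
    -- constant; on the exceptional curve Y has the value bₖ.
    have z1 : C ≠ C₂ := by
      rintro rfl
      have := isDv_of_isDVR (hc.sub_left c) (by rwa [← affineRing_sub_left]) hF.h2.left hC.2
      exact this.right_notMem _ (value_exceptional hc hF.h2)
    have z2 : C ≠ C₂' := by
      rintro rfl
      have := isDv_of_isDVR (hc.sub_left c') (by rwa [← affineRing_sub_left]) hF.h2'.left hC.2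
      exact this.right_notMem _ (value_exceptional hc hF.h2')
    have z3 : C ≠ CI := by
      rintro rfl
      have := (mem_iff_ord_nonneg hC.2 hc.right_ne_zero).mp (right_mem_of_mem e)
      have h5 := hI.ord_left hc.symm.inv_left
      rw [ord_inv C hc.right_ne_zero] at h5
      omega
    rw [if_neg z1, if_neg z2, if_neg z3]
    by_cases m1 : X - const c ∈ maxIdeal C
    · have : C = C₁ := (isDv_of_isDVR (hc.sub_left c) (by rwa [← affineRing_sub_left]) m1
        hC.2).eq hF.h1
      subst this
      -- From here on curves are told apart by the orders of X - c, X - c', Y - bₖ and Y - b'ₖ: an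
      -- equality would give one of these functions two different orders.
      have y1 : C ≠ C₄ := by rintro rfl; omega
      have y2 : C ≠ C₁' := by rintro rfl; omega
      have y3 : C ≠ C₄' := by rintro rfl; omega
      rw [if_pos rfl, if_neg y1, if_neg y2, if_neg y3]
      omega
    by_cases m2 : X - const c' ∈ maxIdeal C
    · have : C = C₁' := (isDv_of_isDVR (hc.sub_left c') (by rwa [← affineRing_sub_left]) m2
        hC.2).eq hF.h1'
      subst this
      have y1 : C ≠ C₄ := by rintro rfl; omega
      have y2 : C ≠ C₁ := by rintro rfl; omega
      have y3 : C ≠ C₄' := by rintro rfl; omega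
      rw [if_pos rfl, if_neg y1, if_neg y2, if_neg y3]
      omega
    by_cases m3 : Y - const (b k) ∈ maxIdeal C
    · have : C = C₄ := (isDv_of_isDVR (hc.symm.sub_left (b k))
        (by rw [← affineRing_sub_left, affineRing_comm]; exact e) m3 hC.2).eq hF.h4
      subst this
      have y1 : C ≠ C₁ := by rintro rfl; omega
      have y2 : C ≠ C₁' := by rintro rfl; omega
      have y3 : C ≠ C₄' := by rintro rfl; omega
      rw [if_pos rfl, if_neg y1, if_neg y2, if_neg y3]
      omega
    by_cases m4 : Y - const (b' k) ∈ maxIdeal C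
    · have : C = C₄' := (isDv_of_isDVR (hc.symm.sub_left (b' k))
        (by rw [← affineRing_sub_left, affineRing_comm]; exact e) m4 hC.2).eq hF.h4'
      subst this
      have y1 : C ≠ C₁ := by rintro rfl; omega
      have y2 : C ≠ C₁' := by rintro rfl; omega
      have y3 : C ≠ C₄ := by rintro rfl; omega
      rw [if_pos rfl, if_neg y1, if_neg y2, if_neg y3]
      omega
    have hcc := containsConst_of_mem e
    have hXC := left_mem_of_mem e
    have hYC := right_mem_of_mem e
    have w1 := ord_eq_zero hC.2 (hc.left_sub_ne_zero c) (sub_mem hXC (hcc c)) m1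
    have w2 := ord_eq_zero hC.2 (hc.left_sub_ne_zero c') (sub_mem hXC (hcc c')) m2
    have w3 := ord_eq_zero hC.2 (hc.right_sub_ne_zero (b k)) (sub_mem hYC (hcc _)) m3
    have w4 := ord_eq_zero hC.2 (hc.right_sub_ne_zero (b' k)) (sub_mem hYC (hcc _)) m4
    have y1 : C ≠ C₁ := by rintro rfl; omega
    have y2 : C ≠ C₁' := by rintro rfl; omega
    have y3 : C ≠ C₄ := by rintro rfl; omega
    have y4 : C ≠ C₄' := by rintro rfl; omega
    rw [if_neg y1, if_neg y2, if_neg y3, if_neg y4]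
    omega
  · obtain ⟨v1, v2⟩ := ord_infinity hc e
    have w1 := v1 c
    have w2 := v1 c'
    have w3 := v2 (b k)
    have w4 := v2 (b' k)
    rw [ordForm_infinity_left hc e hω, if_neg (by rintro rfl; omega), if_neg (by rintro rfl; omega),
      if_neg (by rintro rfl; omega), if_neg (by rintro rfl; omega), if_neg (by rintro rfl; omega),
      if_neg (by rintro rfl; omega), if_neg (by rintro rfl; omega)]
    omega
  · have hCI : C = CI := e.eq hI
    subst hCI
    rw [ordForm_infinity_right hc e hω, if_neg (by rintro rfl; omega), if_neg (by rintro rfl; omega),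
      if_neg (by rintro rfl; omega), if_neg (by rintro rfl; omega), if_neg (by rintro rfl; omega),
      if_neg (by rintro rfl; omega), if_pos rfl]
    omega
  · obtain ⟨w1, w2, w3, w4⟩ := ord_exceptional hc e
    replace w2 := w2 c' n1.symm
    by_cases hik : i = k
    · subst hik
      have : C = C₂ := e.eq hF.h2
      subst this
      rw [ordForm_exceptional hc e hω, if_neg (by rintro rfl; omega), if_pos rfl,
        if_neg (by rintro rfl; omega), if_neg (by rintro rfl; omega), if_neg (by rintro rfl; omega),
        if_neg (by rintro rfl; omega), if_neg (by rintro rfl; omega)]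
      omega
    · have w5 := w4 (b k) fun e => hik (h.inj e).symm
      have w6 := w4 (b' k) (h.gen' i)
      have a3i := a3 (b i)
      rw [ordForm_exceptional hc e hω, if_neg (by rintro rfl; omega), if_neg (by rintro rfl; omega),
        if_neg (by rintro rfl; omega), if_neg (by rintro rfl; omega), if_neg (by rintro rfl; omega),
        if_neg (by rintro rfl; omega), if_neg (by rintro rfl; omega)]
      omega
  · obtain ⟨w1, w2, w3, w4⟩ := ord_exceptional hc e
    replace w2 := w2 c n1
    by_cases hik : i = k
    · subst hik
      have : C = C₂' := e.eq hF.h2'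
      subst this
      rw [ordForm_exceptional hc e hω, if_neg (by rintro rfl; omega), if_neg (by rintro rfl; omega),
        if_neg (by rintro rfl; omega), if_neg (by rintro rfl; omega), if_pos rfl,
        if_neg (by rintro rfl; omega), if_neg (by rintro rfl; omega)]
      omega
    · have w5 := w4 (b' k) fun e => hik (h.inj' e).symm
      have w6 := w4 (b k) (h.gen i)
      have a3i := a3' (b' i)
      rw [ordForm_exceptional hc e hω, if_neg (by rintro rfl; omega), if_neg (by rintro rfl; omega),
        if_neg (by rintro rfl; omega), if_neg (by rintro rfl; omega), if_neg (by rintro rfl; omega),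
        if_neg (by rintro rfl; omega), if_neg (by rintro rfl; omega)]
      omega
  · obtain ⟨w1, w2, w3, w4⟩ := ord_exceptional_near hc e
    replace w2 := w2 c' n1.symm
    replace w4 := w4 (b' k) n2.symm
    rw [ordForm_exceptional_near hc e hω, if_neg (by rintro rfl; omega),
      if_neg (by rintro rfl; omega), if_neg (by rintro rfl; omega), if_neg (by rintro rfl; omega),
      if_neg (by rintro rfl; omega), if_neg (by rintro rfl; omega), if_neg (by rintro rfl; omega)]
    omega
  · obtain ⟨w1, w2, w3, w4⟩ := ord_exceptional_near hc e
    replace w2 := w2 c n1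
    replace w4 := w4 (b k) n2
    rw [ordForm_exceptional_near hc e hω, if_neg (by rintro rfl; omega),
      if_neg (by rintro rfl; omega), if_neg (by rintro rfl; omega), if_neg (by rintro rfl; omega),
      if_neg (by rintro rfl; omega), if_neg (by rintro rfl; omega), if_neg (by rintro rfl; omega)]
    omega

end Config

/-! ### Maps to the projective plane -/

section TakesValue

variable {R : LocalSubring K} {s : Fin 3 → K}

/-- The ratio g/g' of two normalizations has a value in ℂ, computed from a coordinate with vⱼ ≠ 0,
and this one scalar relates all the coordinates. -/
theorem TakesValue.exists_rep_eq (hc : ContainsConst R) {P : Projectivization ℂ (Fin 3 → ℂ)}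
    (hP : TakesValue s R P) {g : K} {v : Fin 3 → ℂ} (hv : v ≠ 0)
    (hg : ∀ i, s i / g - const (v i) ∈ maxIdeal R) : ∃ l : ℂ, l ≠ 0 ∧ P.rep = l • v := by
  obtain ⟨g', hg'0, hg'⟩ := hP
  obtain ⟨j, hj⟩ := Function.ne_iff.mp hv
  have hj : v j ≠ 0 := hj
  have hsj : s j / g ≠ 0 := by
    intro h0
    have := hg j
    rw [h0] at this
    exact hj (value_unique hc this (b := 0) (by rw [const, map_zero, sub_zero]; exact zero_mem_maxIdeal))
  have hg0 : g ≠ 0 := fun h0 => hsj (by rw [h0, div_zero])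
  have hsj0 : s j ≠ 0 := fun h0 => hsj (by rw [h0, zero_div])
  have hρ := value_mul hc (hg' j) (value_inv hc hj (hg j))
  rw [show s j / g' * (s j / g)⁻¹ = g / g' by field_simp] at hρ
  have hrep : P.rep = (P.rep j * (v j)⁻¹) • v := by
    ext i
    have h1 := value_mul hc hρ (hg i)
    rw [show g / g' * (s i / g) = s i / g' by field_simp] at h1
    exact value_unique hc (hg' i) h1
  refine ⟨_, ?_, hrep⟩
  intro h0
  rw [h0, zero_smul] at hrep
  exact P.rep_nonzero hrep

/-- `TakesValue` refers to the chosen representative of P; rescaling g absorbs the choice. -/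
theorem takesValue_of_rep_eq (hc : ContainsConst R) {P : Projectivization ℂ (Fin 3 → ℂ)} {g : K}
    (hg0 : g ≠ 0) {v : Fin 3 → ℂ} (hg : ∀ i, s i / g - const (v i) ∈ maxIdeal R) {l : ℂ}
    (hl : l ≠ 0) (hP : P.rep = l • v) : TakesValue s R P := by
  have hl' : const l ≠ 0 := (map_ne_zero _).mpr hl
  refine ⟨g / const l, div_ne_zero hg0 hl', fun i => ?_⟩
  have h1 := mul_mem_maxIdeal (hc l) (hg i)
  rw [hP]
  rwa [show const l * (s i / g - const (v i)) = s i / (g / const l) - const ((l • v) i) by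
    simp only [const, Pi.smul_apply, smul_eq_mul, map_mul]
    field_simp] at h1

theorem existsUnique_takesValue (hc : ContainsConst R) {g : K} (hg0 : g ≠ 0) {v : Fin 3 → ℂ}
    (hv : v ≠ 0) (hg : ∀ i, s i / g - const (v i) ∈ maxIdeal R) : ∃! P, TakesValue s R P := by
  have hmk : ∀ P : Projectivization ℂ (Fin 3 → ℂ), ∀ l : ℂ, l ≠ 0 → P.rep = l • v →
      P = Projectivization.mk ℂ v hv := by
    intro P l hl hP
    rw [← P.mk_rep, Projectivization.mk_eq_mk_iff']
    exact ⟨l, hP.symm⟩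
  refine ⟨Projectivization.mk ℂ v hv, ?_, fun P hP => ?_⟩
  · obtain ⟨l, hl⟩ := Projectivization.exists_smul_eq_mk_rep ℂ v hv
    exact takesValue_of_rep_eq hc hg0 hg l.ne_zero hl.symm
  · obtain ⟨l, hl, hP⟩ := hP.exists_rep_eq hc hv hg
    exact hmk P l hl hP

end TakesValue

/-- The quadratic form `2 (e₀ e₂ - e₁²)`. -/
def conicMatrix : Matrix (Fin 3) (Fin 3) ℂ := !![0, 0, 1; 0, -2, 0; 1, 0, 0]

theorem dotProduct_conicMatrix (e : Fin 3 → ℂ) :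
    e ⬝ᵥ conicMatrix.mulVec e = 2 * (e 0 * e 2 - e 1 ^ 2) := by
  simp [conicMatrix, Matrix.mulVec, dotProduct, Fin.sum_univ_three]
  ring

/-- The map defined by the polynomials of degree at most `2` in a function `Y` that takes all
values is a morphism onto a conic. -/
theorem isConic_of_quadratic {S : Set (LocalSubring K)} {Y G : K} (hG : G ≠ 0) (hY : Y ≠ 0)
    {s : Fin 3 → K} {M : Matrix (Fin 3) (Fin 3) ℂ} (hM : IsUnit M)
    (hs : ∀ i, s i = G * ∑ j, M i j • Y ^ (j : ℕ))
    (hval : ∀ R, IsClosedPoint S R → HasValues R)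
    (hmem : ∀ R, IsClosedPoint S R → Y ∈ R.toSubring ∨ Y⁻¹ ∈ maxIdeal R)
    (hsurj : ∀ a : ℂ, ∃ R, IsClosedPoint S R ∧ Y - const a ∈ maxIdeal R)
    (hinf : ∃ R, IsClosedPoint S R ∧ Y⁻¹ ∈ maxIdeal R) :
    (∀ R, IsClosedPoint S R → ∃! P, TakesValue s R P) ∧
      IsConic {P | ∃ R, IsClosedPoint S R ∧ TakesValue s R P} := by
  have hdet : IsUnit M.det := (Matrix.isUnit_iff_isUnit_det M).mp hM
  have hMinv : M⁻¹ * M = 1 := Matrix.nonsing_inv_mul M hdet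
  have hMinv' : M * M⁻¹ = 1 := Matrix.mul_nonsing_inv M hdet
  have hval_s : ∀ (R : LocalSubring K) (g : K) (e : Fin 3 → ℂ), ContainsConst R →
      (∀ j : Fin 3, Y ^ (j : ℕ) / g - const (e j) ∈ maxIdeal R) →
      ∀ i, s i / (G * g) - const (M.mulVec e i) ∈ maxIdeal R := by
    intro R g e hc h i
    have h1 : s i / (G * g) - const (M.mulVec e i) =
        ∑ j, const (M i j) * (Y ^ (j : ℕ) / g - const (e j)) := by
      rw [hs, mul_div_mul_left _ _ hG, Matrix.mulVec, dotProduct, const, map_sum, Finset.sum_div,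
        ← Finset.sum_sub_distrib]
      refine Finset.sum_congr rfl fun j _ => ?_
      rw [Algebra.smul_def, map_mul]
      ring
    rw [h1, Fin.sum_univ_three]
    exact add_mem_maxIdeal (add_mem_maxIdeal (mul_mem_maxIdeal (hc _) (h 0))
      (mul_mem_maxIdeal (hc _) (h 1))) (mul_mem_maxIdeal (hc _) (h 2))
  have hfin : ∀ (R : LocalSubring K) (a : ℂ) (l : ℂ), ContainsConst R → l ≠ 0 →
      Y - const a ∈ maxIdeal R → ∀ j : Fin 3,
      Y ^ (j : ℕ) / const l⁻¹ - const ((l • ![1, a, a ^ 2]) j) ∈ maxIdeal R := by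
    intro R a l hc hl ha j
    have h1 : Y ^ (j : ℕ) - const (a ^ (j : ℕ)) ∈ maxIdeal R := by
      have := value_aeval hc ha (Polynomial.X ^ (j : ℕ))
      simpa using this
    have h2 := mul_mem_maxIdeal (hc l) h1
    have h3 : (![1, a, a ^ 2] : Fin 3 → ℂ) j = a ^ (j : ℕ) := by fin_cases j <;> simp
    rw [Pi.smul_apply, h3]
    rwa [show const l * (Y ^ (j : ℕ) - const (a ^ (j : ℕ))) =
      Y ^ (j : ℕ) / const l⁻¹ - const (l • a ^ (j : ℕ)) by
        simp only [const, smul_eq_mul, map_mul, map_inv₀, div_inv_eq_mul]; ring] at h2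
  have hinfv : ∀ (R : LocalSubring K) (l : ℂ), ContainsConst R → l ≠ 0 →
      Y⁻¹ ∈ maxIdeal R → ∀ j : Fin 3,
      Y ^ (j : ℕ) / (Y ^ 2 * const l⁻¹) - const ((l • ![0, 0, 1] : Fin 3 → ℂ) j) ∈ maxIdeal R := by
    intro R l hc hl hm j
    fin_cases j
    · have := mul_mem_maxIdeal (hc l) (pow_mem_maxIdeal two_ne_zero hm)
      simpa [const, div_eq_mul_inv, mul_comm] using this
    · have := mul_mem_maxIdeal (hc l) hm
      have e : Y / (Y ^ 2 * const l⁻¹) = const l * Y⁻¹ := by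
        have hl' : const l ≠ 0 := (map_ne_zero _).mpr hl
        simp only [const, map_inv₀] at hl' ⊢
        field_simp
      rw [← e] at this
      simpa [const] using this
    · have hl' : const l ≠ 0 := (map_ne_zero _).mpr hl
      have e : Y ^ 2 / (Y ^ 2 * const l⁻¹) = const l := by
        simp only [const, map_inv₀] at hl' ⊢
        field_simp
      simp only [e, Fin.reduceFinMk]
      simpa [e] using zero_mem_maxIdeal
  have hMne : ∀ e : Fin 3 → ℂ, e ≠ 0 → M.mulVec e ≠ 0 := by
    intro e he h0
    apply he
    have := congrArg M⁻¹.mulVec h0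
    rwa [Matrix.mulVec_mulVec, hMinv, Matrix.one_mulVec, Matrix.mulVec_zero] at this
  -- the value at a closed point
  have hpoint : ∀ R, IsClosedPoint S R → ∃ g : K, g ≠ 0 ∧ ∃ e : Fin 3 → ℂ, e ≠ 0 ∧
      e 0 * e 2 = e 1 ^ 2 ∧ ∀ i, s i / (G * g) - const (M.mulVec e i) ∈ maxIdeal R := by
    intro R hR
    have hc := (hval R hR).1
    rcases hmem R hR with h1 | h1
    · obtain ⟨a, ha⟩ := (hval R hR).2 Y h1
      refine ⟨const 1⁻¹, (map_ne_zero _).mpr (by norm_num), _, ?_, ?_,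
        hval_s R _ _ hc (hfin R a 1 hc one_ne_zero ha)⟩
      · intro h0
        have := congrFun h0 0
        simp at this
      · simp
    · refine ⟨Y ^ 2 * const 1⁻¹, mul_ne_zero (pow_ne_zero 2 hY) ((map_ne_zero _).mpr (by norm_num)),
        _, ?_, ?_, hval_s R _ _ hc (hinfv R 1 hc one_ne_zero h1)⟩
      · intro h0
        have := congrFun h0 2
        simp at this
      · simp
  -- In the basis 1, Y, Y² the image is e₀ e₂ = e₁². The basis s differs from it by M and the common
  -- factor G, so the form is transported by M⁻¹.
  refine ⟨fun R hR => ?_, M⁻¹.transpose * conicMatrix * M⁻¹, ?_, ?_, ?_⟩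
  · obtain ⟨g, hg, e, he, -, h⟩ := hpoint R hR
    exact existsUnique_takesValue (hval R hR).1 (mul_ne_zero hG hg) (hMne e he) h
  · have hQ : conicMatrix.transpose = conicMatrix := by
      ext i j
      fin_cases i <;> fin_cases j <;> simp [conicMatrix]
    rw [Matrix.IsSymm, Matrix.transpose_mul, Matrix.transpose_mul, Matrix.transpose_transpose, hQ,
      Matrix.mul_assoc]
  · have hQ : conicMatrix.det ≠ 0 := by
      simp [conicMatrix, Matrix.det_fin_three]
    have hdet' : M⁻¹.det ≠ 0 := by
      intro h0
      have := congrArg Matrix.det hMinv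
      rw [Matrix.det_mul, h0, zero_mul, Matrix.det_one] at this
      exact zero_ne_one this
    rw [Matrix.det_mul, Matrix.det_mul, Matrix.det_transpose]
    exact mul_ne_zero (mul_ne_zero hdet' hQ) hdet'
  · have hform : ∀ v : Fin 3 → ℂ, v ⬝ᵥ (M⁻¹.transpose * conicMatrix * M⁻¹).mulVec v =
        2 * (M⁻¹.mulVec v 0 * M⁻¹.mulVec v 2 - M⁻¹.mulVec v 1 ^ 2) := by
      intro v
      rw [← dotProduct_conicMatrix, Matrix.mul_assoc, ← Matrix.mulVec_mulVec,
        ← Matrix.mulVec_mulVec, Matrix.dotProduct_mulVec, Matrix.vecMul_transpose]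
    ext P
    simp only [Set.mem_ofPred_eq]
    rw [hform]
    constructor
    · rintro ⟨R, hR, hP⟩
      obtain ⟨g, hg, e, he, hquad, h⟩ := hpoint R hR
      obtain ⟨l, hl, hrep⟩ := hP.exists_rep_eq (hval R hR).1 (hMne e he) h
      rw [hrep, Matrix.mulVec_smul, Matrix.mulVec_mulVec, hMinv, Matrix.one_mulVec]
      simp only [Pi.smul_apply, smul_eq_mul]
      linear_combination 2 * l ^ 2 * hquad
    · intro hP
      set e := M⁻¹.mulVec P.rep with he
      have hrep : P.rep = M.mulVec e := by
        rw [he, Matrix.mulVec_mulVec, hMinv', Matrix.one_mulVec]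
      have hquad : e 0 * e 2 = e 1 ^ 2 := by linear_combination hP / 2
      -- On the standard conic e₀ = 0 leaves only (0 : 0 : 1), the image of Y = ∞; every other point
      -- is the image of Y = e₁/e₀.
      by_cases h0 : e 0 = 0
      · have h1 : e 1 = 0 := by
          rw [h0, zero_mul] at hquad
          exact pow_eq_zero_iff two_ne_zero |>.mp hquad.symm
        have h2 : e 2 ≠ 0 := by
          intro h2
          apply P.rep_nonzero
          rw [hrep, show e = 0 by ext i; fin_cases i <;> simp [h0, h1, h2], Matrix.mulVec_zero]
        obtain ⟨R, hR, hm⟩ := hinf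
        refine ⟨R, hR, G * (Y ^ 2 * const (e 2)⁻¹), mul_ne_zero hG (mul_ne_zero (pow_ne_zero 2 hY)
          ((map_ne_zero _).mpr (inv_ne_zero h2))), ?_⟩
        have h3 := hval_s R _ _ (hval R hR).1 (hinfv R (e 2) (hval R hR).1 h2 hm)
        rw [show e 2 • (![0, 0, 1] : Fin 3 → ℂ) = e by
          ext i; fin_cases i <;> simp [h0, h1], ← hrep] at h3
        exact h3
      · obtain ⟨R, hR, hm⟩ := hsurj (e 1 / e 0)
        refine ⟨R, hR, G * const (e 0)⁻¹, mul_ne_zero hG ((map_ne_zero _).mpr (inv_ne_zero h0)), ?_⟩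
        have h3 := hval_s R _ _ (hval R hR).1 (hfin R _ (e 0) (hval R hR).1 h0 hm)
        rw [show e 0 • (![1, e 1 / e 0, (e 1 / e 0) ^ 2] : Fin 3 → ℂ) = e by
          ext i
          fin_cases i
          · simp
          · simp [mul_div_cancel₀ _ h0]
          · simp only [Fin.reduceFinMk, Pi.smul_apply, smul_eq_mul, Matrix.cons_val]
            field_simp
            linear_combination -hquad, ← hrep] at h3
        exact h3

/-- The rational functions `G · r(Y)`, `deg r ≤ 2`. -/
def quadraticMap (G Y : K) : (Fin 3 → ℂ) →ₗ[ℂ] K :=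
  (LinearMap.mulLeft ℂ G).comp (Fintype.linearCombination ℂ fun j : Fin 3 => Y ^ (j : ℕ))

theorem quadraticMap_apply (G Y : K) (a : Fin 3 → ℂ) :
    quadraticMap G Y a = G * ∑ j, a j • Y ^ (j : ℕ) := by
  simp [quadraticMap, Fintype.linearCombination_apply, Finset.mul_sum]

theorem exists_quadraticMap_eq (G Y : K) {r : Polynomial ℂ} (hr : r.natDegree ≤ 2) :
    quadraticMap G Y (fun j => r.coeff j) = G * Polynomial.aeval Y r := by
  rw [quadraticMap_apply, Polynomial.aeval_eq_sum_range' (n := 3) (by omega), Finset.sum_range]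

theorem exists_aeval_eq_quadraticMap (G Y : K) (a : Fin 3 → ℂ) :
    ∃ r : Polynomial ℂ, r.natDegree ≤ 2 ∧ (∀ j : Fin 3, r.coeff j = a j) ∧
      quadraticMap G Y a = G * Polynomial.aeval Y r := by
  let r : Polynomial ℂ := ∑ j : Fin 3, Polynomial.monomial (j : ℕ) (a j)
  have hr : r.natDegree ≤ 2 := by
    refine Polynomial.natDegree_sum_le_of_forall_le _ _ fun j _ => ?_
    exact (Polynomial.natDegree_monomial_le _).trans (by omega)
  have hcoeff : ∀ j : Fin 3, r.coeff j = a j := by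
    intro j
    simp only [r, Polynomial.finsetSum_coeff, Polynomial.coeff_monomial]
    rw [Finset.sum_eq_single j]
    · simp
    · intro i _ hij
      rw [if_neg fun h => hij (Fin.ext h)]
    · simp
  refine ⟨r, hr, hcoeff, ?_⟩
  rw [← exists_quadraticMap_eq G Y hr]
  congr 1
  ext j
  exact (hcoeff j).symm

theorem quadraticMap_injective {G Y : K} {X : K} (hG : G ≠ 0) (hc : Coord X Y) :
    Function.Injective (quadraticMap G Y) := by
  rw [injective_iff_map_eq_zero]
  intro a ha
  obtain ⟨r, -, hcoeff, e⟩ := exists_aeval_eq_quadraticMap G Y a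
  obtain ⟨V, hV⟩ := hc.exists_isDv
  have hr0 : Polynomial.aeval Y r = 0 := by
    rw [ha] at e
    exact (mul_eq_zero.mp e.symm).resolve_left hG
  have : r = 0 := hV.right r (by rw [hr0]; exact zero_mem_maxIdeal)
  ext j
  rw [← hcoeff j, this]
  simp

/-! ### The bi-anticanonical system of a configuration -/

namespace Config

variable {X Y : K} {c c' : ℂ} {ι : Type} [Fintype ι] {b b' : ι → ℂ} {k : ι}
  {S : Set (LocalSubring K)} {C₁ C₂ C₄ C₁' C₂' C₄' : LocalSubring K}

theorem ord_aeval_infinity (hc : Coord X Y) {CI : LocalSubring K} (hI : IsDv Y⁻¹ X CI)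
    {r : Polynomial ℂ} (hd : r.natDegree ≤ 2)
    (h0 : Polynomial.aeval Y r ≠ 0) : 0 ≤ ord CI (Polynomial.aeval Y r) + 2 := by
  have hY := hc.right_ne_zero
  have hmem : Polynomial.aeval Y r ∈ bideg Y X 2 0 := by
    rw [← mul_one (Polynomial.aeval Y r)]
    exact Submodule.mul_mem_mul (aeval_mem_polyLE hd) (mem_polyLE.mpr ⟨1, by simp, by simp⟩)
  have h1 := div_pow_mem hI hY hmem
  have h2 := hI.ord_left hc.symm.inv_left
  rw [ord_inv CI hY] at h2
  rw [mem_iff_ord_nonneg (hI.isDVR hc.symm.inv_left) (div_ne_zero h0 (pow_ne_zero 2 hY)),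
    ord_div CI h0 (pow_ne_zero 2 hY), ord_pow CI hY] at h1
  push_cast at h1
  omega

theorem aeval_ne_zero (hc : Coord X Y) {r : Polynomial ℂ} (hr : r ≠ 0) :
    Polynomial.aeval Y r ≠ 0 := by
  obtain ⟨V, hV⟩ := hc.exists_isDv
  intro h0
  exact hr (hV.right r (by rw [h0]; exact zero_mem_maxIdeal))

/-- The bi-anticanonical system, in affine coordinates. -/
theorem bianticanonical (h : Config X Y c c' b b' k S)
    (hFC : FixedCurves X Y c c' (b k) (b' k) C₁ C₂ C₄ C₁' C₂' C₄')
    {KS F : LocalSubring K → ℤ} (hKS : IsCanonicalDivisor S KS)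
    (hF : F = 2 • single C₁ + single C₂ + single C₄ + 2 • single C₁' + single C₂' + single C₄') :
    IsFixedPart (linearSystem S ((-2 : ℤ) • KS)) F ∧
    IsBasePointFree S (movablePart (linearSystem S ((-2 : ℤ) • KS)) F) ∧
    Module.finrank ℂ (H0 S ((-2 : ℤ) • KS - F)) = 3 ∧
    ∀ s : Module.Basis (Fin 3) ℂ (H0 S ((-2 : ℤ) • KS - F)),
      (∀ R, IsClosedPoint S R → ∃! P, TakesValue (fun i => (s i : K)) R P) ∧
      IsConic {P | ∃ R, IsClosedPoint S R ∧ TakesValue (fun i => (s i : K)) R P} := by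
  classical
  have hc := h.coord
  obtain ⟨ω, hω, hKSω⟩ := hKS
  obtain ⟨η, rfl⟩ := hc.exists_eq_smul_wedge ω
  have hη : η ≠ 0 := fun h0 => hω (by rw [h0, zero_smul])
  obtain ⟨CI, hI⟩ := hc.symm.inv_left.exists_isDv
  have hCI : IsCurve S CI := h.isCurve_infinity_right hI
  set Φ := fixedEq X Y c c' (b k) (b' k) with hΦ
  have hΦ0 : Φ ≠ 0 := fixedEq_ne_zero hc _ _ _ _
  set G := η ^ 2 * Φ with hGdef
  have hG : G ≠ 0 := mul_ne_zero (pow_ne_zero 2 hη) hΦ0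
  set D : LocalSubring K → ℤ := (-2 : ℤ) • KS with hD
  have hDC : ∀ C, IsCurve S C → D C = -2 * ordForm C (η • wedge X Y) := by
    intro C hC
    rw [hD, Pi.smul_apply, hKSω, divForm, if_pos hC, smul_eq_mul]
  have hDN : ∀ C, ¬ IsCurve S C → D C = 0 := by
    intro C hC
    rw [hD, Pi.smul_apply, hKSω, divForm, if_neg hC, smul_zero]
  have hdivC : ∀ C f, IsCurve S C → div S f C = ord C f := fun C f hC => if_pos hC
  have hdivN : ∀ C f, ¬ IsCurve S C → div S f C = 0 := fun C f hC => if_neg hC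
  have hordη : ∀ C, ord C (η ^ 2) = 2 * ord C η := fun C => by
    rw [ord_pow C hη]; norm_num
  -- The section G has divisor F + 2 (Y = ∞). The double fibre leaves room for the poles of
  -- quadratic polynomials in Y.
  have htable : ∀ C, IsCurve S C → ord C G + D C = F C + 2 * (if C = CI then 1 else 0) := by
    intro C hC
    rw [hGdef, ord_mul C (pow_ne_zero 2 hη) hΦ0, hordη, hDC C hC, hF,
      ← h.fixed_table hFC hI hC hω]
    ring
  have hFN : ∀ C, ¬ IsCurve S C → F C = 0 := by
    intro C hC
    have k1 : C ≠ C₁ := by rintro rfl; exact hC (h.isCurve_fibre_left hFC.h1)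
    have k2 : C ≠ C₂ := by rintro rfl; exact hC (h.isCurve_exceptional hFC.h2)
    have k3 : C ≠ C₄ := by rintro rfl; exact hC (h.isCurve_fibre_right hFC.h4)
    have k4 : C ≠ C₁' := by rintro rfl; exact hC (h.isCurve_fibre_left hFC.h1')
    have k5 : C ≠ C₂' := by rintro rfl; exact hC (h.symm.isCurve_exceptional hFC.h2')
    have k6 : C ≠ C₄' := by rintro rfl; exact hC (h.isCurve_fibre_right hFC.h4')
    rw [hF]
    simp only [Pi.add_apply, Pi.smul_apply, single_apply, if_neg k1, if_neg k2, if_neg k3,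
      if_neg k4, if_neg k5, if_neg k6]
    simp
  have hF0 : ∀ C, 0 ≤ F C := by
    intro C
    have hs : ∀ D, 0 ≤ single D C := fun D => by
      rw [single_apply]; split_ifs <;> norm_num
    rw [hF]
    simp only [Pi.add_apply, Pi.smul_apply]
    simp only [nsmul_eq_mul, Nat.cast_ofNat]
    have := hs C₁
    have := hs C₂
    have := hs C₄
    have := hs C₁'
    have := hs C₂'
    have := hs C₄'
    linarith
  -- the quadratic polynomials are effective
  have heff : ∀ r : Polynomial ℂ, r ≠ 0 → r.natDegree ≤ 2 → ∀ C, IsCurve S C →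
      0 ≤ ord C (Polynomial.aeval Y r) + 2 * (if C = CI then 1 else 0) := by
    intro r hr hd C hC
    have h0 := aeval_ne_zero hc hr
    split_ifs with hCC
    · subst hCC
      have := ord_aeval_infinity hc hI hd h0
      omega
    · have hYC := h.right_mem_of_isCurve hC fun h1 => hCC (h1.eq hI)
      have hcc := h.isCharted.containsConst hC.1
      have := (mem_iff_ord_nonneg hC.2 h0).mp (aeval_mem_of_mem hcc hYC r)
      omega
  -- Division by η² leaves conditions on orders relative to dX ∧ dY alone, namely the pole and
  -- multiplicity bounds of `exists_eq_fixedEq_mul`.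
  have hsec : ∀ f, f ≠ 0 → (∀ C, IsCurve S C → 0 ≤ ord C f + D C) →
      ∃ r : Polynomial ℂ, r.natDegree ≤ 2 ∧ f = G * Polynomial.aeval Y r := by
    intro f hf hord
    have hg0 : f / η ^ 2 ≠ 0 := div_ne_zero hf (pow_ne_zero 2 hη)
    have hord' : ∀ C, IsCurve S C →
        2 * (ordForm C (η • wedge X Y) - ord C η) ≤ ord C (f / η ^ 2) := by
      intro C hC
      have := hord C hC
      rw [hDC C hC] at this
      rw [ord_div C hf (pow_ne_zero 2 hη), hordη]
      omega
    have key : ∃ r : Polynomial ℂ, r.natDegree ≤ 2 ∧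
        f / η ^ 2 = fixedEq X Y c c' (b k) (b' k) * Polynomial.aeval Y r := by
      refine h.exists_eq_fixedEq_mul hg0 ?_ ?_ ?_ ?_ ?_ ?_ ?_
      · intro C hC hDv
        have := hord' C (h.isCurve_affine hC hDv)
        rw [ordForm_affine hC hDv hω] at this
        omega
      · intro C hC
        have := hord' C (h.isCurve_infinity_left hC)
        rw [ordForm_infinity_left hc hC hω] at this
        omega
      · intro C hC
        have := hord' C (h.isCurve_infinity_right hC)
        rw [ordForm_infinity_right hc hC hω] at this
        omega
      · intro i C hC
        have := hord' C (h.isCurve_exceptional hC)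
        rw [ordForm_exceptional hc hC hω] at this
        omega
      · intro i C hC
        have := hord' C (h.symm.isCurve_exceptional hC)
        rw [ordForm_exceptional hc hC hω] at this
        omega
      · intro C hC
        have := hord' C (h.isCurve_exceptional_near hC)
        rw [ordForm_exceptional_near hc hC hω] at this
        omega
      · intro C hC
        have := hord' C (h.symm.isCurve_exceptional_near hC)
        rw [ordForm_exceptional_near hc hC hω] at this
        omega
    obtain ⟨r, hr, e⟩ := key
    refine ⟨r, hr, ?_⟩
    rw [div_eq_iff (pow_ne_zero 2 hη)] at e
    rw [e, hGdef]; ring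
  have hordG : ∀ r : Polynomial ℂ, r ≠ 0 → ∀ C, IsCurve S C →
      ord C (G * Polynomial.aeval Y r) + D C =
        F C + (ord C (Polynomial.aeval Y r) + 2 * (if C = CI then 1 else 0)) := by
    intro r hr C hC
    rw [ord_mul C hG (aeval_ne_zero hc hr)]
    linarith [htable C hC]
  have hmemL : ∀ r : Polynomial ℂ, r ≠ 0 → r.natDegree ≤ 2 →
      div S (G * Polynomial.aeval Y r) + D ∈ linearSystem S D := by
    intro r hr hd
    refine ⟨fun C => ?_, _, mul_ne_zero hG (aeval_ne_zero hc hr), rfl⟩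
    by_cases hC : IsCurve S C
    · rw [Pi.add_apply, hdivC C _ hC, hordG r hr C hC]
      have := heff r hr hd C hC
      have := hF0 C
      simp only [Pi.zero_apply]
      omega
    · rw [Pi.add_apply, hdivN C _ hC, hDN C hC]
      simp
  have hY := hc.right_ne_zero
  have hordY : ord CI Y = -1 := by
    have := hI.ord_left hc.symm.inv_left
    rw [ord_inv CI hY] at this
    omega
  refine ⟨⟨⟨_, hmemL 1 one_ne_zero (by simp)⟩, ?_, ?_⟩, ?_, ?_⟩
  · rintro E ⟨hE, f, hf, rfl⟩ C
    have hE' : ∀ C, IsCurve S C → 0 ≤ ord C f + D C := by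
      intro C hC
      have := hE C
      rwa [Pi.add_apply, hdivC C _ hC] at this
    obtain ⟨r, hr, rfl⟩ := hsec f hf hE'
    have hr0 : r ≠ 0 := by
      rintro rfl
      exact hf (by rw [map_zero, mul_zero])
    by_cases hC : IsCurve S C
    · rw [Pi.add_apply, hdivC C _ hC, hordG r hr0 C hC]
      exact le_add_of_nonneg_right (heff r hr0 hr C hC)
    · rw [Pi.add_apply, hdivN C _ hC, hDN C hC, hFN C hC]
      simp
  -- Two members suffice to bound a common lower bound by F: r = 1 adds nothing to F off Y = ∞, and
  -- r = Y² adds -2 + 2 = 0 along Y = ∞.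
  · intro W hW C
    by_cases hC : IsCurve S C
    · by_cases hCC : C = CI
      · have h1 := hW (hmemL (Polynomial.X ^ 2) (pow_ne_zero 2 Polynomial.X_ne_zero) (by simp)) C
        rw [Pi.add_apply, hdivC C _ hC, hordG _ (pow_ne_zero 2 Polynomial.X_ne_zero) C hC,
          map_pow, Polynomial.aeval_X, ord_pow C hY, if_pos hCC, hCC, hordY] at h1
        rw [hCC]
        norm_num at h1
        exact h1
      · have h1 := hW (hmemL 1 one_ne_zero (by simp)) C
        rw [Pi.add_apply, hdivC C _ hC, hordG _ one_ne_zero C hC, map_one, ord_one,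
          if_neg hCC] at h1
        norm_num at h1
        exact h1
    · have h1 := hW (hmemL 1 one_ne_zero (by simp)) C
      rw [Pi.add_apply, hdivN C _ hC, hDN C hC] at h1
      rw [hFN C hC]
      exact h1
  · intro R hR
    have hcR := h.isCharted.containsConst hR.1
    -- Choose a finite a different from the value of Y at the point. The member given by (Y - a)² is
    -- twice the fibre over a, which misses the point.
    obtain ⟨a, ha⟩ : ∃ a : ℂ, (Y - const a)⁻¹ ∈ R.toSubring := by
      rcases h.right_mem_or hR.1 with h1 | h1
      · by_cases h0 : Y - const 0 ∈ maxIdeal R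
        · refine ⟨1, inv_mem_of_notMem_maxIdeal (sub_mem h1 (hcR 1)) fun h2 => ?_⟩
          exact zero_ne_one (value_unique hcR h0 h2)
        · exact ⟨0, inv_mem_of_notMem_maxIdeal (sub_mem h1 (hcR 0)) h0⟩
      · refine ⟨0, ?_⟩
        rw [const, map_zero, sub_zero]
        exact h1.1
    have hr0 : (Polynomial.X - Polynomial.C a) ^ 2 ≠ 0 := pow_ne_zero 2 (Polynomial.X_sub_C_ne_zero a)
    have hrd : ((Polynomial.X - Polynomial.C a) ^ 2).natDegree ≤ 2 := by
      rw [Polynomial.natDegree_pow, Polynomial.natDegree_X_sub_C]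
    have hYa := hc.right_sub_ne_zero a
    refine ⟨_, ⟨_, hmemL _ hr0 hrd, rfl⟩, fun C hC hRC => ?_⟩
    have h1 := heff _ hr0 hrd C hC
    change (div S _ + D - F) C = 0
    rw [Pi.sub_apply, Pi.add_apply, hdivC C _ hC, hordG _ hr0 C hC]
    have haev : Polynomial.aeval Y ((Polynomial.X - Polynomial.C a) ^ 2) = (Y - const a) ^ 2 := by
      simp
    rw [haev, ord_pow C hYa] at h1 ⊢
    have h2 := (mem_iff_ord_nonneg hC.2 (inv_ne_zero hYa)).mp (hRC ha)
    rw [ord_inv C hYa] at h2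
    have h3 : C = CI → ord C (Y - const a) = -1 := by
      rintro rfl
      exact (ord_infinity hc.symm hI).1 a
    push_cast at h1 ⊢
    split_ifs at h1 ⊢ with hCC
    · rw [h3 hCC]; ring
    · omega
  -- Since F is effective, a section of D - F is one of D, so `hsec` applies; conversely every G
  -- r(Y) vanishes along F by `hordG` and `heff`.
  · have hH0 : H0 S (D - F) = LinearMap.range (quadraticMap G Y) := by
      ext f
      constructor
      · intro hf
        rcases eq_or_ne f 0 with rfl | hf0
        · exact zero_mem _
        have hf' := hf hf0
        obtain ⟨r, hr, rfl⟩ := hsec f hf0 (by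
          intro C hC
          have h1 := hf' C
          simp only [Pi.add_apply, Pi.sub_apply, Pi.zero_apply, hdivC C _ hC] at h1
          have := hF0 C
          omega)
        exact ⟨_, exists_quadraticMap_eq G Y hr⟩
      · rintro ⟨a, rfl⟩ h0
        obtain ⟨r, hr, -, e⟩ := exists_aeval_eq_quadraticMap G Y a
        rw [e] at h0 ⊢
        have hr0 : r ≠ 0 := by
          rintro rfl
          exact h0 (by rw [map_zero, mul_zero])
        intro C
        simp only [Pi.add_apply, Pi.sub_apply, Pi.zero_apply]
        by_cases hC : IsCurve S C
        · rw [hdivC C _ hC]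
          have := hordG r hr0 C hC
          have := heff r hr0 hr C hC
          omega
        · rw [hdivN C _ hC, hDN C hC, hFN C hC]
          simp
    let e : (Fin 3 → ℂ) ≃ₗ[ℂ] H0 S (D - F) :=
      (LinearEquiv.ofInjective _ (quadraticMap_injective hG hc)).trans (LinearEquiv.ofEq _ _ hH0.symm)
    have he : ∀ a, (e a : K) = quadraticMap G Y a := fun a => rfl
    refine ⟨by rw [← e.finrank_eq]; simp, fun s => ?_⟩
    -- The rows are the coordinates of the basis s in terms of G, G Y, G Y².
    let M : Matrix (Fin 3) (Fin 3) ℂ := fun i => e.symm (s i)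
    have hM : IsUnit M := by
      rw [← Matrix.linearIndependent_rows_iff_isUnit]
      exact (s.map e.symm).linearIndependent
    -- The fibre X = d avoids all centres, and Y already takes every value on it.
    obtain ⟨d, hd⟩ : ∃ d : ℂ, d ∉ ({c, c'} : Set ℂ) := by
      exact (Set.toFinite ({c, c'} : Set ℂ)).exists_notMem
    simp only [Set.mem_insert_iff, Set.mem_singleton_iff, not_or] at hd
    refine isConic_of_quadratic (Y := Y) (G := G) hG hY hM (fun i => ?_)
      (fun R hR => h.isCharted.hasValues hR) (fun R hR => h.right_mem_or hR.1) (fun a => ?_) ?_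
    · rw [← quadraticMap_apply, ← he]
      simp [M]
    · obtain ⟨R, hR⟩ := ((hc.sub_left d).sub_right a).exists_isPt
      exact ⟨R, h.isClosedPoint_of_value
        (h.frame.mem_of_affine (by rw [affineRing_sub X Y d a]; exact hR.mem))
        hR.hasValues hR.left hd.1 hd.2, hR.right⟩
    · obtain ⟨R, hR⟩ := (hc.sub_left d).inv_right.exists_isPt
      exact ⟨R, h.isClosedPoint_of_value ((h.frame.mem_iff R).mpr ⟨X, by simp, Y⁻¹, by simp,
        by rw [affineRing_sub_left X Y⁻¹ d]; exact hR.mem⟩) hR.hasValues hR.left hd.1 hd.2,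
        hR.right⟩

end Config

/-! ### Images of local subrings under endomorphisms of `K` -/

section map

variable {φ : K →+* K} {R R' : LocalSubring K} {u v z : K}

theorem toSubring_map (φ : K →+* K) (R : LocalSubring K) :
    (R.map φ).toSubring = R.toSubring.map φ := rfl

theorem mem_map_iff : φ z ∈ (R.map φ).toSubring ↔ z ∈ R.toSubring := by
  rw [toSubring_map, Subring.mem_map]
  exact ⟨fun ⟨w, hw, e⟩ => φ.injective e ▸ hw, fun h => ⟨z, h, rfl⟩⟩

theorem mem_maxIdeal_map_iff : φ z ∈ maxIdeal (R.map φ) ↔ z ∈ maxIdeal R := by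
  rw [mem_maxIdeal, mem_maxIdeal, ← map_inv₀, mem_map_iff, mem_map_iff, map_eq_zero]

theorem LiesOn.map (h : LiesOn R R') (φ : K →+* K) : LiesOn (R.map φ) (R'.map φ) :=
  (Subring.gc_map_comap φ).monotone_l h

theorem mem_localRings_map {A : Subring K} (h : R ∈ localRings A) (φ : K →+* K) :
    R.map φ ∈ localRings (A.map φ) := by
  rw [mem_localRings_iff] at h ⊢
  refine ⟨(Subring.gc_map_comap φ).monotone_l h.1, ?_⟩
  rintro _ ⟨z, hz, rfl⟩
  obtain ⟨s, hs, t, ht, h0, hi, rfl⟩ := h.2 hz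
  refine ⟨φ s, ⟨s, hs, rfl⟩, φ t, ⟨t, ht, rfl⟩, (map_ne_zero φ).mpr h0, ?_, by simp⟩
  rw [← map_inv₀]
  exact mem_map_iff.mpr hi

/-- The twist τ allows one treatment of two cases: complex conjugation for the real structure and
the identity for the ℂ^*-action. -/
theorem affineRing_map {τ : ℂ ≃+* ℂ} (hτ : ∀ a, φ (const a) = const (τ a)) (u v : K) :
    (affineRing u v).map φ = affineRing (φ u) (φ v) := by
  apply le_antisymm
  · rw [Subring.map_le_iff_le_comap]
    refine affineRing_le (fun a => ?_) (left_mem_affineRing _ _) (right_mem_affineRing _ _)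
    rw [Subring.mem_comap, hτ]
    exact const_mem_affineRing _ _ _
  · refine affineRing_le (fun a => ⟨const (τ.symm a), const_mem_affineRing _ _ _, ?_⟩)
      ⟨u, left_mem_affineRing _ _, rfl⟩ ⟨v, right_mem_affineRing _ _, rfl⟩
    rw [hτ, RingEquiv.apply_symm_apply]

theorem mem_localRings_affineRing_map {τ : ℂ ≃+* ℂ} (hτ : ∀ a, φ (const a) = const (τ a))
    (h : R ∈ localRings (affineRing u v)) : R.map φ ∈ localRings (affineRing (φ u) (φ v)) := by
  rw [← affineRing_map hτ]
  exact mem_localRings_map h φ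

theorem IsPt.map {τ : ℂ ≃+* ℂ} (hτ : ∀ a, φ (const a) = const (τ a)) (h : IsPt u v R) :
    IsPt (φ u) (φ v) (R.map φ) :=
  ⟨mem_localRings_affineRing_map hτ h.mem, mem_maxIdeal_map_iff.mpr h.left,
    mem_maxIdeal_map_iff.mpr h.right⟩

theorem IsPt.map_mem_exceptionalFibre {τ : ℂ ≃+* ℂ} (hτ : ∀ a, φ (const a) = const (τ a))
    {P : LocalSubring K} (h : IsPt u v P) (hc : Coord u v) (hR : R ∈ exceptionalFibre P) :
    R.map φ ∈ exceptionalFibre (P.map φ) := by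
  have hu := (map_ne_zero φ).mpr hc.left_ne_zero
  have hv := (map_ne_zero φ).mpr hc.right_ne_zero
  rcases (h.exceptionalFibre_iff hc).mp hR with ⟨h1, h2⟩ | ⟨h1, h2⟩
  · have h3 := mem_localRings_affineRing_map hτ h1
    rw [map_div₀] at h3
    exact (h.map hτ).mem_exceptionalFibre hu h3 (mem_maxIdeal_map_iff.mpr h2)
  · have h3 := mem_localRings_affineRing_map hτ h1
    rw [map_div₀] at h3
    exact (h.map hτ).symm.mem_exceptionalFibre hv h3 (mem_maxIdeal_map_iff.mpr h2)

theorem IsDVR.map (h : IsDVR R) (φ : K →+* K) (hc : Coord u v)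
    (hA : affineRing u v ≤ (R.map φ).toSubring) : IsDVR (R.map φ) := by
  have := h.1
  have e : R.toSubring ≃+* (R.map φ).toSubring :=
    R.toSubring.equivMapOfInjective φ φ.injective
  exact ⟨IsDiscreteValuationRing.RingEquivClass.isDiscreteValuationRing e, hc.isFractionRing hA⟩

end map

/-! ### The real structure -/

theorem inv_neg_inv {F : Type*} [Field F] (a : F) : (-a⁻¹)⁻¹ = -a := by
  rw [inv_neg, inv_inv]

theorem subst_x (u v : K) (h : AlgebraicIndependent ℂ ![u, v]) : subst u v h x = u := by
  have h' : Function.Injective (MvPolynomial.aeval ![u, v] : MvPolynomial (Fin 2) ℂ →ₐ[ℂ] K) := h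
  change IsFractionRing.lift (K := K) h' (algebraMap _ _ (MvPolynomial.X 0)) = _
  rw [IsFractionRing.lift_algebraMap]
  simp

theorem subst_y (u v : K) (h : AlgebraicIndependent ℂ ![u, v]) : subst u v h y = v := by
  have h' : Function.Injective (MvPolynomial.aeval ![u, v] : MvPolynomial (Fin 2) ℂ →ₐ[ℂ] K) := h
  change IsFractionRing.lift (K := K) h' (algebraMap _ _ (MvPolynomial.X 1)) = _
  rw [IsFractionRing.lift_algebraMap]
  simp

theorem coeffConj_x : coeffConj x = x := by
  change IsFractionRing.ringEquivOfRingEquiv (K := K) (L := K)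
    (MvPolynomial.mapEquiv (Fin 2) (starRingAut (R := ℂ))) (algebraMap _ _ _) = _
  rw [IsFractionRing.ringEquivOfRingEquiv_algebraMap]
  simp [x]

theorem coeffConj_y : coeffConj y = y := by
  change IsFractionRing.ringEquivOfRingEquiv (K := K) (L := K)
    (MvPolynomial.mapEquiv (Fin 2) (starRingAut (R := ℂ))) (algebraMap _ _ _) = _
  rw [IsFractionRing.ringEquivOfRingEquiv_algebraMap]
  simp [y]

theorem algebraMap_C (a : ℂ) :
    algebraMap (MvPolynomial (Fin 2) ℂ) K (MvPolynomial.C a) = const a := by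
  rw [← MvPolynomial.algebraMap_eq, ← IsScalarTower.algebraMap_apply]

theorem coeffConj_const (a : ℂ) : coeffConj (const a) = const (star a) := by
  rw [← algebraMap_C, ← algebraMap_C]
  change IsFractionRing.ringEquivOfRingEquiv (K := K) (L := K)
    (MvPolynomial.mapEquiv (Fin 2) (starRingAut (R := ℂ))) (algebraMap _ _ _) = _
  rw [IsFractionRing.ringEquivOfRingEquiv_algebraMap]
  simp

theorem realStructure_x : realStructure x = x := by
  change subst x (-y⁻¹) algIndep_antipodal (coeffConj x) = x
  rw [coeffConj_x, subst_x]

theorem realStructure_y : realStructure y = -y⁻¹ := by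
  change subst x (-y⁻¹) algIndep_antipodal (coeffConj y) = _
  rw [coeffConj_y, subst_y]

theorem realStructure_const (a : ℂ) : realStructure (const a) = const (starRingAut a) := by
  change subst x (-y⁻¹) algIndep_antipodal (coeffConj (const a)) = _
  rw [coeffConj_const]
  exact AlgHom.commutes _ _

/-- It is enough to check constants and the two coordinates; for y this is -(-1/y)⁻¹ = y. -/
theorem realStructure_realStructure (z : K) : realStructure (realStructure z) = z := by
  obtain ⟨a, b, -, rfl⟩ := IsFractionRing.div_surjective (A := MvPolynomial (Fin 2) ℂ) z
  have hx : realStructure (realStructure x) = x := by rw [realStructure_x, realStructure_x]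
  have hy : realStructure (realStructure y) = y := by
    rw [realStructure_y, map_neg, map_inv₀, realStructure_y, inv_neg_inv, neg_neg]
  have hX : ∀ i : Fin 2, realStructure (realStructure
      (algebraMap (MvPolynomial (Fin 2) ℂ) K (MvPolynomial.X i))) =
        algebraMap (MvPolynomial (Fin 2) ℂ) K (MvPolynomial.X i) :=
    Fin.forall_fin_two.mpr ⟨hx, hy⟩
  have key : ∀ f : MvPolynomial (Fin 2) ℂ,
      realStructure (realStructure (algebraMap (MvPolynomial (Fin 2) ℂ) K f)) =
        algebraMap (MvPolynomial (Fin 2) ℂ) K f := by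
    intro f
    induction f using MvPolynomial.induction_on with
    | C a =>
      rw [algebraMap_C, realStructure_const, realStructure_const]
      simp
    | add f g hf hg => rw [map_add, map_add, map_add, hf, hg]
    | mul_X f i hf =>
      rw [map_mul, map_mul, map_mul, hf, hX i]
  rw [map_div₀, map_div₀, key, key]

theorem conj_conj (R : LocalSubring K) : conj (conj R) = R := by
  apply LocalSubring.toSubring_injective
  ext z
  have h1 : realStructure (realStructure z) ∈ (conj (conj R)).toSubring ↔ z ∈ R.toSubring :=
    mem_map_iff.trans mem_map_iff
  rwa [realStructure_realStructure] at h1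

theorem affineRing_neg_right (u v : K) : affineRing u (-v) = affineRing u v :=
  affineRing_eq (left_mem_affineRing _ _)
    (by simpa using neg_mem (right_mem_affineRing u (-v))) (left_mem_affineRing _ _)
    (neg_mem (right_mem_affineRing _ _))

/-- Up to sign, which does not change a chart, the antipodal map interchanges y and y⁻¹ and so
permutes the four charts. -/
theorem conj_mem_P1P1 {R : LocalSubring K} (h : R ∈ P1P1) : conj R ∈ P1P1 := by
  obtain ⟨u, hu, v, hv, hR⟩ := h
  have h1 := mem_localRings_affineRing_map realStructure_const hR
  have hu' : realStructure u = u := by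
    rcases hu with rfl | rfl
    · exact realStructure_x
    · rw [map_inv₀, realStructure_x]
  rw [hu'] at h1
  rcases hv with rfl | rfl
  · rw [realStructure_y, affineRing_neg_right] at h1
    exact ⟨u, hu, _, by simp, h1⟩
  · rw [map_inv₀, realStructure_y, inv_neg_inv, affineRing_neg_right] at h1
    exact ⟨u, hu, _, by simp, h1⟩

theorem IsCurve.conj {C : LocalSubring K} (h : IsCurve P1P1 C) : IsCurve P1P1 (conj C) := by
  have h1 := conj_mem_P1P1 h.1
  obtain ⟨u, hu, v, hv, hR⟩ := h1
  exact ⟨conj_mem_P1P1 h.1, h.2.map _ (coord_of_mem_pair coord_xy hu hv) (localRings_le hR)⟩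

theorem mem_maxIdeal_conj {R : LocalSubring K} {z : K} (h : z ∈ maxIdeal R) :
    realStructure z ∈ maxIdeal (conj R) := mem_maxIdeal_map_iff.mpr h

theorem realStructure_x_sub (c : ℂ) : realStructure (x - const c) = x - const (star c) := by
  rw [map_sub, realStructure_x, realStructure_const]; rfl

theorem IsFirstFibre.conj {c : ℂ} {C : LocalSubring K} (h : IsFirstFibre c C) :
    IsFirstFibre (star c) (conj C) := by
  refine ⟨h.1.conj, ?_⟩
  rw [← realStructure_x_sub]
  exact mem_maxIdeal_conj h.2

/-- The fibre over b goes to the fibre over minus the inverse of the conjugate of b; b = 0 and b = ∞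
are interchanged and need separate treatment. -/
theorem IsSecondFibre.conj {C : LocalSubring K} (h : IsSecondFibre C) :
    IsSecondFibre (conj C) := by
  refine ⟨h.1.conj, ?_⟩
  have hc : ContainsConst (BlowUpSurface.conj C) := isCharted_P1P1.containsConst h.1.conj.1
  rcases h.2 with ⟨b, hb⟩ | hb
  · have h1 := neg_mem_maxIdeal (mem_maxIdeal_conj hb)
    rw [map_sub, realStructure_y, realStructure_const,
      show -(-y⁻¹ - const (starRingAut b)) = y⁻¹ - const (-starRingAut b) by
        simp only [const, map_neg]; ring] at h1
    rcases eq_or_ne b 0 with rfl | hb0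
    · right
      simpa [const] using h1
    · left
      have := value_inv hc (neg_ne_zero.mpr ((map_ne_zero _).mpr hb0)) h1
      rw [inv_inv] at this
      exact ⟨_, this⟩
  · left
    have h1 := neg_mem_maxIdeal (mem_maxIdeal_conj hb)
    rw [map_inv₀, realStructure_y, inv_neg_inv, neg_neg] at h1
    exact ⟨0, by rwa [const, map_zero, sub_zero]⟩

/-! ### Changes of frame and fibres -/

section frame

variable {X Y u v : K} {R C : LocalSubring K}

theorem isFrame_xy : IsFrame x y := ⟨coord_xy, fun _ => Iff.rfl⟩

theorem IsFrame.inv_right (h : IsFrame X Y) : IsFrame X Y⁻¹ := by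
  refine ⟨h.coord.inv_right, fun R => ?_⟩
  rw [h.mem_iff, inv_inv, Set.pair_comm Y]

theorem const_zero : const 0 = 0 := map_zero _

theorem one_sub_inv_mem (hc : ContainsConst R) {z : K} (hz : z ∈ maxIdeal R) (e : ℂ) :
    (1 - const e * z)⁻¹ ∈ R.toSubring := by
  refine inv_mem_of_value hc one_ne_zero (a := 1) ?_
  rw [show 1 - const e * z - const 1 = const (-e) * z by
    simp only [const, map_neg, map_one]; ring]
  exact mul_mem_maxIdeal (hc _) hz

theorem inv_sub_const {z : K} (hz : z ≠ 0) (e : ℂ) :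
    (z - const e)⁻¹ = z⁻¹ * (1 - const e * z⁻¹)⁻¹ := by
  rw [← mul_inv]
  congr 1
  field_simp

/-- Only points with Y = ∞ need an argument: there (Y - e)⁻¹ is Y⁻¹ times the unit (1 - e Y⁻¹)⁻¹, so
either function serves as coordinate. -/
theorem exists_chart_sub_right (hY : Y ≠ 0) (e : ℂ) (h0 : Y - const e ≠ 0) {v : K}
    (hv : v ∈ ({Y, Y⁻¹} : Set K)) (hR : R ∈ localRings (affineRing u v)) :
    ∃ v' ∈ ({Y - const e, (Y - const e)⁻¹} : Set K), R ∈ localRings (affineRing u v') := by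
  have key : R ∈ localRings (affineRing u Y) → R ∈ localRings (affineRing u (Y - const e)) := by
    intro h
    rwa [← affineRing_sub_right]
  rcases hv with rfl | rfl
  · exact ⟨_, by simp, key hR⟩
  by_cases hm : Y⁻¹ ∈ maxIdeal R
  · have hc := containsConst_of_mem hR
    have h1 : 1 - const e * Y⁻¹ ∈ R.toSubring := sub_mem (one_mem _) (mul_mem (hc e) hm.1)
    have h2 := one_sub_inv_mem hc hm e
    have e1 := inv_sub_const hY e
    have e2 : (1 + const e * (Y - const e)⁻¹)⁻¹ = 1 - const e * Y⁻¹ := by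
      rw [inv_eq_iff_eq_inv]
      have : 1 - const e * Y⁻¹ = (Y - const e) * Y⁻¹ := by field_simp
      rw [this, mul_inv, inv_inv]
      field_simp
      ring
    have e3 : Y⁻¹ = (Y - const e)⁻¹ * (1 + const e * (Y - const e)⁻¹)⁻¹ := by
      rw [e2]
      field_simp
    have h3 : 1 + const e * (Y - const e)⁻¹ ≠ 0 := by
      intro h3
      rw [h3, inv_zero, mul_zero] at e3
      exact inv_ne_zero hY e3
    refine ⟨(Y - const e)⁻¹, by simp, mem_localRings_affineRing_of hR (left_mem_of_mem hR)
      (by rw [e1]; exact mul_mem hm.1 h2) (le_fractionsIn _ _ (left_mem_affineRing _ _)) ?_⟩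
    rw [e3]
    refine mul_mem (le_fractionsIn _ _ (right_mem_affineRing _ _)) (inv_mem_fractionsIn
      (add_mem (one_mem _) (mul_mem (const_mem_affineRing _ _ e) (right_mem_affineRing _ _))) h3 ?_)
    rw [e2]
    exact h1
  · exact ⟨_, by simp, key (mem_localRings_of_inv_right hR hY hm)⟩

theorem IsFrame.sub_right (h : IsFrame X Y) (e : ℂ) : IsFrame X (Y - const e) := by
  have hY := h.coord.right_ne_zero
  have h0 := h.coord.right_sub_ne_zero e
  refine ⟨h.coord.sub_right e, fun R => ?_⟩
  rw [h.mem_iff]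
  constructor
  · rintro ⟨u, hu, v, hv, hR⟩
    exact ⟨u, hu, exists_chart_sub_right hY e h0 hv hR⟩
  · rintro ⟨u, hu, v, hv, hR⟩
    have e1 : Y - const e - const (-e) = Y := by simp only [const, map_neg]; ring
    have := exists_chart_sub_right h0 (-e) (by rwa [e1]) hv hR
    rw [e1] at this
    exact ⟨u, hu, this⟩

theorem IsFrame.mem_localRings (h : IsFrame X Y) (hR : R ∈ P1P1) (hX : X ∈ R.toSubring)
    (hY : Y ∈ R.toSubring) : R ∈ localRings (affineRing X Y) := by
  have h1 : X⁻¹ ∉ maxIdeal R :=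
    notMem_maxIdeal_of_inv_mem (inv_ne_zero h.coord.left_ne_zero) (by rwa [inv_inv])
  have h2 : Y⁻¹ ∉ maxIdeal R :=
    notMem_maxIdeal_of_inv_mem (inv_ne_zero h.coord.right_ne_zero) (by rwa [inv_inv])
  rcases h.cases hR with h3 | h3 | h3 | h3
  · exact h3
  · exact absurd h3.2 h1
  · exact absurd h3.2 h2
  · exact absurd h3.2.1 h1

/-- A point on the fibre `X = c`, `c ≠ 0`, of the first projection. -/
theorem IsFrame.left_value_of_liesOn (h : IsFrame X Y) (hR : R ∈ P1P1) (hRC : LiesOn R C) {c : ℂ}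
    (hc : c ≠ 0) (hC : X - const c ∈ maxIdeal C) : X - const c ∈ maxIdeal R := by
  have hcR := isCharted_P1P1.containsConst hR
  have hcC : ContainsConst C := fun a => hRC (hcR a)
  -- On the curve X⁻¹ has the value c⁻¹, which is nonzero and so excludes X = ∞; this is where c ≠ 0
  -- enters.
  have key : X⁻¹ ∉ maxIdeal R := by
    intro h1
    have h2 := value_of_liesOn hRC hcR h1.1 (value_inv hcC hc hC)
    refine inv_ne_zero hc (value_unique hcR h2 (b := 0) ?_)
    rwa [const, map_zero, sub_zero]
  have hX : X ∈ R.toSubring := by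
    rcases h.cases hR with h3 | h3 | h3 | h3
    · exact left_mem_of_mem h3
    · exact absurd h3.2 key
    · exact left_mem_of_mem h3.1
    · exact absurd h3.2.1 key
  exact value_of_liesOn hRC hcR hX hC

theorem IsFrame.right_mem_or (h : IsFrame X Y) (hR : R ∈ P1P1) :
    Y ∈ R.toSubring ∨ Y⁻¹ ∈ maxIdeal R := by
  rcases h.cases hR with h1 | h1 | h1 | h1
  · exact Or.inl (right_mem_of_mem h1)
  · exact Or.inl (right_mem_of_mem h1.1)
  · exact Or.inr h1.2
  · exact Or.inr h1.2.2

theorem IsFrame.isDv_of_left_mem (h : IsFrame X Y) (hC : IsCurve P1P1 C) {c : ℂ}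
    (hm : X - const c ∈ maxIdeal C) : IsDv (X - const c) Y C := by
  have hcC := isCharted_P1P1.containsConst hC.1
  rcases h.curve_cases hC.1 hC.2 with h1 | h1 | h1
  · rw [affineRing_sub_left X Y c] at h1
    exact isDv_of_isDVR (h.coord.sub_left c) h1 hm hC.2
  · refine absurd h1.left (notMem_maxIdeal_of_inv_mem (inv_ne_zero h.coord.left_ne_zero) ?_)
    rw [inv_inv]
    exact mem_of_sub_const_mem hcC hm.1
  · exact absurd hm (h1.right_notMem c)

theorem IsFrame.isDv_of_right_mem (h : IsFrame X Y) (hC : IsCurve P1P1 C) {b : ℂ}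
    (hm : Y - const b ∈ maxIdeal C) : IsDv (Y - const b) X C := by
  have hcC := isCharted_P1P1.containsConst hC.1
  rcases h.curve_cases hC.1 hC.2 with h1 | h1 | h1
  · rw [affineRing_sub_right X Y b, affineRing_comm] at h1
    exact isDv_of_isDVR (h.coord.symm.sub_left b) h1 hm hC.2
  · exact absurd hm (h1.right_notMem b)
  · refine absurd h1.left (notMem_maxIdeal_of_inv_mem (inv_ne_zero h.coord.right_ne_zero) ?_)
    rw [inv_inv]
    exact mem_of_sub_const_mem hcC hm.1

theorem inv_sub_const_mem_maxIdeal (hc : ContainsConst R) {z : K} (hz0 : z ≠ 0)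
    (hz : z⁻¹ ∈ maxIdeal R) (e : ℂ) : (z - const e)⁻¹ ∈ maxIdeal R := by
  rw [inv_sub_const hz0]
  exact mul_mem_maxIdeal' hz (one_sub_inv_mem hc hz e)

theorem inv_sub_const_mem (hR : R ∈ P1P1) {e : ℂ} (he : y - const e ∉ maxIdeal R) :
    (y - const e)⁻¹ ∈ R.toSubring := by
  have hc := isCharted_P1P1.containsConst hR
  rcases isFrame_xy.right_mem_or hR with h1 | h1
  · exact inv_mem_of_notMem_maxIdeal (sub_mem h1 (hc e)) he
  · exact (inv_sub_const_mem_maxIdeal hc y_ne_zero h1 e).1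

/-- Each point excludes at most one value e, namely its own value of y. With e chosen off a finite
set, all centres lie in one affine plane. -/
theorem exists_inv_sub_const_mem {Z : Set (LocalSubring K)} (hZ : Z.Finite) (hZP : Z ⊆ P1P1) :
    ∃ e : ℂ, ∀ R ∈ Z, (y - const e)⁻¹ ∈ R.toSubring := by
  have hfin : (⋃ R ∈ Z, {e : ℂ | y - const e ∈ maxIdeal R}).Finite :=
    hZ.biUnion fun R hR => Set.Subsingleton.finite fun a ha b hb =>
      value_unique (isCharted_P1P1.containsConst (hZP hR)) ha hb
  obtain ⟨e, he⟩ := hfin.exists_notMem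
  refine ⟨e, fun R hR => inv_sub_const_mem (hZP hR) fun hm => he ?_⟩
  simp only [Set.mem_iUnion]
  exact ⟨R, hR, hm⟩

/-- The member of `|𝒪(0,1)|` through a given point. -/
theorem IsSecondFibre.isDv (hC : IsSecondFibre C) {e b : ℂ}
    (hcR : ContainsConst R) (hRC : LiesOn R C) (hm : (y - const e)⁻¹ - const b ∈ maxIdeal R) :
    IsDv ((y - const e)⁻¹ - const b) x C := by
  have hcC := isCharted_P1P1.containsConst hC.1.1
  have hYR : (y - const e)⁻¹ ∈ R.toSubring := mem_of_sub_const_mem hcR hm.1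
  have hF := (isFrame_xy.sub_right e).inv_right
  obtain ⟨b', hb'⟩ : ∃ b' : ℂ, (y - const e)⁻¹ - const b' ∈ maxIdeal C := by
    rcases hC.2 with ⟨β, hβ⟩ | hβ
    · have h1 : (y - const e) - const (β - e) ∈ maxIdeal C := by
        rwa [show y - const e - const (β - e) = y - const β by
          simp only [const, map_sub]; ring]
      refine ⟨_, value_inv hcC ?_ h1⟩
      intro h0
      rw [h0, const_zero, sub_zero] at h1
      exact notMem_maxIdeal_of_inv_mem (coord_xy.right_sub_ne_zero e) (hRC hYR) h1
    · refine ⟨0, ?_⟩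
      rw [const_zero, sub_zero]
      exact inv_sub_const_mem_maxIdeal hcC y_ne_zero hβ e
  have := value_unique hcR hm (value_of_liesOn hRC hcR hYR hb')
  rw [this]
  exact hF.isDv_of_right_mem hC.1 hb'

theorem IsDv.sub_right (h : IsDv u v R) (a : ℂ) : IsDv u (v - const a) R := by
  refine ⟨by rw [← affineRing_sub_right]; exact h.mem, h.left, fun p hp => ?_⟩
  have h1 := h.right (p.comp (Polynomial.X - Polynomial.C a)) (by
    rw [Polynomial.aeval_comp]
    simpa using hp)
  have h2 := congrArg (fun q => q.comp (Polynomial.X + Polynomial.C a)) h1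
  simpa [Polynomial.comp_assoc] using h2

/-- The strict transform of the curve `u = 0` in the chart `u / v`, `v`. -/
theorem IsDv.div_left (h : IsDv u v R) (hv : v ≠ 0) : IsDv (u / v) v R := by
  have h1 : u / v ∈ maxIdeal R := by
    rw [div_eq_mul_inv]
    exact mul_mem_maxIdeal' h.left h.right_inv_mem
  refine ⟨mem_localRings_affineRing_of h.mem h1.1 (right_mem_of_mem h.mem) ?_
    (le_fractionsIn _ _ (right_mem_affineRing _ _)), h1, h.right⟩
  refine le_fractionsIn _ _ ?_
  have := mul_mem (left_mem_affineRing (u / v) v) (right_mem_affineRing (u / v) v)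
  rwa [div_mul_cancel₀ _ hv] at this

end frame

/-! ### The `ℂ^*`-action -/

section act

variable {c : ℂ} {hc : c.im ≠ 0} {t : ℂˣ} {R : LocalSubring K}

theorem sub_star_ne_zero (hc : c.im ≠ 0) : c - star c ≠ 0 := by
  intro h
  apply hc
  have := congrArg Complex.im h
  simp at this
  linarith

theorem act_const (a : ℂ) : (act c hc t : K →+* K) (const a) = const (RingEquiv.refl ℂ a) :=
  (act c hc t).commutes a

theorem act_y : (act c hc t : K →+* K) y = y := subst_y _ _ (algIndep_flow c hc t)

theorem act_x : (act c hc t : K →+* K) x = flow c t := subst_x _ _ (algIndep_flow c hc t)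

/-- The denominator of the action on `x - c`. -/
theorem value_denominator (hcR : ContainsConst R) (hR : x - const c ∈ maxIdeal R) (t : ℂ) :
    (const (c - star c) + const (1 - t) * (x - const c)) - const (c - star c) ∈ maxIdeal R := by
  rw [add_sub_cancel_left]
  exact mul_mem_maxIdeal (hcR _) hR

theorem denominator_ne_zero (hc : c.im ≠ 0) (t : ℂ) :
    const (c - star c) + const (1 - t) * (x - const c) ≠ 0 := by
  obtain ⟨R, hR⟩ := (coord_xy.sub_left c).exists_isPt
  intro h0
  have h1 := value_denominator hR.containsConst hR.left t
  rw [h0] at h1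
  refine sub_star_ne_zero hc (value_unique hR.containsConst h1 (b := 0) ?_)
  rw [const_zero, sub_zero]
  exact zero_mem_maxIdeal

/-- The factor by which the action multiplies `x - c`. -/
def multiplier (c t : ℂ) : K :=
  const (t * (c - star c)) * (const (c - star c) + const (1 - t) * (x - const c))⁻¹

theorem act_x_sub : (act c hc t : K →+* K) (x - const c) = multiplier c t * (x - const c) := by
  have hd := denominator_ne_zero hc t
  have e : x - const (star c) - const t * (x - const c) =
      const (c - star c) + const (1 - t) * (x - const c) := by
    simp only [const, map_sub, map_one]; ring
  rw [map_sub, act_x, act_const, flow, multiplier, e, ← div_eq_mul_inv, div_mul_eq_mul_div,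
    div_sub' hd, div_left_inj' hd]
  simp only [const, map_sub, map_one, map_mul, RingEquiv.refl_apply]
  ring

theorem multiplier_ne_zero (hc : c.im ≠ 0) (t : ℂˣ) : multiplier c t ≠ 0 :=
  mul_ne_zero ((map_ne_zero _).mpr (mul_ne_zero t.ne_zero (sub_star_ne_zero hc)))
    (inv_ne_zero (denominator_ne_zero hc t))

/-- The action has weight t in the direction normal to the fixed curve x = c. -/
theorem value_multiplier (hc : c.im ≠ 0) (hcR : ContainsConst R) (hR : x - const c ∈ maxIdeal R)
    (t : ℂ) : multiplier c t - const t ∈ maxIdeal R := by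
  have hδ := sub_star_ne_zero hc
  have h1 := value_mul hcR (value_const (t * (c - star c)))
    (value_inv hcR hδ (value_denominator hcR hR t))
  rwa [mul_inv_cancel_right₀ hδ] at h1

theorem multiplier_inv_mem (hc : c.im ≠ 0) (hcR : ContainsConst R)
    (hR : x - const c ∈ maxIdeal R) (t : ℂˣ) : (multiplier c t)⁻¹ ∈ R.toSubring :=
  inv_mem_of_value hcR t.ne_zero (value_multiplier hc hcR hR t)

/-- The Möbius relation is solved for x - c; the denominator that appears has the nonzero value t (c
- star c). Hence moved points still lie on x = c. -/
theorem sub_mem_maxIdeal_of_act (hc : c.im ≠ 0) (hcR : ContainsConst R)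
    (hR : multiplier c t * (x - const c) ∈ maxIdeal R) : x - const c ∈ maxIdeal R := by
  have hδ := sub_star_ne_zero hc
  have htδ : (t : ℂ) * (c - star c) ≠ 0 := mul_ne_zero t.ne_zero hδ
  have hd := denominator_ne_zero hc t
  set U := multiplier c t * (x - const c) with hU
  have e1 : U * (const (c - star c) + const (1 - t) * (x - const c)) =
      const (t * (c - star c)) * (x - const c) := by
    rw [hU, multiplier]
    field_simp
  have e2 : (x - const c) * (const (t * (c - star c)) + const (t - 1) * U) =
      const (c - star c) * U := by
    simp only [const, map_sub, map_one, map_mul] at e1 ⊢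
    linear_combination -e1
  have h1 : (const (t * (c - star c)) + const (t - 1) * U) - const (t * (c - star c)) ∈
      maxIdeal R := by
    rw [add_sub_cancel_left]
    exact mul_mem_maxIdeal (hcR _) hR
  have h2 := inv_mem_of_value hcR htδ h1
  have h0 : const (t * (c - star c)) + const (t - 1) * U ≠ 0 := by
    intro h0
    rw [h0] at h1
    refine htδ (value_unique hcR h1 (b := 0) ?_)
    rw [const_zero, sub_zero]
    exact zero_mem_maxIdeal
  rw [eq_div_of_mul_eq h0 e2, div_eq_mul_inv]
  exact mul_mem_maxIdeal' (mul_mem_maxIdeal (hcR _) hR) h2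

/-- A point of the fixed curve `x = c` with coordinates that are semi-invariant is fixed. -/
theorem IsPt.isFixed {v w : K} (h : IsPt v w R) (hu : x - const c ∈ maxIdeal R)
    (hv : ∀ t, (act c hc t : K →+* K) v = v)
    (hw : ∀ t, (act c hc t : K →+* K) w = w ∨ (act c hc t : K →+* K) w = multiplier c t * w) :
    IsFixed c hc R := by
  intro t
  have hR' := h.map (φ := (act c hc t : K →+* K)) act_const
  have hcR := h.containsConst
  have hcR' := hR'.containsConst
  have hu' : x - const c ∈ maxIdeal (R.map (act c hc t : K →+* K)) := by
    have := mem_maxIdeal_map_iff (φ := (act c hc t : K →+* K)) |>.mpr hu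
    rw [act_x_sub] at this
    exact sub_mem_maxIdeal_of_act hc hcR' this
  have h1 := mem_of_sub_const_mem hcR (value_multiplier hc hcR hu t).1
  have h2 := multiplier_inv_mem hc hcR' hu' t
  have hm := multiplier_ne_zero hc t
  have hw1 : (act c hc t : K →+* K) w ∈ R.toSubring := by
    rcases hw t with e | e <;> rw [e]
    · exact h.right.1
    · exact mul_mem h1 h.right.1
  have hw2 : w ∈ maxIdeal (R.map (act c hc t : K →+* K)) := by
    have h3 := hR'.right
    rcases hw t with e | e <;> rw [e] at h3
    · exact h3
    · have := mul_mem_maxIdeal h2 h3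
      rwa [inv_mul_cancel_left₀ hm] at this
  have hv2 := hR'.left
  rw [hv t] at hv2
  have hle := h.le_of_mem hcR' hv2 hw2
  refine (eq_of_localRings_of_le hR'.mem (affineRing_le hcR ?_ hw1) hle).symm
  rw [hv t]
  exact h.left.1

/-- At a fixed point, a function that is multiplied by `t⁻¹` takes the value `0`. -/
theorem IsFixed.eq_zero_of_value (hR : IsFixed c hc R) (hcR : ContainsConst R)
    (hu : x - const c ∈ maxIdeal R) {v : K} (hv : ∀ t, (act c hc t : K →+* K) v = v) {a : ℂ}
    (ha : v / (x - const c) - const a ∈ maxIdeal R) : a = 0 := by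
  have h2 : (2 : ℂ) ≠ 0 := two_ne_zero
  -- Invariance under a single t ≠ 1 is enough: with t = 2 the value satisfies a = 2a.
  set t : ℂˣ := Units.mk0 2 h2 with ht
  have h1 := mem_maxIdeal_map_iff (φ := (act c hc t : K →+* K)) |>.mpr ha
  rw [hR t, map_sub, map_div₀, hv, act_x_sub, act_const] at h1
  have h3 := value_mul hcR h1 (value_multiplier hc hcR hu t)
  have hm := multiplier_ne_zero hc t
  have e : v / (multiplier c t * (x - const c)) * multiplier c t = v / (x - const c) := by
    have := x_ne_const c
    field_simp
  rw [e] at h3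
  have h4 := value_unique hcR ha h3
  simp only [RingEquiv.refl_apply, ht, Units.val_mk0] at h4
  linear_combination -h4

end act

/-! ### The isolated fixed points on the exceptional curves -/

section fixedPoint

variable {ι : Type} {Y : K} {c : ℂ} {b b' : ι → ℂ} {p p' : ι → LocalSubring K}
  {R : LocalSubring K}

/-- The points of the blow-up over one of the centres. -/
theorem mem_exceptionalFibre_of_le (hF : IsFrame x Y) (hc : c.im ≠ 0)
    (hp : ∀ i, IsPt (x - const c) (Y - const (b i)) (p i))
    (hp' : ∀ i, IsPt (x - const (star c)) (Y - const (b' i)) (p' i))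
    (hb : Function.Injective b) {k : ι}
    (hR : R ∈ blowUp P1P1 (Set.range p ∪ Set.range p')) (hle : p k ≤ R) :
    R ∈ exceptionalFibre (p k) := by
  have hcR : ContainsConst R := fun a => mem_of_le hle ((hp k).containsConst a)
  have hpk : p k ∈ P1P1 := hF.mem_of_affine (by
    rw [affineRing_sub x Y c (b k)]; exact (hp k).mem)
  rcases mem_blowUp_iff.mp hR with ⟨h1, h2⟩ | ⟨P, ⟨j, rfl⟩ | ⟨j, rfl⟩, h1⟩
  · exact absurd (Or.inl ⟨k, hF.eq_of_le h1 hpk hle⟩) h2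
  · have : b k = b j := value_unique hcR (mem_maxIdeal_of_le hle (hp k).right)
      (mem_maxIdeal_of_le h1.1 (hp j).right)
    rwa [hb this]
  · have : c = star c := value_unique hcR (mem_maxIdeal_of_le hle (hp k).left)
      (mem_maxIdeal_of_le h1.1 (hp' j).left)
    exact absurd (sub_eq_zero.mpr this) (sub_star_ne_zero hc)

/-- The curve `x = c` consists of fixed points. -/
theorem isFixed_of_liesOn (hF : IsFrame x Y) (hc : c.im ≠ 0)
    (hY : ∀ t, (act c hc t : K →+* K) Y = Y)
    (hp : ∀ i, IsPt (x - const c) (Y - const (b i)) (p i))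
    (hp' : ∀ i, IsPt (x - const (star c)) (Y - const (b' i)) (p' i))
    {C : LocalSubring K} (hC : IsDv (x - const c) Y C)
    (hR : R ∈ blowUp P1P1 (Set.range p ∪ Set.range p')) (hv : HasValues R) (hRC : LiesOn R C) :
    IsFixed c hc R := by
  have hc0 : c ≠ 0 := by
    rintro rfl
    exact hc rfl
  have hYb : ∀ b t, (act c hc t : K →+* K) (Y - const b) = Y - const b := fun b t => by
    rw [map_sub, hY, act_const]; rfl
  rcases mem_blowUp_iff.mp hR with ⟨h1, -⟩ | ⟨P, ⟨j, rfl⟩ | ⟨j, rfl⟩, h1⟩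
  · have hm := hF.left_value_of_liesOn h1 hRC hc0 hC.left
    have hxR := mem_of_sub_const_mem hv.1 hm.1
    rcases hF.right_mem_or h1 with h2 | h2
    · obtain ⟨b, hb⟩ := hv.2 Y h2
      have hPt : IsPt (Y - const b) (x - const c) R := ⟨by
        rw [affineRing_comm, ← affineRing_sub]
        exact hF.mem_localRings h1 hxR h2, hb, hm⟩
      exact hPt.isFixed hm (hYb b) fun t => Or.inr act_x_sub
    · have hPt : IsPt Y⁻¹ (x - const c) R := ⟨by
        rw [affineRing_comm, ← affineRing_sub_left]
        exact hF.inv_right.mem_localRings h1 hxR h2.1, h2, hm⟩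
      exact hPt.isFixed hm (fun t => by rw [map_inv₀, hY]) fun t => Or.inr act_x_sub
  -- Where the strict transform of x = c meets an exceptional curve, local coordinates are the
  -- invariant Y - bⱼ and the ratio (x - c)/(Y - bⱼ), which scales by the multiplier.
  · have hPt := (hp j).symm.isPt_of_liesOn_strictTransform
      ((hF.coord.sub_left c).sub_right (b j)).symm h1 (hC.sub_right (b j)) hRC
    refine hPt.isFixed (mem_maxIdeal_of_le h1.1 (hp j).left) (hYb _) fun t => Or.inr ?_
    rw [map_div₀, act_x_sub, hYb, mul_div_assoc]
  · have h2 := mem_maxIdeal_of_le h1.1 (hp' j).left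
    have h3 := value_of_liesOn hRC hv.1 (mem_of_sub_const_mem hv.1 h2.1) hC.left
    exact absurd (sub_eq_zero.mpr (value_unique hv.1 h3 h2)) (sub_star_ne_zero hc)

/-- The isolated fixed point on the exceptional curve over `p k` is the point in the direction of
the invariant curve `Y = b k`. -/
theorem IsIsolatedFixedPoint.isPt [Finite ι] (hF : IsFrame x Y) (hc : c.im ≠ 0)
    (hY : ∀ t, (act c hc t : K →+* K) Y = Y)
    (hp : ∀ i, IsPt (x - const c) (Y - const (b i)) (p i))
    (hp' : ∀ i, IsPt (x - const (star c)) (Y - const (b' i)) (p' i))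
    (hb : Function.Injective b) {C : LocalSubring K} (hC : IsDv (x - const c) Y C) {k : ι}
    (hR : IsIsolatedFixedPoint c hc (blowUp P1P1 (Set.range p ∪ Set.range p')) R)
    (hle : p k ≤ R) : IsPt (x - const c) ((Y - const (b k)) / (x - const c)) R := by
  have hcoord : ∀ c b, Coord (x - const c) (Y - const b) := fun c b =>
    (hF.coord.sub_left c).sub_right b
  have hch : IsCharted (blowUp P1P1 (Set.range p ∪ Set.range p')) := by
    refine isCharted_P1P1.blowUp ((Set.finite_range p).union (Set.finite_range p')) ?_
    rintro P (⟨i, rfl⟩ | ⟨i, rfl⟩)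
    · exact ⟨_, _, hcoord _ _, hp i⟩
    · exact ⟨_, _, hcoord _ _, hp' i⟩
  obtain ⟨hcl, hfix, hiso⟩ := hR
  have hv := hch.hasValues hcl
  have hYb : ∀ t, (act c hc t : K →+* K) (Y - const (b k)) = Y - const (b k) := fun t => by
    rw [map_sub, hY, act_const]; rfl
  have hu := mem_maxIdeal_of_le hle (hp k).left
  have hE := mem_exceptionalFibre_of_le hF hc hp hp' hb hcl.1 hle
  -- In the first chart the slope (Y - bₖ)/(x - c) scales with a nontrivial weight, so it is 0 at a
  -- fixed point. In the second chart a nonzero inverse slope is excluded likewise, and inverse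
  -- slope 0 means a point on the pointwise fixed curve C₁, which is not isolated.
  rcases ((hp k).exceptionalFibre_iff (hcoord _ _)).mp hE with ⟨h1, -⟩ | ⟨h1, h2⟩
  · obtain ⟨a, ha⟩ := hv.2 _ (right_mem_of_mem h1)
    have := hfix.eq_zero_of_value hv.1 hu hYb ha
    rw [this, const_zero, sub_zero] at ha
    exact ⟨h1, hu, ha⟩
  · obtain ⟨a, ha⟩ := hv.2 _ (right_mem_of_mem h1)
    rcases eq_or_ne a 0 with rfl | ha0
    · rw [const_zero, sub_zero] at ha
      have hPt : IsPt (Y - const (b k)) ((x - const c) / (Y - const (b k))) R := ⟨h1, h2, ha⟩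
      have hCD := hC.sub_right (b k)
      refine absurd ⟨C, ⟨mem_blowUp_iff.mpr (Or.inl ⟨hF.mem_of_affine ?_, ?_⟩),
        hC.isDVR (hF.coord.sub_left c)⟩, hPt.liesOn (hCD.div_left (hcoord c (b k)).right_ne_zero),
        fun R' hR' hR'C => isFixed_of_liesOn hF hc hY hp hp' hC hR'.1 (hch.hasValues hR') hR'C⟩ hiso
      · rw [affineRing_sub_left x Y c]
        exact hC.mem
      · have hD := hC.isDVR (hF.coord.sub_left c)
        rintro (⟨i, rfl⟩ | ⟨i, rfl⟩)
        · exact (hp i).not_isDVR (hcoord _ _) hD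
        · exact (hp' i).not_isDVR (hcoord _ _) hD
    · have h3 := value_inv hv.1 ha0 ha
      rw [inv_div] at h3
      exact absurd (hfix.eq_zero_of_value hv.1 hu hYb h3) (inv_ne_zero ha0)

end fixedPoint

end BlowUpSurface

end

/-! ### Reduction of the geometric data to the normal form -/

open BlowUpSurface in
theorem mainTheorem10 (n : ℕ) (hn : 4 ≤ n)
    -- a non-real curve `C₁ ∈ |𝒪(1,0)|` and `n - 1` points on it
    (c : ℂ) (hc : c.im ≠ 0) (C₁ : LocalSubring K) (hC₁ : IsFirstFibre c C₁)
    (p : Fin (n - 1) → LocalSubring K) (hp_inj : Function.Injective p)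
    (hp : ∀ i, IsClosedPoint P1P1 (p i) ∧ LiesOn (p i) C₁)
    -- the first blow-up
    (S' : Set (LocalSubring K))
    (hS' : S' = blowUp P1P1 (Set.range p ∪ conj '' Set.range p))
    -- an isolated fixed point, on the exceptional curve over one of the points, and the second
    -- blow-up
    (k : Fin (n - 1)) (q : LocalSubring K) (hq : IsIsolatedFixedPoint c hc S' q) (hqk : p k ≤ q)
    (S : Set (LocalSubring K)) (hS : S = blowUp S' {q, conj q})
    -- the exceptional curve over `p k`, and the member of `|𝒪(0,1)|` through `p k`, which
    -- contains none of the conjugate points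
    (C₂ C₄ : LocalSubring K) (hC₂ : IsCurve S' C₂ ∧ p k ≤ C₂)
    (hC₄ : IsSecondFibre C₄ ∧ LiesOn (p k) C₄)
    (hgen : ∀ i, ¬ LiesOn (conj (p i)) C₄)
    (KS : LocalSubring K → ℤ) (hKS : IsCanonicalDivisor S KS)
    (F : LocalSubring K → ℤ)
    (hF : F = 2 • single C₁ + single C₂ + single C₄ +
      2 • single (conj C₁) + single (conj C₂) + single (conj C₄)) :
    IsFixedPart (linearSystem S ((-2 : ℤ) • KS)) F ∧
    IsBasePointFree S (movablePart (linearSystem S ((-2 : ℤ) • KS)) F) ∧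
    Module.finrank ℂ (H0 S ((-2 : ℤ) • KS - F)) = 3 ∧
    ∀ s : Module.Basis (Fin 3) ℂ (H0 S ((-2 : ℤ) • KS - F)),
      (∀ R, IsClosedPoint S R → ∃! P, TakesValue (fun i => (s i : K)) R P) ∧
      IsConic {P | ∃ R, IsClosedPoint S R ∧ TakesValue (fun i => (s i : K)) R P} := by
  have hc0 : c ≠ 0 := by
    rintro rfl
    exact hc rfl
  have hp' : ∀ i, conj (p i) ∈ P1P1 := fun i => conj_mem_P1P1 (hp i).1.1
  have hZfin : (Set.range p ∪ conj '' Set.range p).Finite :=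
    (Set.finite_range p).union ((Set.finite_range p).image _)
  obtain ⟨e, he⟩ := exists_inv_sub_const_mem hZfin (by
    rintro _ (⟨i, rfl⟩ | ⟨_, ⟨i, rfl⟩, rfl⟩)
    · exact (hp i).1.1
    · exact hp' i)
  have hY : ∀ i, (y - const e)⁻¹ ∈ (p i).toSubring := fun i => he _ (Or.inl ⟨i, rfl⟩)
  have hY' : ∀ i, (y - const e)⁻¹ ∈ (conj (p i)).toSubring :=
    fun i => he _ (Or.inr ⟨_, ⟨i, rfl⟩, rfl⟩)
  have hF' : IsFrame x (y - const e)⁻¹ := (isFrame_xy.sub_right e).inv_right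
  have hact : ∀ t, (act c hc t : K →+* K) (y - const e)⁻¹ = (y - const e)⁻¹ := fun t => by
    rw [map_inv₀, map_sub, act_y, act_const]; rfl
  -- the points on the two fibres
  have hx : ∀ i, x - const c ∈ maxIdeal (p i) := fun i =>
    isFrame_xy.left_value_of_liesOn (hp i).1.1 (hp i).2 hc0 hC₁.2
  have hx' : ∀ i, x - const (star c) ∈ maxIdeal (conj (p i)) := fun i => by
    rw [← realStructure_x_sub]
    exact mem_maxIdeal_conj (hx i)
  have hval' : ∀ i, HasValues (conj (p i)) := fun i => by
    obtain ⟨u, v, -, h⟩ := isCharted_P1P1.exists_isPt (hp i).1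
    exact (h.map realStructure_const).hasValues
  choose b hb using fun i => (isCharted_P1P1.hasValues (hp i).1).2 _ (hY i)
  choose b' hb' using fun i => (hval' i).2 _ (hY' i)
  have hcc := fun i => (isCharted_P1P1.hasValues (hp i).1).1
  have hcc' := fun i => (hval' i).1
  have hPt : ∀ i, IsPt (x - const c) ((y - const e)⁻¹ - const (b i)) (p i) := fun i => ⟨by
    rw [← affineRing_sub]
    exact hF'.mem_localRings (hp i).1.1 (mem_of_sub_const_mem (hcc i) (hx i).1) (hY i), hx i, hb i⟩
  have hPt' : ∀ i, IsPt (x - const (star c)) ((y - const e)⁻¹ - const (b' i)) (conj (p i)) :=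
    fun i => ⟨by
      rw [← affineRing_sub]
      exact hF'.mem_localRings (hp' i) (mem_of_sub_const_mem (hcc' i) (hx' i).1) (hY' i),
      hx' i, hb' i⟩
  have hb_inj : Function.Injective b := by
    intro i j hij
    refine hp_inj ((hPt i).eq ?_)
    rw [hij]
    exact hPt j
  have hb_inj' : Function.Injective b' := by
    intro i j hij
    have h1 : conj (p i) = conj (p j) := by
      refine (hPt' i).eq ?_
      rw [hij]
      exact hPt' j
    exact hp_inj (by rw [← conj_conj (p i), h1, conj_conj])
  -- the curves
  have hD₁ := hF'.isDv_of_left_mem hC₁.1 hC₁.2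
  have hD₁' := hF'.isDv_of_left_mem hC₁.conj.1 hC₁.conj.2
  have hD₄ := hC₄.1.isDv (hcc k) hC₄.2 (hb k)
  have hD₄' := hC₄.1.conj.isDv (hcc' k) (hC₄.2.map realStructure) (hb' k)
  -- Equal second coordinates would place a conjugate point on C₄; `hgen₂` is this statement after
  -- conjugation.
  have hgen₁ : ∀ i, b k ≠ b' i := by
    intro i h
    refine hgen i ((hPt' i).liesOn ?_)
    rw [← h]
    exact hD₄.sub_right _
  have hgen₂ : ∀ i, b' k ≠ b i := by
    intro i h
    refine hgen i ?_
    have h1 : LiesOn (p i) (conj C₄) := (hPt i).liesOn (by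
      rw [← h]
      exact hD₄'.sub_right _)
    have h2 : LiesOn (conj (p i)) (conj (conj C₄)) := h1.map realStructure
    rwa [conj_conj] at h2
  -- the first blow-up
  have hrange : conj '' Set.range p = Set.range fun i => conj (p i) := (Set.range_comp conj p).symm
  rw [hrange] at hS'
  subst hS'
  have hcoord : ∀ a b, Coord (x - const a) ((y - const e)⁻¹ - const b) := fun a b =>
    (hF'.coord.sub_left a).sub_right b
  have hqPt := hq.isPt hF' hc hact hPt hPt' hb_inj hD₁ hqk
  have hqE := mem_exceptionalFibre_of_le hF' hc hPt hPt' hb_inj hq.1.1 hqk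
  have hqE' : conj q ∈ exceptionalFibre (conj (p k)) :=
    (hPt k).map_mem_exceptionalFibre realStructure_const (hcoord _ _) hqE
  -- q is where the exceptional curve meets the strict transform of C₄. This description is carried
  -- over by the real structure, so the coordinates at conj q follow with no formula for the
  -- conjugate of Y.
  have hqC₄ : LiesOn q C₄ :=
    hqPt.liesOn ((hD₄.sub_right c).div_left (hcoord c (b k)).left_ne_zero)
  have hqPt' := (hPt' k).isPt_of_liesOn_strictTransform (hcoord _ _) hqE'
    (hD₄'.sub_right (star c)) (hqC₄.map realStructure)
  have hC₂E := mem_exceptionalFibre_of_le hF' hc hPt hPt' hb_inj hC₂.1.1 hC₂.2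
  have hD₂ := (hPt k).isDv_of_exceptionalFibre (hcoord _ _) hC₂E hC₂.1.2
  have hC₂E' : conj C₂ ∈ exceptionalFibre (conj (p k)) :=
    (hPt k).map_mem_exceptionalFibre realStructure_const (hcoord _ _) hC₂E
  have hD₂' := (hPt' k).isDv_of_exceptionalFibre (hcoord _ _) hC₂E'
    (hC₂.1.2.map realStructure (hcoord (star c) (b' k))
      ((localRings_le (hPt' k).mem).trans fun z hz => mem_of_le hC₂E'.1 hz))
  have hconfig : Config x (y - const e)⁻¹ c (star c) b b' k S := {
    frame := hF'
    ne := sub_ne_zero.mp (sub_star_ne_zero hc)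
    inj := hb_inj
    inj' := hb_inj'
    card := by rw [Fintype.card_fin]; omega
    gen := hgen₁
    gen' := hgen₂
    exists_points := ⟨p, fun i => conj (p i), q, conj q, hPt, hPt', hqPt, hqPt', hS⟩ }
  exact hconfig.bianticanonical
    ⟨hD₁, hD₂, hD₄, hD₁', hD₂', hD₄'⟩ hKS hF
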